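/- A \emph{Jordan algebra} is a finite-dimensional commutative (not necessarily associative) complex algebra $J$ with unity $e$ such that $x^2(xy)=x(x^2y)$ for all $x,y\in J$. Its \emph{rank} is the dimension of the subalgebra spanned by $e$ and a general element $x\in J$, and its \emph{radical} $R$ is its largest nil ideal. Products of basis vectors not listed below and not obtained by commutativity are zero. For $0\le r\le 3$ let $\mathcal J^4_{q,r}=\mathbb C\oplus\mathbb C^3$ with product $(\lambda,w)(\lambda',w')=(\lambda\lambda'-\sum_{i=1}^r w_iw'_i,\ \lambda w'+\lambda' w)$. Define sixteen 5-dimensional algebras as follows. (i) $\mathcal J^5_1,\dots,\mathcal J^5_5$ are the unitalizations $\mathbb Ce\oplus\mathcal R$ of the algebras $\mathcal R$ with basis $v_1,\dots,v_4$ and products, respectively: $v_1^2=v_3,\ v_1v_2=v_4$; $\ v_1^2=v_2^2=v_3,\ v_1v_2=v_4$; $\ v_1^2=v_4$; $\ v_1^2=v_2^2=v_4$; $\ v_1^2=v_2^2=v_3^2=v_4$. (ii) $\mathcal J^5_6,\dots,\mathcal J^5_{12}$ have a basis $e_1,e_2,a,b,d$ with $e_1^2=e_1$, $e_2^2=e_2$,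 $e_1a=a$ and the following further products. For $\mathcal J^5_6,\mathcal J^5_7,\mathcal J^5_8,\mathcal J^5_9$: $e_1b=e_2b=\tfrac12 b$, $e_1d=e_2d=\tfrac12 d$, and in addition: nothing for $\mathcal J^5_6$; $b^2=a$ for $\mathcal J^5_7$; $b^2=d^2=a$ for $\mathcal J^5_8$; $ab=d$ for $\mathcal J^5_9$. For $\mathcal J^5_{10},\mathcal J^5_{11}$: $e_1b=b$, $e_1d=e_2d=\tfrac12 d$, and in addition $d^2=a$ for $\mathcal J^5_{11}$. For $\mathcal J^5_{12}$: $e_1b=b$, $e_1d=d$. (iii) $\mathcal J^5_{13}$ has a basis $e_1,e_2,e_3,a,b$ with $e_i^2=e_i$ for $i=1,2,3$, $e_1a=e_2a=\tfrac12a$, $e_1b=e_3b=\tfrac12b$. (iv) $\mathcal J^5_{14}=\mathbb C\times\mathcal J^4_{q,1}$, $\mathcal J^5_{15}=\mathbb C\times\mathcal J^4_{q,2}$, $\mathcal J^5_{16}=\mathbb C\times\mathcal J^4_{q,3}$. \textbf{Theorem.} The algebras $\mathcal J^5_1,\dots,\mathcal J^5_{16}$ are pairwise non-isomorphic Jordan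 algebras of dimension 5 and rank 3, with radical of dimension $4$ for $k\le 5$, $3$ for $6\le k\le 12$, $2$ for $k=13,14$, $1$ for $k=15$ and $0$ for $k=16$. Every Jordan algebra of dimension 5 and rank 3 is isomorphic to exactly one of them. -/

import Mathlib

open Module

noncomputable section

namespace Jordan3

/-! ### Notions for commutative unital complex algebras -/

section Notions

variable (J : Type*) [NonAssocCommRing J] [Module ℂ J] [IsScalarTower ℂ J J] [SMulCommClass ℂ J J]

/-- `J` has rank `r`: the subalgebra spanned by the unity and a general element `x` has dimension
`r`, where "general" means: for all `x` outside the zero locus of a suitable nonzero polynomial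
in the coordinates of `x` in some basis of the finite-dimensional space `J`. -/
def HasRank (r : ℕ) : Prop :=
  ∃ (n : ℕ) (b : Basis (Fin n) ℂ J) (p : MvPolynomial (Fin n) ℂ), p ≠ 0 ∧
    ∀ x : J, MvPolynomial.eval (b.repr x) p ≠ 0 →
      finrank ℂ (NonUnitalAlgebra.adjoin ℂ ({1, x} : Set J)) = r

variable {J}

/-- Powers `x ^ k` in a (power-associative) algebra. -/
def jpow (x : J) : ℕ → J
  | 0 => 1
  | k + 1 => x * jpow x k

/-- A nil ideal of `J`: an ideal all of whose elements are nilpotent. -/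
structure IsNilIdeal (I : Submodule ℂ J) : Prop where
  mul_mem : ∀ x : J, ∀ y ∈ I, x * y ∈ I
  nil : ∀ y ∈ I, ∃ k : ℕ, jpow y k = 0

/-- The radical of `J`: its largest nil ideal. -/
def IsRadical (R : Submodule ℂ J) : Prop :=
  IsGreatest {I : Submodule ℂ J | IsNilIdeal I} R

/-- Isomorphism of complex algebras. -/
def Isomorphic (J J' : Type*) [NonAssocCommRing J] [Module ℂ J] [NonAssocCommRing J']
    [Module ℂ J'] : Prop :=
  ∃ f : J ≃ₗ[ℂ] J', ∀ x y : J, f (x * y) = f x * f y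

end Notions

/-- A (bundled) commutative complex algebra with unity, not assumed associative. -/
structure UnitalCommAlg where
  carrier : Type
  [ring : NonAssocCommRing carrier]
  [module : Module ℂ carrier]
  [isScalarTower : IsScalarTower ℂ carrier carrier]
  [smulCommClass : SMulCommClass ℂ carrier carrier]

instance : CoeSort UnitalCommAlg Type := ⟨UnitalCommAlg.carrier⟩

attribute [instance] UnitalCommAlg.ring UnitalCommAlg.module UnitalCommAlg.isScalarTower
  UnitalCommAlg.smulCommClass

/-! ### Algebras given by multiplication tables -/

/-- A symmetric multiplication table: the entry `(i, j)` is the product of the basis vectors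
`i` and `j`. -/
structure MulTable (n : ℕ) where
  entry : Matrix (Fin n) (Fin n) (Fin n → ℂ)
  symm : entry.IsSymm

/-- The commutative algebra `ℂⁿ` whose standard basis multiplies according to the table `T`. -/
def MulTable.Alg {n : ℕ} (_T : MulTable n) : Type := Fin n → ℂ

section MulTableAlg

variable {n : ℕ} (T : MulTable n)

instance : AddCommGroup T.Alg := inferInstanceAs (AddCommGroup (Fin n → ℂ))

instance : Module ℂ T.Alg := inferInstanceAs (Module ℂ (Fin n → ℂ))

/-- The bilinear extension of the table. -/
def MulTable.mul (x y : Fin n → ℂ) : Fin n → ℂ :=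
  ∑ i, ∑ j, (x i * y j) • T.entry i j

theorem MulTable.mul_comm' (x y : Fin n → ℂ) : T.mul x y = T.mul y x := by
  unfold MulTable.mul
  rw [Finset.sum_comm]
  refine Finset.sum_congr rfl fun i _ => Finset.sum_congr rfl fun j _ => ?_
  rw [mul_comm, T.symm.apply]

theorem MulTable.mul_add' (x y z : Fin n → ℂ) : T.mul x (y + z) = T.mul x y + T.mul x z := by
  simp [MulTable.mul, mul_add, add_smul, Finset.sum_add_distrib]

theorem MulTable.mul_smul' (c : ℂ) (x y : Fin n → ℂ) : T.mul x (c • y) = c • T.mul x y := by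
  simp [MulTable.mul, Finset.smul_sum, smul_smul, mul_left_comm]

theorem MulTable.mul_zero' (x : Fin n → ℂ) : T.mul x 0 = 0 := by
  simp [MulTable.mul]

instance : NonUnitalNonAssocCommRing T.Alg where
  mul x y := T.mul x y
  left_distrib x y z := T.mul_add' x y z
  right_distrib x y z := (T.mul_comm' _ z).trans ((T.mul_add' z x y).trans
    (congrArg₂ (fun u w : Fin n → ℂ => u + w) (T.mul_comm' z x) (T.mul_comm' z y)))
  zero_mul x := (T.mul_comm' 0 x).trans (T.mul_zero' x)
  mul_zero x := T.mul_zero' x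
  mul_comm x y := T.mul_comm' x y

instance : IsScalarTower ℂ T.Alg T.Alg where
  smul_assoc c x y := (T.mul_comm' _ y).trans ((T.mul_smul' c y x).trans
    (congrArg (fun u : Fin n → ℂ => c • u) (T.mul_comm' y x)))

instance : SMulCommClass ℂ T.Alg T.Alg where
  smul_comm c x y := (T.mul_smul' c x y).symm

/-- The algebra of a table, when `u` is a unity for it. -/
def MulTable.toUnital (u : Fin n → ℂ)
    (hu : ∀ j, ∑ i, u i • T.entry i j = Pi.single j 1) : UnitalCommAlg :=
  have one_mul' : ∀ x : Fin n → ℂ, T.mul u x = x := fun x => by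
    unfold MulTable.mul
    rw [Finset.sum_comm]
    have h : ∀ j, ∑ i, (u i * x j) • T.entry i j = x j • Pi.single j (1 : ℂ) := fun j => by
      rw [← hu j, Finset.smul_sum]
      exact Finset.sum_congr rfl fun i _ => by rw [smul_smul, mul_comm]
    simp only [h]
    exact (pi_eq_sum_univ' x).symm
  { carrier := T.Alg
    ring :=
      { (inferInstance : NonUnitalNonAssocCommRing T.Alg) with
        one := u
        one_mul := one_mul'
        mul_one := fun x => by
          rw [mul_comm]
          exact one_mul' x } }

end MulTableAlg

/-! ### Unitalizations, direct products with `ℂ`, and the algebras `ℂ ⊕ W` of quadratic forms -/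

/-- The unitalization `ℂ e ⊕ A` of a commutative algebra `A`. -/
def unitalization (A : Type) [NonUnitalNonAssocCommRing A] [Module ℂ A] [IsScalarTower ℂ A A]
    [SMulCommClass ℂ A A] : UnitalCommAlg where
  carrier := Unitization ℂ A
  ring :=
    { (inferInstance : NonAssocRing (Unitization ℂ A)) with
      mul_comm := fun x y => by
        ext
        · simp [mul_comm]
        · simp [mul_comm, add_comm] }
  isScalarTower := ⟨fun c x y => by
    ext
    · simp [mul_assoc]
    · simp [smul_add, smul_smul, mul_comm y.fst c, smul_mul_assoc]⟩
  smulCommClass := ⟨fun c x y => by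
    ext
    · simp [mul_left_comm]
    · simp [smul_add, smul_smul, mul_comm, mul_smul_comm]⟩

/-- The direct product `ℂ × J`. -/
def prodC (J : UnitalCommAlg) : UnitalCommAlg where
  carrier := ℂ × J
  ring :=
    { (inferInstance : NonAssocRing (ℂ × J)) with
      mul_comm := fun x y => by ext <;> simp [mul_comm] }

/-- The polarization `q(w, w')` of the quadratic form `q(w) = w₁² + ⋯ + w_r²` on `ℂⁿ`. -/
def quadPol {n : ℕ} (r : ℕ) (w w' : Fin n → ℂ) : ℂ :=
  ∑ i : Fin n, if i.val < r then w i * w' i else 0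

/-- The product `(l, w) (l', w') = (l l' - q(w, w'), l w' + l' w)`. -/
def quadMul {n : ℕ} (r : ℕ) (x y : ℂ × (Fin n → ℂ)) : ℂ × (Fin n → ℂ) :=
  (x.1 * y.1 - quadPol r x.2 y.2, x.1 • y.2 + y.1 • x.2)

theorem quadPol_comm {n : ℕ} (r : ℕ) (w w' : Fin n → ℂ) : quadPol r w w' = quadPol r w' w := by
  simp [quadPol, mul_comm]

theorem quadPol_add {n : ℕ} (r : ℕ) (w v v' : Fin n → ℂ) :
    quadPol r w (v + v') = quadPol r w v + quadPol r w v' := by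
  unfold quadPol
  rw [← Finset.sum_add_distrib]
  refine Finset.sum_congr rfl fun i _ => ?_
  split_ifs <;> simp [mul_add]

theorem quadPol_smul {n : ℕ} (r : ℕ) (c : ℂ) (w v : Fin n → ℂ) :
    quadPol r w (c • v) = c * quadPol r w v := by
  simp [quadPol, Finset.mul_sum, mul_left_comm]

theorem quadMul_comm {n : ℕ} (r : ℕ) (x y : ℂ × (Fin n → ℂ)) : quadMul r x y = quadMul r y x := by
  simp [quadMul, quadPol_comm r x.2 y.2, mul_comm, add_comm]

theorem quadMul_add {n : ℕ} (r : ℕ) (x y z : ℂ × (Fin n → ℂ)) :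
    quadMul r x (y + z) = quadMul r x y + quadMul r x z := by
  ext
  · simp [quadMul, quadPol_add]; ring
  · simp [quadMul]; ring

theorem quadMul_smul {n : ℕ} (r : ℕ) (c : ℂ) (x y : ℂ × (Fin n → ℂ)) :
    quadMul r x (c • y) = c • quadMul r x y := by
  ext
  · simp [quadMul, quadPol_smul]; ring
  · simp [quadMul]; ring

theorem quadMul_one {n : ℕ} (r : ℕ) (x : ℂ × (Fin n → ℂ)) : quadMul r x (1, 0) = x := by
  ext <;> simp [quadMul, quadPol]

theorem quadMul_zero {n : ℕ} (r : ℕ) (x : ℂ × (Fin n → ℂ)) : quadMul r x 0 = 0 := by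
  ext <;> simp [quadMul, quadPol]

/-- The space `ℂ ⊕ W` with `W = ℂⁿ`, to be endowed with the product `quadMul r`. -/
def QuadSpace (n _r : ℕ) : Type := ℂ × (Fin n → ℂ)

section QuadSpace

variable (n r : ℕ)

instance : AddCommGroup (QuadSpace n r) := inferInstanceAs (AddCommGroup (ℂ × (Fin n → ℂ)))

instance : Module ℂ (QuadSpace n r) := inferInstanceAs (Module ℂ (ℂ × (Fin n → ℂ)))

instance : NonAssocCommRing (QuadSpace n r) where
  mul x y := quadMul r x y
  one := ((1, 0) : ℂ × (Fin n → ℂ))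
  left_distrib x y z := quadMul_add r x y z
  right_distrib x y z := (quadMul_comm r _ z).trans ((quadMul_add r z x y).trans
    (congrArg₂ (fun u w : ℂ × (Fin n → ℂ) => u + w) (quadMul_comm r z x) (quadMul_comm r z y)))
  zero_mul x := (quadMul_comm r 0 x).trans (quadMul_zero r x)
  mul_zero x := quadMul_zero r x
  one_mul x := (quadMul_comm r _ _).trans (quadMul_one r x)
  mul_one x := quadMul_one r x
  mul_comm x y := quadMul_comm r x y

instance : IsScalarTower ℂ (QuadSpace n r) (QuadSpace n r) where
  smul_assoc c x y := (quadMul_comm r _ y).trans ((quadMul_smul r c y x).trans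
    (congrArg (fun u : ℂ × (Fin n → ℂ) => c • u) (quadMul_comm r y x)))

instance : SMulCommClass ℂ (QuadSpace n r) (QuadSpace n r) where
  smul_comm c x y := (quadMul_smul r c x y).symm

/-- The algebra `ℂ ⊕ W` with `W = ℂⁿ`, of dimension `n + 1`, for the quadratic form
`w₁² + ⋯ + w_r²` on `W`. -/
def quadAlg : UnitalCommAlg where
  carrier := QuadSpace n r

end QuadSpace

/-! ### The five nilalgebras of dimension 4 (basis `v₁, …, v₄` = `v 0, …, v 3`) -/

/-- The standard basis vectors of `ℂ⁴`. -/
abbrev v (i : Fin 4) : Fin 4 → ℂ := Pi.single i 1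

/-- `v₁² = v₃`, `v₁ v₂ = v₄`. -/
def nil1 : MulTable 4 where
  entry := !![v 2, v 3, 0, 0;
              v 3,   0, 0, 0;
                0,   0, 0, 0;
                0,   0, 0, 0]
  symm := by ext1 i j; fin_cases i <;> fin_cases j <;> rfl

/-- `v₁² = v₂² = v₃`, `v₁ v₂ = v₄`. -/
def nil2 : MulTable 4 where
  entry := !![v 2, v 3, 0, 0;
              v 3, v 2, 0, 0;
                0,   0, 0, 0;
                0,   0, 0, 0]
  symm := by ext1 i j; fin_cases i <;> fin_cases j <;> rfl

/-- `v₁² = v₄`. -/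
def nil3 : MulTable 4 where
  entry := !![v 3, 0, 0, 0;
                0, 0, 0, 0;
                0, 0, 0, 0;
                0, 0, 0, 0]
  symm := by ext1 i j; fin_cases i <;> fin_cases j <;> rfl

/-- `v₁² = v₂² = v₄`. -/
def nil4 : MulTable 4 where
  entry := !![v 3,   0, 0, 0;
                0, v 3, 0, 0;
                0,   0, 0, 0;
                0,   0, 0, 0]
  symm := by ext1 i j; fin_cases i <;> fin_cases j <;> rfl

/-- `v₁² = v₂² = v₃² = v₄`. -/
def nil5 : MulTable 4 where
  entry := !![v 3,   0,   0, 0;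
                0, v 3,   0, 0;
                0,   0, v 3, 0;
                0,   0,   0, 0]
  symm := by ext1 i j; fin_cases i <;> fin_cases j <;> rfl

/-! ### The tables in the basis `e₁, e₂, a, b, d`, and the one in the basis `e₁, e₂, e₃, a, b` -/

/-- The standard basis vectors of `ℂ⁵`. -/
abbrev s (i : Fin 5) : Fin 5 → ℂ := Pi.single i 1

/-- Half of the standard basis vectors of `ℂ⁵`. -/
abbrev h (i : Fin 5) : Fin 5 → ℂ := Pi.single i (1 / 2)

def table6 : MulTable 5 where
  entry := !![s 0,   0, s 2, h 3, h 4;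
                0, s 1,   0, h 3, h 4;
              s 2,   0,   0,   0,   0;
              h 3, h 3,   0,   0,   0;
              h 4, h 4,   0,   0,   0]
  symm := by ext1 i j; fin_cases i <;> fin_cases j <;> rfl

def table7 : MulTable 5 where
  entry := !![s 0,   0, s 2, h 3, h 4;
                0, s 1,   0, h 3, h 4;
              s 2,   0,   0,   0,   0;
              h 3, h 3,   0, s 2,   0;
              h 4, h 4,   0,   0,   0]
  symm := by ext1 i j; fin_cases i <;> fin_cases j <;> rfl

def table8 : MulTable 5 where
  entry := !![s 0,   0, s 2, h 3, h 4;
                0, s 1,   0, h 3, h 4;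
              s 2,   0,   0,   0,   0;
              h 3, h 3,   0, s 2,   0;
              h 4, h 4,   0,   0, s 2]
  symm := by ext1 i j; fin_cases i <;> fin_cases j <;> rfl

def table9 : MulTable 5 where
  entry := !![s 0,   0, s 2, h 3, h 4;
                0, s 1,   0, h 3, h 4;
              s 2,   0,   0, s 4,   0;
              h 3, h 3, s 4,   0,   0;
              h 4, h 4,   0,   0,   0]
  symm := by ext1 i j; fin_cases i <;> fin_cases j <;> rfl

def table10 : MulTable 5 where
  entry := !![s 0,   0, s 2, s 3, h 4;
                0, s 1,   0,   0, h 4;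
              s 2,   0,   0,   0,   0;
              s 3,   0,   0,   0,   0;
              h 4, h 4,   0,   0,   0]
  symm := by ext1 i j; fin_cases i <;> fin_cases j <;> rfl

def table11 : MulTable 5 where
  entry := !![s 0,   0, s 2, s 3, h 4;
                0, s 1,   0,   0, h 4;
              s 2,   0,   0,   0,   0;
              s 3,   0,   0,   0,   0;
              h 4, h 4,   0,   0, s 2]
  symm := by ext1 i j; fin_cases i <;> fin_cases j <;> rfl

def table12 : MulTable 5 where
  entry := !![s 0,   0, s 2, s 3, s 4;
                0, s 1,   0,   0,   0;
              s 2,   0,   0,   0,   0;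
              s 3,   0,   0,   0,   0;
              s 4,   0,   0,   0,   0]
  symm := by ext1 i j; fin_cases i <;> fin_cases j <;> rfl

def table13 : MulTable 5 where
  entry := !![s 0,   0,   0, h 3, h 4;
                0, s 1,   0, h 3,   0;
                0,   0, s 2,   0, h 4;
              h 3, h 3,   0,   0,   0;
              h 4,   0, h 4,   0,   0]
  symm := by ext1 i j; fin_cases i <;> fin_cases j <;> rfl

/-- The unity `e₁ + e₂`. -/
abbrev unit2 : Fin 5 → ℂ := ![1, 1, 0, 0, 0]

/-- The unity `e₁ + e₂ + e₃`. -/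
abbrev unit3 : Fin 5 → ℂ := ![1, 1, 1, 0, 0]

/-- The sixteen algebras; the algebra with number `k = 1, …, 16` is `J5 (k - 1)`. -/
def J5 : Fin 16 → UnitalCommAlg := ![
  unitalization nil1.Alg,
  unitalization nil2.Alg,
  unitalization nil3.Alg,
  unitalization nil4.Alg,
  unitalization nil5.Alg,
  table6.toUnital unit2 (by
    intro j
    ext k
    fin_cases j <;> fin_cases k <;>
      simp [Fin.sum_univ_succ, table6] <;>
      norm_num),
  table7.toUnital unit2 (by
    intro j
    ext k
    fin_cases j <;> fin_cases k <;>
      simp [Fin.sum_univ_succ, table7] <;>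
      norm_num),
  table8.toUnital unit2 (by
    intro j
    ext k
    fin_cases j <;> fin_cases k <;>
      simp [Fin.sum_univ_succ, table8] <;>
      norm_num),
  table9.toUnital unit2 (by
    intro j
    ext k
    fin_cases j <;> fin_cases k <;>
      simp [Fin.sum_univ_succ, table9] <;>
      norm_num),
  table10.toUnital unit2 (by
    intro j
    ext k
    fin_cases j <;> fin_cases k <;>
      simp [Fin.sum_univ_succ, table10] <;>
      norm_num),
  table11.toUnital unit2 (by
    intro j
    ext k
    fin_cases j <;> fin_cases k <;>
      simp [Fin.sum_univ_succ, table11] <;>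
      norm_num),
  table12.toUnital unit2 (by
    intro j
    ext k
    fin_cases j <;> fin_cases k <;>
      simp [Fin.sum_univ_succ, table12] <;>
      norm_num),
  table13.toUnital unit3 (by
    intro j
    ext k
    fin_cases j <;> fin_cases k <;>
      simp [Fin.sum_univ_succ, table13] <;>
      norm_num),
  prodC (quadAlg 3 1),
  prodC (quadAlg 3 2),
  prodC (quadAlg 3 3)]

end Jordan3

end

noncomputable section

/-! Rank three means that every element satisfies a monic cubic (`HasRank.exists_cubic`) while some
element satisfies no monic quadratic (`HasRank.exists_not_quadratic`). Linear independence of powers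
is a Zariski-open condition, so what holds for a general element bounds the degree for all elements.
The classification splits according to the idempotents, and in each case the rank bound cuts the
Peirce decomposition down to a short list of multiplication tables.

If 0 and 1 are the only idempotents, the cubic of any element has a triple root in the sense of
`exists_sub_smul_one_cube`: the element is a scalar plus something with vanishing cube. The trace of
multiplication picks out that scalar, so its kernel N is a nil hyperplane closed under products. A
computation special to dimension four gives (xy)z = 0 on N, and N is then governed either by one
quadratic form with values in a line, or by a binary quadratic form that expresses the only relation
among the products of two generators. Over ℂ these have the normal forms of the first five algebras.

If there are three orthogonal nonzero idempotents with sum 1, rank three makes the diagonal Peirce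
spaces one-dimensional, so the three off-diagonal ones have total dimension two. The pattern (2,0,0)
gives ℂ times a quadratic-form algebra, and (1,1,0) gives the algebra with index 12.

Otherwise take complementary idempotents e and f. Each diagonal Peirce space is a scalar line plus a
subspace of square-zero elements with zero product; rank three forces one of the two nil parts to
vanish and the other not to (`IsPair.nil_eq_bot`, `IsPair.nil_ne_bot`). Products of half-space
elements land in the surviving nil part (`IsPair.mul_self_mem`). That part has dimension 1, 2 or 3,
which yields indices 5 to 11.

For the converse the sixteen algebras are written as explicit products on ℂ⁵. Jordan identity,
generic cubic and radical are checked by coordinates, and non-isomorphism follows from the dimension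
of the radical, the traces of idempotents and a few properties of the elements with vanishing cube.
-/

namespace Jordan3

/-! ### Rank, generic powers and the degree of the elements -/

section Rank

variable {J : Type*} [NonAssocCommRing J] [Module ℂ J] [IsScalarTower ℂ J J] [SMulCommClass ℂ J J]

/-- Multiplication of `J` in coordinates with respect to a basis. -/
theorem repr_mul {ι : Type*} [Fintype ι] (b : Basis ι ℂ J) (x y : J) (i : ι) :
    b.repr (x * y) i = ∑ k, ∑ l, b.repr x k * b.repr y l * b.repr (b k * b l) i := by
  conv_lhs => rw [← b.sum_repr x, ← b.sum_repr y]
  simp only [Finset.sum_mul, Finset.mul_sum, smul_mul_assoc, mul_smul_comm, map_sum, map_smul,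
    Finsupp.coe_finsetSum, Finset.sum_apply, Finsupp.smul_apply, smul_eq_mul]
  rw [Finset.sum_comm]
  refine Finset.sum_congr rfl fun k _ => Finset.sum_congr rfl fun l _ => by ring

/-- The coordinates of the powers of `z` are polynomials in the coordinates of `z`. -/
theorem exists_jpow_poly {n : ℕ} (b : Basis (Fin n) ℂ J) (k : ℕ) :
    ∃ Q : Fin n → MvPolynomial (Fin n) ℂ, ∀ z i,
      MvPolynomial.eval (b.repr z) (Q i) = b.repr (jpow z k) i := by
  induction k with
  | zero => exact ⟨fun i => MvPolynomial.C (b.repr 1 i), fun z i => by simp [jpow]⟩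
  | succ k ih =>
    obtain ⟨Q, hQ⟩ := ih
    refine ⟨fun i => ∑ p, ∑ q, MvPolynomial.X p * Q q * MvPolynomial.C (b.repr (b p * b q) i),
      fun z i => ?_⟩
    rw [jpow, repr_mul]
    simp [hQ]

/-- Linear independence of powers of `z` is an open condition. -/
theorem exists_poly_linearIndependent {n : ℕ} (b : Basis (Fin n) ℂ J) {m : ℕ} (x₀ : J)
    (h : LinearIndependent ℂ (fun j : Fin m => jpow x₀ j)) :
    ∃ P : MvPolynomial (Fin n) ℂ, MvPolynomial.eval (b.repr x₀) P ≠ 0 ∧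
      ∀ z, MvPolynomial.eval (b.repr z) P ≠ 0 →
        LinearIndependent ℂ (fun j : Fin m => jpow z j) := by
  -- With F a left inverse of the combination map of the powers of `x₀`, the matrix with rows F(zⁱ)
  -- has entries polynomial in z and is the identity at `x₀`. Its determinant is the required
  -- polynomial.
  obtain ⟨F, hF⟩ := LinearMap.exists_leftInverse_of_injective
    (Fintype.linearCombination ℂ (fun j : Fin m => jpow x₀ j))
    (LinearMap.ker_eq_bot.2 h.fintypeLinearCombination_injective)
  choose Q hQ using fun k => exists_jpow_poly b k
  let A : Matrix (Fin m) (Fin m) (MvPolynomial (Fin n) ℂ) := Matrix.of fun i j =>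
    ∑ l, MvPolynomial.C (F (b l) j) * Q i l
  have hA : ∀ z, (MvPolynomial.eval (b.repr z)).mapMatrix A =
      Matrix.of fun i j : Fin m => F (jpow z i) j := by
    intro z
    ext i j
    simp only [A, RingHom.mapMatrix_apply, Matrix.map_apply, Matrix.of_apply, map_sum, map_mul,
      MvPolynomial.eval_C, hQ]
    conv_rhs => rw [← b.sum_repr (jpow z i), map_sum, Finset.sum_apply]
    exact Finset.sum_congr rfl fun l _ => by rw [map_smul, Pi.smul_apply, smul_eq_mul, mul_comm]
  refine ⟨A.det, ?_, fun z hz => ?_⟩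
  · rw [RingHom.map_det, hA]
    have : (Matrix.of fun i j : Fin m => F (jpow x₀ i) j) = 1 := by
      ext i j
      have := congrArg (fun f => f (Pi.single i 1) j) hF
      simp only [LinearMap.comp_apply, Fintype.linearCombination_apply_single, one_smul,
        LinearMap.id_apply] at this
      rw [Matrix.of_apply, this, Matrix.one_apply, Pi.single_apply]
      simp [eq_comm]
    rw [this]
    simp
  · rw [RingHom.map_det, hA] at hz
    exact LinearIndependent.of_comp F (Matrix.linearIndependent_rows_of_det_ne_zero hz)

theorem jpow_mem_adjoin (x : J) (k : ℕ) : jpow x k ∈ NonUnitalAlgebra.adjoin ℂ ({1, x} : Set J) := by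
  induction k with
  | zero => exact NonUnitalAlgebra.subset_adjoin ℂ (by simp [jpow])
  | succ k ih => exact mul_mem (NonUnitalAlgebra.subset_adjoin ℂ (by simp)) ih

/-- In an algebra of rank `r` the first `r + 1` powers of an element are dependent. -/
theorem HasRank.not_linearIndependent {r : ℕ} (h : HasRank J r) (x : J) :
    ¬ LinearIndependent ℂ (fun j : Fin (r + 1) => jpow x j) := by
  intro hx
  obtain ⟨n, b, p, hp, hr⟩ := h
  obtain ⟨P, hP, hz⟩ := exists_poly_linearIndependent b x hx
  -- Both conditions are nonempty and open, so some z satisfies both: its generated algebra has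
  -- dimension r but contains r + 1 independent powers.
  have hpP : p * P ≠ 0 := mul_ne_zero hp (by rintro rfl; simp at hP)
  obtain ⟨f, hf⟩ : ∃ f, MvPolynomial.eval f (p * P) ≠ 0 := by
    by_contra! hc
    exact hpP (MvPolynomial.funext fun f => by simpa using hc f)
  set z := b.equivFun.symm f with hzdef
  have hzf : (b.repr z : Fin n → ℂ) = f := b.equivFun.apply_symm_apply f
  rw [map_mul, ← hzf] at hf
  have h1 := hr z (left_ne_zero_of_mul hf)
  have h2 := hz z (right_ne_zero_of_mul hf)
  have : FiniteDimensional ℂ J := b.finiteDimensional_of_finite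
  have h3 : LinearIndependent ℂ
      (fun j : Fin (r + 1) => (⟨jpow z j, jpow_mem_adjoin z j⟩ :
        NonUnitalAlgebra.adjoin ℂ ({1, z} : Set J))) :=
    LinearIndependent.of_comp (NonUnitalSubalgebra.toSubmodule
      (NonUnitalAlgebra.adjoin ℂ ({1, z} : Set J))).subtype h2
  have : FiniteDimensional ℂ (NonUnitalAlgebra.adjoin ℂ ({1, z} : Set J)) :=
    inferInstanceAs (FiniteDimensional ℂ (NonUnitalSubalgebra.toSubmodule
      (NonUnitalAlgebra.adjoin ℂ ({1, z} : Set J))))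
  have := h3.fintype_card_le_finrank
  simp [h1] at this

/-- A subspace containing `1` and `x` and closed under products contains the algebra generated by
`1` and `x`. -/
theorem adjoin_le_of_mul_mem (x : J) (S : Submodule ℂ J) (h1 : (1 : J) ∈ S) (hx : x ∈ S)
    (hS : ∀ a ∈ S, ∀ b ∈ S, a * b ∈ S) :
    NonUnitalSubalgebra.toSubmodule (NonUnitalAlgebra.adjoin ℂ ({1, x} : Set J)) ≤ S := by
  let A : NonUnitalSubalgebra ℂ J :=
    { S with mul_mem' := fun {a b} ha hb => hS a ha b hb }
  have : NonUnitalAlgebra.adjoin ℂ ({1, x} : Set J) ≤ A := by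
    rw [NonUnitalAlgebra.adjoin_le_iff]
    rintro y (rfl | rfl)
    exacts [h1, hx]
  exact this

/-- In an algebra of rank three some element does not satisfy a quadratic equation. -/
theorem HasRank.exists_not_quadratic (h : HasRank J 3) :
    ∃ x : J, ∀ A B : ℂ, x * x ≠ A • x + B • (1 : J) := by
  obtain ⟨n, b, p, hp, hr⟩ := h
  obtain ⟨f, hf⟩ : ∃ f, MvPolynomial.eval f p ≠ 0 := by
    by_contra! hc
    exact hp (MvPolynomial.funext fun f => by simpa using hc f)
  refine ⟨b.equivFun.symm f, fun A B hx => ?_⟩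
  set x := b.equivFun.symm f
  have hxf : (b.repr x : Fin n → ℂ) = f := b.equivFun.apply_symm_apply f
  have h3 := hr x (by rwa [hxf])
  have hle := adjoin_le_of_mul_mem x (Submodule.span ℂ {1, x}) (Submodule.subset_span (by simp))
    (Submodule.subset_span (by simp)) (by
      intro a ha c hc
      rw [Submodule.mem_span_pair] at ha hc ⊢
      obtain ⟨a1, a2, rfl⟩ := ha
      obtain ⟨c1, c2, rfl⟩ := hc
      refine ⟨a1 * c1 + a2 * c2 * B, a1 * c2 + a2 * c1 + a2 * c2 * A, ?_⟩
      simp only [mul_add, add_mul, smul_mul_assoc, mul_smul_comm, one_mul, mul_one, hx]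
      module)
  have : FiniteDimensional ℂ J := b.finiteDimensional_of_finite
  have h4 := Submodule.finrank_mono hle
  have h5 : finrank ℂ (Submodule.span ℂ ({1, x} : Set J)) ≤ 2 := by
    classical
    have := finrank_span_finset_le_card (R := ℂ) ({1, x} : Finset J)
    simp only [Finset.coe_insert, Finset.coe_singleton] at this
    exact this.trans Finset.card_le_two
  have h6 : finrank ℂ (NonUnitalSubalgebra.toSubmodule
    (NonUnitalAlgebra.adjoin ℂ ({1, x} : Set J))) = 3 := h3
  omega

/-- In a Jordan algebra of rank three every element satisfies a cubic equation. -/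
theorem HasRank.exists_cubic (h : HasRank J 3) (x : J) :
    ∃ A B C : ℂ, x * (x * x) = A • (x * x) + B • x + C • (1 : J) := by
  have h1 := h.not_linearIndependent x
  rw [Fintype.not_linearIndependent_iff] at h1
  obtain ⟨g, hg, i, hi⟩ := h1
  replace hg : g 0 • (1 : J) + g 1 • x + g 2 • (x * x) + g 3 • (x * (x * x)) = 0 := by
    rw [← hg, Fin.sum_univ_four]
    simp [jpow]
  by_cases g3 : g 3 = 0
  · by_cases g2 : g 2 = 0
    · by_cases g1 : g 1 = 0
      · have g0 : g 0 ≠ 0 := by fin_cases i <;> simp_all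
        have h0 : (1 : J) = 0 := by simpa [g1, g2, g3, g0] using hg
        refine ⟨0, 0, 0, ?_⟩
        -- Here the relation says 1 = 0, so the algebra is zero and any coefficients will do.
        rw [← one_mul (x * (x * x)), h0]
        simp
      -- In this case x = c·1 with c = -g₀/g₁, hence x³ = c²x.
      · refine ⟨0, (g 0 / g 1) ^ 2, 0, ?_⟩
        have hx : x = (-(g 0 / g 1)) • (1 : J) := by
          have : g 1 • x = (-g 0) • (1 : J) := by
            rw [g2, g3] at hg
            linear_combination (norm := module) (1 : ℂ) • hg
          rw [← inv_smul_smul₀ g1 x, this, smul_smul]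
          congr 1
          ring
        rw [hx]
        simp only [mul_smul_comm, mul_one]
        module
    · have hx : x * x = (-(g 1 / g 2)) • x + (-(g 0 / g 2)) • (1 : J) := by
        have : g 2 • (x * x) = (-g 1) • x + (-g 0) • (1 : J) := by
          rw [g3] at hg
          linear_combination (norm := module) (1 : ℂ) • hg
        rw [← inv_smul_smul₀ g2 (x * x), this, smul_add, smul_smul, smul_smul]
        congr 2 <;> ring
      refine ⟨-(g 1 / g 2), -(g 0 / g 2), 0, ?_⟩
      conv_lhs => rw [hx]
      simp [mul_add, mul_smul_comm]
  · refine ⟨-(g 2 / g 3), -(g 1 / g 3), -(g 0 / g 3), ?_⟩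
    have : g 3 • (x * (x * x)) = (-g 2) • (x * x) + (-g 1) • x + (-g 0) • (1 : J) := by
      linear_combination (norm := module) (1 : ℂ) • hg
    rw [← inv_smul_smul₀ g3 (x * (x * x)), this, smul_add, smul_add, smul_smul, smul_smul,
      smul_smul]
    congr 3 <;> ring

/-- The criterion for rank three. -/
theorem hasRank_three_of_cubic [FiniteDimensional ℂ J]
    (hJ : ∀ x : J, (x * x) * (x * x) = x * (x * (x * x)))
    (hc : ∀ x : J, ∃ A B C : ℂ, x * (x * x) = A • (x * x) + B • x + C • (1 : J))
    (x₀ : J) (hx₀ : LinearIndependent ℂ ![1, x₀, x₀ * x₀]) : HasRank J 3 := by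
  have hfun : ∀ x : J, (fun j : Fin 3 => jpow x j) = ![1, x, x * x] := fun x => by
    ext j; fin_cases j <;> simp [jpow]
  let b := Module.finBasis ℂ J
  obtain ⟨P, hP, hz⟩ := exists_poly_linearIndependent b x₀ (m := 3) (by rw [hfun]; exact hx₀)
  refine ⟨_, b, P, by rintro rfl; simp at hP, fun x hx => ?_⟩
  have hx := hz x hx
  rw [hfun] at hx
  obtain ⟨A, B, C, h3⟩ := hc x
  have heq : NonUnitalSubalgebra.toSubmodule (NonUnitalAlgebra.adjoin ℂ ({1, x} : Set J)) =
      Submodule.span ℂ (Set.range ![1, x, x * x]) := by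
    apply le_antisymm
    · apply adjoin_le_of_mul_mem
      · exact Submodule.subset_span ⟨0, rfl⟩
      · exact Submodule.subset_span ⟨1, rfl⟩
      · intro a ha c hc
        rw [Submodule.mem_span_range_iff_exists_fun] at ha hc ⊢
        obtain ⟨a, rfl⟩ := ha
        obtain ⟨c, rfl⟩ := hc
        -- The square of x² equals x·x³, so the cubic relation reduces it to degree two; this is
        -- where a power-associativity hypothesis is needed for the span to be closed.
        have h4 : (x * x) * (x * x) =
            (A * A + B) • (x * x) + (A * B + C) • x + (A * C) • (1 : J) := by
          rw [hJ, h3, mul_add, mul_add, mul_smul_comm, mul_smul_comm, mul_smul_comm, h3, mul_one]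
          module
        refine ⟨![a 0 * c 0 + C * (a 1 * c 2 + a 2 * c 1) + A * C * (a 2 * c 2),
          a 0 * c 1 + a 1 * c 0 + B * (a 1 * c 2 + a 2 * c 1) + (A * B + C) * (a 2 * c 2),
          a 0 * c 2 + a 1 * c 1 + a 2 * c 0 + A * (a 1 * c 2 + a 2 * c 1) +
            (A * A + B) * (a 2 * c 2)], ?_⟩
        simp only [Fin.sum_univ_three, Matrix.cons_val, mul_add, add_mul, smul_mul_assoc,
          mul_smul_comm, one_mul, mul_one, mul_comm (x * x) x, h3, h4]
        module
    · rw [Submodule.span_le]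
      rintro _ ⟨j, rfl⟩
      have := jpow_mem_adjoin x j
      rw [show jpow x j = ![1, x, x * x] j from congrFun (hfun x) j] at this
      exact this
  have := finrank_span_eq_card hx
  rw [← heq, Fintype.card_fin] at this
  exact this

end Rank

/-! ### The sixteen algebras in coordinates -/

/-- The product of `J5 0` in coordinates. -/
def mul1 (x y : Fin 5 → ℂ) : Fin 5 → ℂ :=
    ![x 0 * y 0, x 0 * y 1 + x 1 * y 0, x 0 * y 2 + x 2 * y 0, x 0 * y 3 + x 3 * y 0 + x 1 * y 1,
    x 0 * y 4 + x 4 * y 0 + x 1 * y 2 + x 2 * y 1]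

/-- The product of `J5 1` in coordinates. -/
def mul2 (x y : Fin 5 → ℂ) : Fin 5 → ℂ :=
    ![x 0 * y 0, x 0 * y 1 + x 1 * y 0, x 0 * y 2 + x 2 * y 0, x 0 * y 3 + x 3 * y 0 + x 1 * y 1 +
    x 2 * y 2, x 0 * y 4 + x 4 * y 0 + x 1 * y 2 + x 2 * y 1]

/-- The product of `J5 2` in coordinates. -/
def mul3 (x y : Fin 5 → ℂ) : Fin 5 → ℂ :=
    ![x 0 * y 0, x 0 * y 1 + x 1 * y 0, x 0 * y 2 + x 2 * y 0, x 0 * y 3 + x 3 * y 0, x 0 * y 4 +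
    x 4 * y 0 + x 1 * y 1]

/-- The product of `J5 3` in coordinates. -/
def mul4 (x y : Fin 5 → ℂ) : Fin 5 → ℂ :=
    ![x 0 * y 0, x 0 * y 1 + x 1 * y 0, x 0 * y 2 + x 2 * y 0, x 0 * y 3 + x 3 * y 0, x 0 * y 4 +
    x 4 * y 0 + x 1 * y 1 + x 2 * y 2]

/-- The product of `J5 4` in coordinates. -/
def mul5 (x y : Fin 5 → ℂ) : Fin 5 → ℂ :=
    ![x 0 * y 0, x 0 * y 1 + x 1 * y 0, x 0 * y 2 + x 2 * y 0, x 0 * y 3 + x 3 * y 0, x 0 * y 4 +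
    x 4 * y 0 + x 1 * y 1 + x 2 * y 2 + x 3 * y 3]

/-- The product of `J5 5` in coordinates. -/
def mul6 (x y : Fin 5 → ℂ) : Fin 5 → ℂ :=
    ![x 0 * y 0, x 1 * y 1, x 0 * y 2 + x 2 * y 0, ((x 0 + x 1) * y 3 + x 3 * (y 0 + y 1)) / 2,
    ((x 0 + x 1) * y 4 + x 4 * (y 0 + y 1)) / 2]

/-- The product of `J5 6` in coordinates. -/
def mul7 (x y : Fin 5 → ℂ) : Fin 5 → ℂ :=
    ![x 0 * y 0, x 1 * y 1, x 0 * y 2 + x 2 * y 0 + x 3 * y 3, ((x 0 + x 1) * y 3 + x 3 * (y 0 + y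
    1)) / 2, ((x 0 + x 1) * y 4 + x 4 * (y 0 + y 1)) / 2]

/-- The product of `J5 7` in coordinates. -/
def mul8 (x y : Fin 5 → ℂ) : Fin 5 → ℂ :=
    ![x 0 * y 0, x 1 * y 1, x 0 * y 2 + x 2 * y 0 + x 3 * y 3 + x 4 * y 4, ((x 0 + x 1) * y 3 + x
    3 * (y 0 + y 1)) / 2, ((x 0 + x 1) * y 4 + x 4 * (y 0 + y 1)) / 2]

/-- The product of `J5 8` in coordinates. -/
def mul9 (x y : Fin 5 → ℂ) : Fin 5 → ℂ :=
    ![x 0 * y 0, x 1 * y 1, x 0 * y 2 + x 2 * y 0, ((x 0 + x 1) * y 3 + x 3 * (y 0 + y 1)) / 2,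
    ((x 0 + x 1) * y 4 + x 4 * (y 0 + y 1)) / 2 + x 2 * y 3 + x 3 * y 2]

/-- The product of `J5 9` in coordinates. -/
def mul10 (x y : Fin 5 → ℂ) : Fin 5 → ℂ :=
    ![x 0 * y 0, x 1 * y 1, x 0 * y 2 + x 2 * y 0, x 0 * y 3 + x 3 * y 0, ((x 0 + x 1) * y 4 + x 4
    * (y 0 + y 1)) / 2]

/-- The product of `J5 10` in coordinates. -/
def mul11 (x y : Fin 5 → ℂ) : Fin 5 → ℂ :=
    ![x 0 * y 0, x 1 * y 1, x 0 * y 2 + x 2 * y 0 + x 4 * y 4, x 0 * y 3 + x 3 * y 0, ((x 0 + x 1)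
    * y 4 + x 4 * (y 0 + y 1)) / 2]

/-- The product of `J5 11` in coordinates. -/
def mul12 (x y : Fin 5 → ℂ) : Fin 5 → ℂ :=
  ![x 0 * y 0, x 1 * y 1, x 0 * y 2 + x 2 * y 0, x 0 * y 3 + x 3 * y 0, x 0 * y 4 + x 4 * y 0]

/-- The product of `J5 12` in coordinates. -/
def mul13 (x y : Fin 5 → ℂ) : Fin 5 → ℂ :=
    ![x 0 * y 0, x 1 * y 1, x 2 * y 2, ((x 0 + x 1) * y 3 + x 3 * (y 0 + y 1)) / 2, ((x 0 + x 2) *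
    y 4 + x 4 * (y 0 + y 2)) / 2]

/-- The product of `J5 13` in coordinates. -/
def mul14 (x y : Fin 5 → ℂ) : Fin 5 → ℂ :=
    ![x 0 * y 0, x 1 * y 1 - x 2 * y 2, x 1 * y 2 + y 1 * x 2, x 1 * y 3 + y 1 * x 3, x 1 * y 4 +
    y 1 * x 4]

/-- The product of `J5 14` in coordinates. -/
def mul15 (x y : Fin 5 → ℂ) : Fin 5 → ℂ :=
    ![x 0 * y 0, x 1 * y 1 - (x 2 * y 2 + x 3 * y 3), x 1 * y 2 + y 1 * x 2, x 1 * y 3 + y 1 * x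
    3, x 1 * y 4 + y 1 * x 4]

/-- The product of `J5 15` in coordinates. -/
def mul16 (x y : Fin 5 → ℂ) : Fin 5 → ℂ :=
    ![x 0 * y 0, x 1 * y 1 - (x 2 * y 2 + x 3 * y 3 + x 4 * y 4), x 1 * y 2 + y 1 * x 2, x 1 * y 3
    + y 1 * x 3, x 1 * y 4 + y 1 * x 4]

/-- The product of `J5 k` in coordinates. -/
def mulC : Fin 16 → (Fin 5 → ℂ) → (Fin 5 → ℂ) → (Fin 5 → ℂ) :=
  ![mul1, mul2, mul3, mul4, mul5, mul6, mul7, mul8, mul9, mul10, mul11, mul12, mul13, mul14, mul15,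
    mul16]

/-- The unity of `J5 k` in coordinates. -/
def oneC : Fin 16 → Fin 5 → ℂ :=
  ![![1, 0, 0, 0, 0], ![1, 0, 0, 0, 0], ![1, 0, 0, 0, 0], ![1, 0, 0, 0, 0], ![1, 0, 0, 0, 0],
    ![1, 1, 0, 0, 0], ![1, 1, 0, 0, 0], ![1, 1, 0, 0, 0], ![1, 1, 0, 0, 0], ![1, 1, 0, 0, 0],
    ![1, 1, 0, 0, 0], ![1, 1, 0, 0, 0], ![1, 1, 1, 0, 0], ![1, 1, 0, 0, 0], ![1, 1, 0, 0, 0],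
    ![1, 1, 0, 0, 0]]

/-- `φ` presents `A` as the space `ℂ⁵` with the product `m` and the unity `u`. -/
structure IsCoord (A : UnitalCommAlg) (m : (Fin 5 → ℂ) → (Fin 5 → ℂ) → (Fin 5 → ℂ))
    (u : Fin 5 → ℂ) (φ : A ≃ₗ[ℂ] (Fin 5 → ℂ)) : Prop where
  map_one : φ 1 = u
  map_mul : ∀ x y, φ (x * y) = m (φ x) (φ y)

theorem isCoord_toUnital (T : MulTable 5) (u : Fin 5 → ℂ)
    (hu : ∀ j, ∑ i, u i • T.entry i j = Pi.single j 1)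
    (m : (Fin 5 → ℂ) → (Fin 5 → ℂ) → (Fin 5 → ℂ)) (hm : ∀ x y, T.mul x y = m x y) :
    ∃ φ, IsCoord (T.toUnital u hu) m u φ :=
  ⟨{ toFun := fun x => x, invFun := fun x => x, map_add' := fun _ _ => rfl,
     map_smul' := fun _ _ => rfl, left_inv := fun _ => rfl, right_inv := fun _ => rfl },
    ⟨rfl, fun x y => hm x y⟩⟩

theorem isCoord_unitalization (T : MulTable 4)
    (m : (Fin 5 → ℂ) → (Fin 5 → ℂ) → (Fin 5 → ℂ))
    (hm : ∀ (a c : ℂ) (x y : Fin 4 → ℂ),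
      m (Matrix.vecCons a x) (Matrix.vecCons c y) =
        Matrix.vecCons (a * c) (a • y + c • x + T.mul x y)) :
    ∃ φ, IsCoord (unitalization T.Alg) m ![1, 0, 0, 0, 0] φ := by
  refine ⟨{ toFun := fun x : Unitization ℂ T.Alg => Matrix.vecCons x.fst x.snd,
            invFun := fun x => (⟨x 0, Matrix.vecTail x⟩ : Unitization ℂ T.Alg),
            map_add' := fun x y => ?_, map_smul' := fun c x => ?_,
            left_inv := fun x => rfl, right_inv := fun x => ?_ }, ⟨?_, fun x y => ?_⟩⟩
  · exact (Matrix.cons_add_cons x.fst x.snd y.fst y.snd).symm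
  · exact (Matrix.smul_cons c x.fst x.snd).symm
  · exact Matrix.cons_head_tail x
  · ext i
    fin_cases i <;> rfl
  · exact (hm x.fst y.fst x.snd y.snd).symm

theorem isCoord_prodC_quadAlg (r : ℕ) (m : (Fin 5 → ℂ) → (Fin 5 → ℂ) → (Fin 5 → ℂ))
    (hm : ∀ (a c l l' : ℂ) (x y : Fin 3 → ℂ),
      m (Matrix.vecCons a (Matrix.vecCons l x)) (Matrix.vecCons c (Matrix.vecCons l' y)) =
        Matrix.vecCons (a * c) (Matrix.vecCons (l * l' - quadPol r x y) (l • y + l' • x))) :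
    ∃ φ, IsCoord (prodC (quadAlg 3 r)) m ![1, 1, 0, 0, 0] φ := by
  refine ⟨{ toFun := fun x : ℂ × (ℂ × (Fin 3 → ℂ)) =>
              Matrix.vecCons x.1 (Matrix.vecCons x.2.1 x.2.2),
            invFun := fun x => ((x 0, x 1, Matrix.vecTail (Matrix.vecTail x)) :
              ℂ × (ℂ × (Fin 3 → ℂ))),
            map_add' := fun x y => ?_, map_smul' := fun c x => ?_,
            left_inv := fun x => rfl, right_inv := fun x => ?_ }, ⟨?_, fun x y => ?_⟩⟩
  · ext i
    fin_cases i <;> rfl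
  · ext i
    fin_cases i <;> rfl
  · ext i
    fin_cases i <;> rfl
  · ext i
    fin_cases i <;> rfl
  · exact (hm x.1 y.1 x.2.1 y.2.1 x.2.2 y.2.2).symm

-- A coordinate unity `u` is enough to recover the unity hypothesis of `MulTable.toUnital`: expand u
-- times a basis vector by the table. This avoids checking the table entry by entry again; by proof
-- irrelevance the algebra agrees with the one in `J5`.
set_option maxHeartbeats 1000000 in
theorem MulTable.sum_smul_entry (T : MulTable 5) {m : (Fin 5 → ℂ) → (Fin 5 → ℂ) → (Fin 5 → ℂ)}
    (hm : ∀ x y, T.mul x y = m x y) {u : Fin 5 → ℂ} (hu : ∀ x, m u x = x) (j : Fin 5) :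
    ∑ i, u i • T.entry i j = Pi.single j 1 := by
  rw [← hu (Pi.single j 1), ← hm, MulTable.mul]
  exact Finset.sum_congr rfl fun i _ => by simp [Pi.single_apply]

theorem mulC_oneC (k : Fin 16) (x : Fin 5 → ℂ) : mulC k (oneC k) x = x := by
  fin_cases k <;>
  · change ![_, _, _, _, _] = _
    simp only [oneC]
    ext i
    fin_cases i <;> simp <;> ring

theorem exists_isCoord (k : Fin 16) : ∃ φ, IsCoord (J5 k) (mulC k) (oneC k) φ := by
  fin_cases k
  · refine isCoord_unitalization nil1 _ fun a c x y => ?_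
    change ![_, _, _, _, _] = _
    simp only [MulTable.mul, nil1, Fin.sum_univ_four, Matrix.of_apply, Matrix.cons_val]
    ext i
    fin_cases i <;> simp <;> ring
  · refine isCoord_unitalization nil2 _ fun a c x y => ?_
    change ![_, _, _, _, _] = _
    simp only [MulTable.mul, nil2, Fin.sum_univ_four, Matrix.of_apply, Matrix.cons_val]
    ext i
    fin_cases i <;> simp <;> ring
  · refine isCoord_unitalization nil3 _ fun a c x y => ?_
    change ![_, _, _, _, _] = _
    simp only [MulTable.mul, nil3, Fin.sum_univ_four, Matrix.of_apply, Matrix.cons_val]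
    ext i
    fin_cases i <;> simp <;> ring
  · refine isCoord_unitalization nil4 _ fun a c x y => ?_
    change ![_, _, _, _, _] = _
    simp only [MulTable.mul, nil4, Fin.sum_univ_four, Matrix.of_apply, Matrix.cons_val]
    ext i
    fin_cases i <;> simp <;> ring
  · refine isCoord_unitalization nil5 _ fun a c x y => ?_
    change ![_, _, _, _, _] = _
    simp only [MulTable.mul, nil5, Fin.sum_univ_four, Matrix.of_apply, Matrix.cons_val]
    ext i
    fin_cases i <;> simp <;> ring
  · have hm (x y) : table6.mul x y = mulC 5 x y := by
      change _ = ![_, _, _, _, _]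
      simp only [MulTable.mul, table6, Fin.sum_univ_five, Matrix.of_apply, Matrix.cons_val]
      ext i
      fin_cases i <;> simp <;> ring
    exact isCoord_toUnital _ _ (MulTable.sum_smul_entry _ hm (mulC_oneC 5)) _ hm
  · have hm (x y) : table7.mul x y = mulC 6 x y := by
      change _ = ![_, _, _, _, _]
      simp only [MulTable.mul, table7, Fin.sum_univ_five, Matrix.of_apply, Matrix.cons_val]
      ext i
      fin_cases i <;> simp <;> ring
    exact isCoord_toUnital _ _ (MulTable.sum_smul_entry _ hm (mulC_oneC 6)) _ hm
  · have hm (x y) : table8.mul x y = mulC 7 x y := by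
      change _ = ![_, _, _, _, _]
      simp only [MulTable.mul, table8, Fin.sum_univ_five, Matrix.of_apply, Matrix.cons_val]
      ext i
      fin_cases i <;> simp <;> ring
    exact isCoord_toUnital _ _ (MulTable.sum_smul_entry _ hm (mulC_oneC 7)) _ hm
  · have hm (x y) : table9.mul x y = mulC 8 x y := by
      change _ = ![_, _, _, _, _]
      simp only [MulTable.mul, table9, Fin.sum_univ_five, Matrix.of_apply, Matrix.cons_val]
      ext i
      fin_cases i <;> simp <;> ring
    exact isCoord_toUnital _ _ (MulTable.sum_smul_entry _ hm (mulC_oneC 8)) _ hm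
  · have hm (x y) : table10.mul x y = mulC 9 x y := by
      change _ = ![_, _, _, _, _]
      simp only [MulTable.mul, table10, Fin.sum_univ_five, Matrix.of_apply, Matrix.cons_val]
      ext i
      fin_cases i <;> simp <;> ring
    exact isCoord_toUnital _ _ (MulTable.sum_smul_entry _ hm (mulC_oneC 9)) _ hm
  · have hm (x y) : table11.mul x y = mulC 10 x y := by
      change _ = ![_, _, _, _, _]
      simp only [MulTable.mul, table11, Fin.sum_univ_five, Matrix.of_apply, Matrix.cons_val]
      ext i
      fin_cases i <;> simp <;> ring
    exact isCoord_toUnital _ _ (MulTable.sum_smul_entry _ hm (mulC_oneC 10)) _ hm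
  · have hm (x y) : table12.mul x y = mulC 11 x y := by
      change _ = ![_, _, _, _, _]
      simp only [MulTable.mul, table12, Fin.sum_univ_five, Matrix.of_apply, Matrix.cons_val]
      ext i
      fin_cases i <;> simp <;> ring
    exact isCoord_toUnital _ _ (MulTable.sum_smul_entry _ hm (mulC_oneC 11)) _ hm
  · have hm (x y) : table13.mul x y = mulC 12 x y := by
      change _ = ![_, _, _, _, _]
      simp only [MulTable.mul, table13, Fin.sum_univ_five, Matrix.of_apply, Matrix.cons_val]
      ext i
      fin_cases i <;> simp <;> ring
    exact isCoord_toUnital _ _ (MulTable.sum_smul_entry _ hm (mulC_oneC 12)) _ hm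
  iterate 3
    exact isCoord_prodC_quadAlg _ _ fun a c l l' x y => by
      change ![_, _, _, _, _] = _
      simp only [quadPol, Fin.sum_univ_three]
      ext i
      fin_cases i <;> simp <;> ring

/-- The product is a separate argument of `P` so that each case sees one explicit formula instead of
a lookup in a vector of sixteen functions. -/
theorem mulC_cases {P : Fin 16 → ((Fin 5 → ℂ) → (Fin 5 → ℂ) → (Fin 5 → ℂ)) → Prop}
    (h0 : P 0 mul1) (h1 : P 1 mul2) (h2 : P 2 mul3) (h3 : P 3 mul4) (h4 : P 4 mul5)
    (h5 : P 5 mul6) (h6 : P 6 mul7) (h7 : P 7 mul8) (h8 : P 8 mul9) (h9 : P 9 mul10)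
    (h10 : P 10 mul11) (h11 : P 11 mul12) (h12 : P 12 mul13) (h13 : P 13 mul14)
    (h14 : P 14 mul15) (h15 : P 15 mul16) (k : Fin 16) : P k (mulC k) := by
  fin_cases k <;> assumption

theorem jordanC (k : Fin 16) : ∀ (x y : Fin 5 → ℂ),
    mulC k (mulC k x y) (mulC k x x) = mulC k x (mulC k y (mulC k x x)) := by
  apply mulC_cases (P := fun _ m => ∀ x y, m (m x y) (m x x) = m x (m y (m x x))) <;>
  · intro x y
    simp only [mul1, mul2, mul3, mul4, mul5, mul6, mul7, mul8, mul9,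
      mul10, mul11, mul12, mul13, mul14, mul15, mul16, Matrix.cons_val]
    ext i
    fin_cases i <;> simp [-one_div] <;> ring

/-- The coefficients are those of the generic polynomial: (t - x₀)³ for the local algebras, (t -
x₀)²(t - x₁) for indices 5 to 11, (t - x₀)(t - x₁)(t - x₂) for index 12, and (t - x₀)((t - x₁)² + q)
for the last three, q being the quadratic form. -/
theorem cubicC (k : Fin 16) : ∀ x : Fin 5 → ℂ, ∃ A B C : ℂ,
    mulC k x (mulC k x x) = A • mulC k x x + B • x + C • oneC k := by
  apply mulC_cases (P := fun k m => ∀ x : Fin 5 → ℂ, ∃ A B C : ℂ,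
    m x (m x x) = A • m x x + B • x + C • oneC k) <;> intro x
  iterate 5
    refine ⟨3 * x 0, -3 * x 0 ^ 2, x 0 ^ 3, ?_⟩
    simp only [mul1, mul2, mul3, mul4, mul5, Matrix.cons_val, oneC]
    ext i
    simp only [Pi.add_apply, Pi.smul_apply, smul_eq_mul]
    fin_cases i <;> simp <;> ring
  iterate 7
    refine ⟨2 * x 0 + x 1, -(x 0 ^ 2 + 2 * x 0 * x 1), x 0 ^ 2 * x 1, ?_⟩
    simp only [mul6, mul7, mul8, mul9, mul10, mul11, mul12, Matrix.cons_val, oneC]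
    ext i
    simp only [Pi.add_apply, Pi.smul_apply, smul_eq_mul]
    fin_cases i <;> simp <;> ring
  · refine ⟨x 0 + x 1 + x 2, -(x 0 * x 1 + x 0 * x 2 + x 1 * x 2), x 0 * x 1 * x 2, ?_⟩
    simp only [mul13, Matrix.cons_val, oneC]
    ext i
    simp only [Pi.add_apply, Pi.smul_apply, smul_eq_mul]
    fin_cases i <;> simp <;> ring
  · refine ⟨x 0 + 2 * x 1, -(x 1 ^ 2 + x 2 ^ 2 + 2 * x 0 * x 1), x 0 * (x 1 ^ 2 + x 2 ^ 2), ?_⟩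
    simp only [mul14, Matrix.cons_val, oneC]
    ext i
    simp only [Pi.add_apply, Pi.smul_apply, smul_eq_mul]
    fin_cases i <;> simp <;> ring
  · refine ⟨x 0 + 2 * x 1, -(x 1 ^ 2 + x 2 ^ 2 + x 3 ^ 2 + 2 * x 0 * x 1),
      x 0 * (x 1 ^ 2 + x 2 ^ 2 + x 3 ^ 2), ?_⟩
    simp only [mul15, Matrix.cons_val, oneC]
    ext i
    simp only [Pi.add_apply, Pi.smul_apply, smul_eq_mul]
    fin_cases i <;> simp <;> ring
  · refine ⟨x 0 + 2 * x 1, -(x 1 ^ 2 + x 2 ^ 2 + x 3 ^ 2 + x 4 ^ 2 + 2 * x 0 * x 1),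
      x 0 * (x 1 ^ 2 + x 2 ^ 2 + x 3 ^ 2 + x 4 ^ 2), ?_⟩
    simp only [mul16, Matrix.cons_val, oneC]
    ext i
    simp only [Pi.add_apply, Pi.smul_apply, smul_eq_mul]
    fin_cases i <;> simp <;> ring

theorem exists_linearIndependentC (k : Fin 16) :
    ∃ x, LinearIndependent ℂ ![oneC k, x, mulC k x x] := by
  apply mulC_cases (P := fun k m => ∃ x, LinearIndependent ℂ ![oneC k, x, m x x])
  iterate 5
    refine ⟨![0, 1, 0, 0, 0], Fintype.linearIndependent_iff.2 fun g hg => ?_⟩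
    have h0 := congrFun hg 0
    have h1 := congrFun hg 1
    have h3 := congrFun hg 3
    have h4 := congrFun hg 4
    simp [Fin.sum_univ_three, oneC, mul1, mul2, mul3, mul4, mul5] at h0 h1 h3 h4
    intro i
    fin_cases i <;> simp [*]
  iterate 7
    refine ⟨![1, 0, 1, 0, 0], Fintype.linearIndependent_iff.2 fun g hg => ?_⟩
    have h0 := congrFun hg 0
    have h1 := congrFun hg 1
    have h2 := congrFun hg 2
    simp [Fin.sum_univ_three, oneC, mul6, mul7, mul8, mul9, mul10, mul11, mul12] at h0 h1 h2
    have key : g 0 = 0 ∧ g 1 = 0 ∧ g 2 = 0 := ⟨h1, by linear_combination 2 * h0 - 2 * h1 - h2, by linear_combination h2 - h0 + h1⟩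
    intro i
    exact Fin.cases key.1 (fun i => Fin.cases key.2.1 (fun i => by rw [Subsingleton.elim i 0]; exact key.2.2) i) i
  · refine ⟨![0, 1, -1, 0, 0], Fintype.linearIndependent_iff.2 fun g hg => ?_⟩
    have h0 := congrFun hg 0
    have h1 := congrFun hg 1
    have h2 := congrFun hg 2
    simp [Fin.sum_univ_three, oneC, mul13] at h0 h1 h2
    have key : g 0 = 0 ∧ g 1 = 0 ∧ g 2 = 0 := ⟨h0, by linear_combination (h1 - h2) / 2, by linear_combination (h1 + h2) / 2 - h0⟩
    intro i
    exact Fin.cases key.1 (fun i => Fin.cases key.2.1 (fun i => by rw [Subsingleton.elim i 0]; exact key.2.2) i) i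
  iterate 3
    refine ⟨![0, 0, 1, 0, 0], Fintype.linearIndependent_iff.2 fun g hg => ?_⟩
    have h0 := congrFun hg 0
    have h1 := congrFun hg 1
    have h2 := congrFun hg 2
    simp [Fin.sum_univ_three, oneC, mul14, mul15, mul16] at h0 h1 h2
    have key : g 0 = 0 ∧ g 1 = 0 ∧ g 2 = 0 := ⟨h0, h2, by linear_combination h0 - h1⟩
    intro i
    exact Fin.cases key.1 (fun i => Fin.cases key.2.1 (fun i => by rw [Subsingleton.elim i 0]; exact key.2.2) i) i

/-! ### The radical in coordinates -/

/-- The codimension of the radical of `J5 k`. -/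
def codimRad : Fin 16 → ℕ := ![1, 1, 1, 1, 1, 2, 2, 2, 2, 2, 2, 2, 3, 3, 4, 5]

/-- The vectors whose first `s` coordinates vanish. -/
def vanish (s : ℕ) : Submodule ℂ (Fin 5 → ℂ) where
  carrier := {x | ∀ i : Fin 5, i.val < s → x i = 0}
  add_mem' hx hy i hi := by simp [hx i hi, hy i hi]
  zero_mem' i _ := rfl
  smul_mem' c x hx i hi := by simp [hx i hi]

theorem finrank_vanish (s : ℕ) (hs : s ≤ 5) : finrank ℂ (vanish s) = 5 - s := by
  let f : (Fin 5 → ℂ) →ₗ[ℂ] (Fin s → ℂ) := LinearMap.funLeft ℂ ℂ (Fin.castLE hs)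
  have hf : Function.Surjective f :=
    LinearMap.funLeft_surjective_of_injective _ _ _ (Fin.castLE_injective hs)
  have hk : LinearMap.ker f = vanish s := by
    ext x
    rw [LinearMap.mem_ker]
    constructor
    · intro h i hi
      exact congrFun h ⟨i, hi⟩
    · intro h
      ext i
      exact h _ i.2
  have := f.finrank_range_add_finrank_ker
  rw [LinearMap.range_eq_top.2 hf, hk, finrank_top] at this
  simp at this
  omega

theorem mulC_mem_vanish (k : Fin 16) : ∀ x y : Fin 5 → ℂ, y ∈ vanish (codimRad k) →
    mulC k x y ∈ vanish (codimRad k) := by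
  apply mulC_cases (P := fun k m => ∀ x y : Fin 5 → ℂ, y ∈ vanish (codimRad k) →
    m x y ∈ vanish (codimRad k)) <;>
  · intro x y h i
    have h0 := h 0
    have h1 := h 1
    have h2 := h 2
    have h3 := h 3
    have h4 := h 4
    simp [codimRad] at h0 h1 h2 h3 h4
    fin_cases i <;> simp [*, mul1, mul2, mul3, mul4, mul5, mul6, mul7, mul8, mul9,
      mul10, mul11, mul12, mul13, mul14, mul15, mul16, codimRad]

theorem cube_eq_zeroC (k : Fin 16) : ∀ y : Fin 5 → ℂ, y ∈ vanish (codimRad k) →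
    mulC k y (mulC k y y) = 0 := by
  apply mulC_cases (P := fun k m => ∀ y : Fin 5 → ℂ, y ∈ vanish (codimRad k) →
    m y (m y y) = 0) <;>
  · intro y h
    have h0 := h 0
    have h1 := h 1
    have h2 := h 2
    have h3 := h 3
    have h4 := h 4
    simp [codimRad] at h0 h1 h2 h3 h4
    ext i
    fin_cases i <;> simp [*, mul1, mul2, mul3, mul4, mul5, mul6, mul7, mul8, mul9,
      mul10, mul11, mul12, mul13, mul14, mul15, mul16]

/-- Powers in coordinates. -/
def jpowC (k : Fin 16) (y : Fin 5 → ℂ) : ℕ → Fin 5 → ℂ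
  | 0 => oneC k
  | n + 1 => mulC k y (jpowC k y n)

/-- The number of leading coordinates which are multiplicative on `J5 k`. -/
def charNum : Fin 16 → ℕ := ![1, 1, 1, 1, 1, 2, 2, 2, 2, 2, 2, 2, 3, 1, 1, 1]

/-- These coordinates are characters of the algebra, so they vanish on nilpotent elements. For
indices 0 to 12 they already cut out the radical. -/
theorem mulC_apply_of_lt (k : Fin 16) : ∀ (x y : Fin 5 → ℂ) (i : Fin 5), i.val < charNum k →
    mulC k x y i = x i * y i := by
  apply mulC_cases (P := fun k m => ∀ (x y : Fin 5 → ℂ) (i : Fin 5), i.val < charNum k →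
    m x y i = x i * y i) <;>
  · intro x y i h
    fin_cases i <;> simp [charNum, mul1, mul2, mul3, mul4, mul5, mul6, mul7, mul8, mul9,
      mul10, mul11, mul12, mul13, mul14, mul15, mul16] at h ⊢

theorem oneC_apply_of_lt (k : Fin 16) (i : Fin 5) (h : i.val < charNum k) : oneC k i = 1 := by
  fin_cases k <;> fin_cases i <;> simp [charNum, oneC] at h ⊢

theorem jpowC_apply_of_lt (k : Fin 16) (y : Fin 5 → ℂ) (n : ℕ) (i : Fin 5)
    (h : i.val < charNum k) : jpowC k y n i = y i ^ n := by
  induction n with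
  | zero => simpa [jpowC] using oneC_apply_of_lt k i h
  | succ n ih => rw [jpowC, mulC_apply_of_lt k _ _ i h, ih, pow_succ']

/-- The quadratic form `q` of the factor `ℂ ⊕ W` of `J5 k`, for `k = 13, 14, 15`. -/
def quadC (k : Fin 16) (y : Fin 5 → ℂ) : ℂ :=
  if k = 13 then y 2 ^ 2 else if k = 14 then y 2 ^ 2 + y 3 ^ 2 else y 2 ^ 2 + y 3 ^ 2 + y 4 ^ 2

/-- The inequality singles out indices 13, 14 and 15. The displayed vectors, whose W-part is
proportional to that of y, contain every power of y. -/
theorem mulC_of_charNum_lt (k : Fin 16) (y : Fin 5 → ℂ) (a A B : ℂ) :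
    charNum k < codimRad k →
    mulC k y ![a, A, B * y 2, B * y 3, B * y 4] =
      ![y 0 * a, y 1 * A - B * quadC k y, (A + y 1 * B) * y 2, (A + y 1 * B) * y 3,
        (A + y 1 * B) * y 4] := by
  apply mulC_cases (P := fun k m => charNum k < codimRad k →
    m y ![a, A, B * y 2, B * y 3, B * y 4] =
      ![y 0 * a, y 1 * A - B * quadC k y, (A + y 1 * B) * y 2, (A + y 1 * B) * y 3,
        (A + y 1 * B) * y 4])
  iterate 13
    intro h
    simp [charNum, codimRad] at h
  iterate 3
    intro _
    ext i
    fin_cases i <;> simp [quadC, mul14, mul15, mul16] <;> ring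

/-- Since w² = -q(w) for w in W, sending w to a square root t of -q(w) evaluates elements A + Bw
multiplicatively at A + Bt. Powers of y then go to powers of y₁ + t. -/
theorem jpowC_of_charNum_lt (k : Fin 16) (h : charNum k < codimRad k) (y : Fin 5 → ℂ) (t : ℂ)
    (ht : t ^ 2 = -quadC k y) (n : ℕ) : ∃ a A B : ℂ,
    jpowC k y n = ![a, A, B * y 2, B * y 3, B * y 4] ∧ A + B * t = (y 1 + t) ^ n := by
  induction n with
  | zero =>
    refine ⟨1, 1, 0, ?_, by simp⟩
    revert h
    fin_cases k <;> simp [charNum, codimRad, jpowC, oneC]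
  | succ n ih =>
    obtain ⟨a, A, B, h1, h2⟩ := ih
    refine ⟨_, _, _, by rw [jpowC, h1, mulC_of_charNum_lt k y a A B h], ?_⟩
    rw [pow_succ', ← h2]
    linear_combination (-B) * ht

/-- Evaluation at both square roots ±t kills a nilpotent element, so y₁ + t = y₁ - t = 0. When the
W-part of y vanishes t is zero anyway, so the two evaluations agree. -/
theorem jpowC_eq_zero (k : Fin 16) (h : charNum k < codimRad k) (y : Fin 5 → ℂ) (n : ℕ)
    (hn : jpowC k y n = 0) : y 1 = 0 := by
  obtain ⟨t, ht⟩ := IsAlgClosed.exists_pow_nat_eq (-quadC k y) (n := 2) (by norm_num)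
  have key : ∀ t : ℂ, t ^ 2 = -quadC k y → y 1 + t = 0 := by
    intro t ht
    obtain ⟨a, A, B, h1, h2⟩ := jpowC_of_charNum_lt k h y t ht n
    rw [hn] at h1
    have hA : A = 0 := by simpa using (congrFun h1 1).symm
    have h3 : B * y 2 = 0 := by simpa using (congrFun h1 2).symm
    have h4 : B * y 3 = 0 := by simpa using (congrFun h1 3).symm
    have h5 : B * y 4 = 0 := by simpa using (congrFun h1 4).symm
    refine eq_zero_of_pow_eq_zero (n := n) ?_
    rw [← h2, hA, zero_add]
    by_cases hB : B = 0
    · simp [hB]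
    · have h3 : y 2 = 0 := by simpa [hB] using h3
      have h4 : y 3 = 0 := by simpa [hB] using h4
      have h5 : y 4 = 0 := by simpa [hB] using h5
      have : t = 0 := by
        refine eq_zero_of_pow_eq_zero (n := 2) ?_
        rw [ht, quadC]
        simp [h3, h4, h5]
      simp [this]
  linear_combination (key t ht + key (-t) (by rw [neg_sq, ht])) / 2

/-- Multiplying by a non-isotropic basis vector of W moves the coordinate i to the scalar
coordinate. In a nil ideal, where the scalar coordinate always vanishes, the coordinate i must
vanish too. -/
theorem mulC_single_apply (k : Fin 16) (i : Fin 5) : ∀ y : Fin 5 → ℂ, charNum k < codimRad k →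
    i.val < codimRad k → i ≠ 0 → i ≠ 1 → mulC k (Pi.single i 1) y 1 = -y i := by
  apply mulC_cases (P := fun k m => ∀ y : Fin 5 → ℂ, charNum k < codimRad k →
    i.val < codimRad k → i ≠ 0 → i ≠ 1 → m (Pi.single i 1) y 1 = -y i)
  iterate 13
    intro y h
    simp [charNum, codimRad] at h
  iterate 3
    intro y _
    fin_cases i <;> simp [codimRad, mul14, mul15, mul16]

theorem IsCoord.map_jpow {k : Fin 16} {φ : J5 k ≃ₗ[ℂ] (Fin 5 → ℂ)}
    (h : IsCoord (J5 k) (mulC k) (oneC k) φ) (y : J5 k) (n : ℕ) :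
    φ (jpow y n) = jpowC k (φ y) n := by
  induction n with
  | zero => exact h.map_one
  | succ n ih => rw [jpow, h.map_mul, ih, jpowC]

/-- The radical of `J5 k` in coordinates. -/
theorem IsCoord.isRadical {k : Fin 16} {φ : J5 k ≃ₗ[ℂ] (Fin 5 → ℂ)}
    (h : IsCoord (J5 k) (mulC k) (oneC k) φ) :
    IsRadical ((vanish (codimRad k)).comap (φ : J5 k →ₗ[ℂ] (Fin 5 → ℂ))) := by
  constructor
  · refine ⟨fun x y hy => ?_, fun y hy => ⟨3, ?_⟩⟩
    · rw [Submodule.mem_comap] at hy ⊢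
      simpa [h.map_mul] using mulC_mem_vanish k (φ x) (φ y) hy
    · have := cube_eq_zeroC k (φ y) hy
      rw [← h.map_mul, ← h.map_mul] at this
      rw [jpow, jpow, jpow, jpow, mul_one]
      simpa using this
  -- Maximality: characters vanish on nilpotents, and for the last three algebras the other
  -- coordinates are read off from products that stay inside the ideal.
  · rintro I hI y hy
    have h0 : ∀ y ∈ I, ∀ i : Fin 5, i.val < charNum k → φ y i = 0 := by
      intro y hy i hi
      obtain ⟨n, hn⟩ := hI.nil y hy
      have := jpowC_apply_of_lt k (φ y) n i hi
      rw [← h.map_jpow, hn, map_zero] at this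
      exact eq_zero_of_pow_eq_zero this.symm
    intro i hi
    by_cases hk : charNum k < codimRad k
    · have h1 : ∀ y ∈ I, φ y 1 = 0 := by
        intro y hy
        obtain ⟨n, hn⟩ := hI.nil y hy
        refine jpowC_eq_zero k hk (φ y) n ?_
        rw [← h.map_jpow, hn, map_zero]
      by_cases i0 : i = 0
      · subst i0
        exact h0 y hy 0 (by revert hk; fin_cases k <;> simp [charNum, codimRad])
      by_cases i1 : i = 1
      · subst i1
        exact h1 y hy
      have := h1 _ (hI.mul_mem (φ.symm (Pi.single i 1)) y hy)
      rw [h.map_mul, φ.apply_symm_apply, mulC_single_apply k i _ hk hi i0 i1] at this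
      simpa using this
    · exact h0 y hy i (by omega)

theorem J5_spec (k : Fin 16) :
    IsCommJordan (J5 k) ∧ finrank ℂ (J5 k) = 5 ∧ HasRank (J5 k) 3 ∧
      ∃ R : Submodule ℂ (J5 k), IsRadical R ∧ finrank ℂ R = 5 - codimRad k := by
  obtain ⟨φ, h⟩ := exists_isCoord k
  have : FiniteDimensional ℂ (J5 k) := φ.symm.finiteDimensional
  have hJ : IsCommJordan (J5 k) := ⟨fun a b => φ.injective (by
    simpa only [h.map_mul] using jordanC k (φ a) (φ b))⟩
  refine ⟨hJ, ?_, ?_, _, h.isRadical, ?_⟩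
  · rw [φ.finrank_eq, finrank_fintype_fun_eq_card, Fintype.card_fin]
  · obtain ⟨x, hx⟩ := exists_linearIndependentC k
    refine hasRank_three_of_cubic (fun x => ?_) (fun x => ?_) (φ.symm x) ?_
    · exact IsCommJordan.lmul_comm_rmul_rmul x x
    · obtain ⟨A, B, C, hc⟩ := cubicC k (φ x)
      refine ⟨A, B, C, φ.injective ?_⟩
      simp only [h.map_mul, map_add, map_smul, h.map_one, hc]
    · refine LinearIndependent.of_comp (φ : J5 k →ₗ[ℂ] (Fin 5 → ℂ)) ?_
      convert hx using 1
      ext i j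
      fin_cases i
      · simp [h.map_one]
      · simp
      · simp [h.map_mul]
  · rw [← finrank_vanish (codimRad k) (by fin_cases k <;> simp [codimRad])]
    exact (φ.submoduleMap _).finrank_eq.trans
      (by rw [Submodule.map_comap_eq_of_surjective φ.surjective])

/-! ### Invariants separating the sixteen algebras -/

/-- An isomorphism `J5 k ≃ J5 l` in coordinates. -/
def IsIsoC (k l : Fin 16) (g : (Fin 5 → ℂ) ≃ₗ[ℂ] (Fin 5 → ℂ)) : Prop :=
  ∀ x y, g (mulC k x y) = mulC l (g x) (g y)

theorem IsIsoC.symm {k l : Fin 16} {g : (Fin 5 → ℂ) ≃ₗ[ℂ] (Fin 5 → ℂ)} (hg : IsIsoC k l g) :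
    IsIsoC l k g.symm := fun x y => g.injective (by simp [hg _ _])

/-- The trace of the multiplication by `x` in `J5 k`. -/
def traceC (k : Fin 16) (x : Fin 5 → ℂ) : ℂ := ∑ i, mulC k x (Pi.single i 1) i

/-- The multiplication by `x` in `J5 k`, as a linear map. -/
theorem exists_mulLeftC (k : Fin 16) (x : Fin 5 → ℂ) :
    ∃ T : (Fin 5 → ℂ) →ₗ[ℂ] (Fin 5 → ℂ), (∀ y, T y = mulC k x y) ∧
      LinearMap.trace ℂ _ T = traceC k x := by
  obtain ⟨φ, h⟩ := exists_isCoord k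
  have hT : ∀ y, ((φ : J5 k →ₗ[ℂ] (Fin 5 → ℂ)) ∘ₗ LinearMap.mulLeft ℂ (φ.symm x) ∘ₗ
      (φ.symm : (Fin 5 → ℂ) →ₗ[ℂ] J5 k)) y = mulC k x y := fun y => by simp [h.map_mul]
  refine ⟨_, hT, ?_⟩
  rw [LinearMap.trace_eq_matrix_trace ℂ (Pi.basisFun ℂ (Fin 5)), Matrix.trace, traceC]
  refine Finset.sum_congr rfl fun i _ => ?_
  rw [Matrix.diag_apply, LinearMap.toMatrix_apply, hT]
  simp

theorem IsIsoC.traceC_eq {k l : Fin 16} {g : (Fin 5 → ℂ) ≃ₗ[ℂ] (Fin 5 → ℂ)} (hg : IsIsoC k l g)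
    (x : Fin 5 → ℂ) : traceC l (g x) = traceC k x := by
  obtain ⟨T, hT, h1⟩ := exists_mulLeftC k x
  obtain ⟨U, hU, h2⟩ := exists_mulLeftC l (g x)
  rw [← h1, ← h2, ← LinearMap.trace_conj' T g]
  congr 1
  refine LinearMap.ext fun y => ?_
  simp [hU, LinearEquiv.conj_apply, hT, hg _ _]

/-- Some idempotent has trace `c`. -/
def HasIdemTrace (c : ℂ) (k : Fin 16) : Prop := ∃ e, mulC k e e = e ∧ traceC k e = c

/-- The elements with vanishing cube. -/
def IsCubeZero (k : Fin 16) (x : Fin 5 → ℂ) : Prop := mulC k x (mulC k x x) = 0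

/-- For indices 0 to 12 the elements with vanishing cube form the radical (`isCubeZero_iff`), so
this and the following predicates describe the radical as an algebra without naming it. They visibly
transfer along isomorphisms. -/
def HasNonzeroSq (k : Fin 16) : Prop := ∃ x, IsCubeZero k x ∧ mulC k x x ≠ 0

def HasSqZeroNotAnn (k : Fin 16) : Prop :=
  ∃ x y, IsCubeZero k x ∧ IsCubeZero k y ∧ mulC k x x = 0 ∧ mulC k x y ≠ 0

/-- At indices 7 and 8 trace 3 forces the leading coordinates (1, 0) on the idempotent. The
predicate asks whether a nonzero square in the radical lies in its Peirce space for 1 rather than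
for 1/2. -/
def HasFixedSq (k : Fin 16) : Prop :=
  ∃ e x, mulC k e e = e ∧ traceC k e = 3 ∧ IsCubeZero k x ∧ mulC k x x ≠ 0 ∧
    mulC k e (mulC k x x) = mulC k x x

def HasIndepSq (k : Fin 16) : Prop :=
  ∃ x y, IsCubeZero k x ∧ IsCubeZero k y ∧ LinearIndependent ℂ ![mulC k x x, mulC k y y]

def HasIndepAnn (k : Fin 16) : Prop :=
  ∃ x y, IsCubeZero k x ∧ IsCubeZero k y ∧ LinearIndependent ℂ ![x, y] ∧
    ∀ z, IsCubeZero k z → mulC k x z = 0 ∧ mulC k y z = 0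

section Transfer

variable {k l : Fin 16} {g : (Fin 5 → ℂ) ≃ₗ[ℂ] (Fin 5 → ℂ)}

theorem IsIsoC.isCubeZero (hg : IsIsoC k l g) {x : Fin 5 → ℂ} (hx : IsCubeZero k x) :
    IsCubeZero l (g x) := by
  rw [IsCubeZero, ← hg, ← hg, hx, map_zero]

theorem IsIsoC.linearIndependent (hg : IsIsoC k l g) {x y : Fin 5 → ℂ}
    (h : LinearIndependent ℂ ![x, y]) :
    LinearIndependent ℂ ![g x, g y] := by
  rw [LinearIndependent.pair_iff] at h ⊢
  intro s t hst
  exact h s t (g.injective (by simpa using hst))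

theorem IsIsoC.hasIdemTrace (hg : IsIsoC k l g) {c : ℂ} : HasIdemTrace c k → HasIdemTrace c l := by
  rintro ⟨e, he, ht⟩
  exact ⟨g e, by rw [← hg, he], by rw [hg.traceC_eq, ht]⟩

theorem IsIsoC.hasNonzeroSq (hg : IsIsoC k l g) : HasNonzeroSq k → HasNonzeroSq l := by
  rintro ⟨x, hx, h⟩
  exact ⟨g x, hg.isCubeZero hx, by rwa [← hg, Ne, g.map_eq_zero_iff]⟩

theorem IsIsoC.hasSqZeroNotAnn (hg : IsIsoC k l g) : HasSqZeroNotAnn k → HasSqZeroNotAnn l := by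
  rintro ⟨x, y, hx, hy, h, h'⟩
  exact ⟨g x, g y, hg.isCubeZero hx, hg.isCubeZero hy, by rw [← hg, h, map_zero],
    by rwa [← hg, Ne, g.map_eq_zero_iff]⟩

theorem IsIsoC.hasFixedSq (hg : IsIsoC k l g) : HasFixedSq k → HasFixedSq l := by
  rintro ⟨e, x, he, ht, hx, h, h'⟩
  exact ⟨g e, g x, by rw [← hg, he], by rw [hg.traceC_eq, ht], hg.isCubeZero hx,
    by rwa [← hg, Ne, g.map_eq_zero_iff], by rw [← hg, ← hg, h']⟩

theorem IsIsoC.hasIndepSq (hg : IsIsoC k l g) : HasIndepSq k → HasIndepSq l := by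
  rintro ⟨x, y, hx, hy, h⟩
  exact ⟨g x, g y, hg.isCubeZero hx, hg.isCubeZero hy,
    by simpa only [hg _ _] using hg.linearIndependent h⟩

theorem IsIsoC.hasIndepAnn (hg : IsIsoC k l g) : HasIndepAnn k → HasIndepAnn l := by
  rintro ⟨x, y, hx, hy, h, h'⟩
  refine ⟨g x, g y, hg.isCubeZero hx, hg.isCubeZero hy, hg.linearIndependent h, fun z hz => ?_⟩
  have := h' _ (hg.symm.isCubeZero hz)
  have h1 := hg x (g.symm z)
  have h2 := hg y (g.symm z)
  rw [this.1, map_zero, g.apply_symm_apply] at h1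
  rw [this.2, map_zero, g.apply_symm_apply] at h2
  exact ⟨h1.symm, h2.symm⟩

end Transfer

/-- When the characters cut out the radical, a vanishing cube makes every character vanish, and the
converse holds because cubes in the radical are zero. -/
theorem isCubeZero_iff (k : Fin 16) (hk : codimRad k ≤ charNum k) (x : Fin 5 → ℂ) :
    IsCubeZero k x ↔ x ∈ vanish (codimRad k) := by
  refine ⟨fun h i hi => ?_, cube_eq_zeroC k x⟩
  have := congrFun h i
  rw [mulC_apply_of_lt k _ _ i (by omega), mulC_apply_of_lt k _ _ i (by omega)] at this
  simpa using this

theorem idem_apply (k : Fin 16) {e : Fin 5 → ℂ} (he : mulC k e e = e) (i : Fin 5)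
    (hi : i.val < charNum k) : e i = 0 ∨ e i = 1 := by
  have := congrFun he i
  rw [mulC_apply_of_lt k _ _ i hi] at this
  rcases mul_eq_zero.1 (show e i * (e i - 1) = 0 by linear_combination this) with h | h
  · exact Or.inl h
  · exact Or.inr (sub_eq_zero.1 h)

theorem traceC_eq (k : Fin 16) : ∀ x : Fin 5 → ℂ,
    (k ∈ ({5, 6, 7, 8} : Finset (Fin 16)) → traceC k x = 3 * x 0 + 2 * x 1) ∧
    (k ∈ ({9, 10} : Finset (Fin 16)) → traceC k x = 7 / 2 * x 0 + 3 / 2 * x 1) ∧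
    (k = 11 → traceC k x = 4 * x 0 + x 1) ∧
    (k = 12 → traceC k x = 2 * x 0 + 3 / 2 * x 1 + 3 / 2 * x 2) ∧
    (k = 13 → traceC k x = x 0 + 4 * x 1) := by
  intro x
  refine ⟨fun h => ?_, fun h => ?_, ?_, ?_, ?_⟩
  · simp only [Finset.mem_insert, Finset.mem_singleton] at h
    rcases h with rfl | rfl | rfl | rfl
    · change ∑ i, mul6 _ _ _ = _
      simp [mul6, Fin.sum_univ_five]
      ring
    · change ∑ i, mul7 _ _ _ = _
      simp [mul7, Fin.sum_univ_five]
      ring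
    · change ∑ i, mul8 _ _ _ = _
      simp [mul8, Fin.sum_univ_five]
      ring
    · change ∑ i, mul9 _ _ _ = _
      simp [mul9, Fin.sum_univ_five]
      ring
  · simp only [Finset.mem_insert, Finset.mem_singleton] at h
    rcases h with rfl | rfl
    · change ∑ i, mul10 _ _ _ = _
      simp [mul10, Fin.sum_univ_five]
      ring
    · change ∑ i, mul11 _ _ _ = _
      simp [mul11, Fin.sum_univ_five]
      ring
  · rintro rfl
    change ∑ i, mul12 _ _ _ = _
    simp [mul12, Fin.sum_univ_five]
    ring
  · rintro rfl
    change ∑ i, mul13 _ _ _ = _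
    simp [mul13, Fin.sum_univ_five]
    ring
  · rintro rfl
    change ∑ i, mul14 _ _ _ = _
    simp [mul14, Fin.sum_univ_five]
    ring

/-- The leading coordinates of an idempotent are 0 or 1, which leaves finitely many traces. The
witnesses are an idempotent acting as zero on the radical at index 11, and the unity of the factor ℂ
at index 13. -/
theorem hasIdemTrace_one_iff (k : Fin 16) (hk : k ∈ Finset.Icc (5 : Fin 16) 13) :
    HasIdemTrace 1 k ↔ k = 11 ∨ k = 13 := by
  constructor
  · rintro ⟨e, he, ht⟩
    have h0 := idem_apply k he 0
    have h1 := idem_apply k he 1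
    have h2 := idem_apply k he 2
    obtain ⟨t1, t2, t3, t4, t5⟩ := traceC_eq k e
    rw [ht] at t1 t2 t3 t4 t5
    by_contra hc
    fin_cases k <;> simp [charNum] at hk hc h0 h1 h2 t1 t2 t4
    iterate 4
      rcases h0 with h0 | h0 <;> rcases h1 with h1 | h1 <;> norm_num [h0, h1] at t1
    iterate 2
      rcases h0 with h0 | h0 <;> rcases h1 with h1 | h1 <;> norm_num [h0, h1] at t2
    rcases h0 with h0 | h0 <;> rcases h1 with h1 | h1 <;> rcases h2 with h2 | h2 <;>
      norm_num [h0, h1, h2] at t4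
  · rintro (rfl | rfl)
    · refine ⟨![0, 1, 0, 0, 0], ?_, by rw [(traceC_eq 11 _).2.2.1 rfl]; simp⟩
      change mul12 _ _ = _
      simp [mul12]
    · refine ⟨![1, 0, 0, 0, 0], ?_, by rw [(traceC_eq 13 _).2.2.2.2 rfl]; simp⟩
      change mul14 _ _ = _
      simp [mul14]

theorem hasIdemTrace_three_iff (k : Fin 16) (hk : k ∈ Finset.Icc (5 : Fin 16) 11) :
    HasIdemTrace 3 k ↔ k ∈ ({5, 6, 7, 8} : Finset (Fin 16)) := by
  constructor
  · rintro ⟨e, he, ht⟩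
    have h0 := idem_apply k he 0
    have h1 := idem_apply k he 1
    obtain ⟨t1, t2, t3, t4, t5⟩ := traceC_eq k e
    rw [ht] at t1 t2 t3 t4 t5
    by_contra hc
    fin_cases k <;> simp [charNum] at hk hc h0 h1 t2
    iterate 2
      rcases h0 with h0 | h0 <;> rcases h1 with h1 | h1 <;> norm_num [h0, h1] at t2
    have t3 := t3 rfl
    rcases h0 with h0 | h0 <;> rcases h1 with h1 | h1 <;> norm_num [h0, h1] at t3
  · intro h
    refine ⟨![1, 0, 0, 0, 0], ?_, by rw [(traceC_eq k _).1 h]; simp⟩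
    simp only [Finset.mem_insert, Finset.mem_singleton] at h
    rcases h with rfl | rfl | rfl | rfl
    · change mul6 _ _ = _
      simp [mul6]
    · change mul7 _ _ = _
      simp [mul7]
    · change mul8 _ _ = _
      simp [mul8]
    · change mul9 _ _ = _
      simp [mul9]

/-- A single vector, the sum of all basis vectors of the radical for which the first two coordinates
vanish, has nonzero square in each of the four positive cases. -/
theorem hasNonzeroSq_iff (k : Fin 16) (hk : k ∈ Finset.Icc (5 : Fin 16) 11) :
    HasNonzeroSq k ↔ k ∈ ({6, 7, 8, 10} : Finset (Fin 16)) := by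
  constructor
  · rintro ⟨x, hx, h⟩
    by_contra hc
    rw [isCubeZero_iff k (by revert hk; fin_cases k <;> simp [codimRad, charNum])] at hx
    apply h
    have h0 := hx 0
    have h1 := hx 1
    revert h0 h1 hk hc
    apply mulC_cases (P := fun k m => k ∈ Finset.Icc (5 : Fin 16) 11 →
      k ∉ ({6, 7, 8, 10} : Finset (Fin 16)) → (_ < codimRad k → x 0 = 0) →
      (_ < codimRad k → x 1 = 0) → m x x = 0) <;>
    · intro hk hc h0 h1
      simp [codimRad] at hk hc h0 h1
      try simp [mul6, mul10, mul12, h0, h1]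
  · intro h
    have hN : ∀ x, IsCubeZero k x ↔ x ∈ vanish (codimRad k) := fun x =>
      isCubeZero_iff k (by revert hk; fin_cases k <;> simp [codimRad, charNum]) x
    refine ⟨![0, 0, 1, 1, 1], (hN _).2 ?_, ?_⟩
    · intro i hi
      revert hi hk
      fin_cases k <;> fin_cases i <;> simp [codimRad]
    · simp only [Finset.mem_insert, Finset.mem_singleton] at h
      intro h'
      rcases h with rfl | rfl | rfl | rfl
      · simpa [mul7] using congrFun (show mul7 _ _ = 0 from h') 2
      · have := congrFun (show mul8 _ _ = 0 from h') 2
        simp [mul8] at this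
      · have := congrFun (show mul9 _ _ = 0 from h') 4
        simp [mul9] at this
      · simpa [mul11] using congrFun (show mul11 _ _ = 0 from h') 2

/-- Isomorphisms preserve the dimension of the radical. -/
theorem IsRadical.finrank_le {J J' : Type*} [NonAssocCommRing J] [Module ℂ J]
    [NonAssocCommRing J'] [Module ℂ J'] [FiniteDimensional ℂ J'] {R : Submodule ℂ J}
    {S : Submodule ℂ J'} (hR : IsRadical R) (hS : IsRadical S) (f : J ≃ₗ[ℂ] J')
    (hf : ∀ x y, f (x * y) = f x * f y) : finrank ℂ R ≤ finrank ℂ S := by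
  have h1 : f 1 = 1 := by
    rw [← mul_one (f 1), ← f.apply_symm_apply (1 : J'), ← hf, one_mul]
  have hpow : ∀ x n, f (jpow x n) = jpow (f x) n := by
    intro x n
    induction n with
    | zero => exact h1
    | succ n ih => rw [jpow, hf, ih, jpow]
  have hle : R.map (f : J →ₗ[ℂ] J') ≤ S := by
    refine hS.2 ⟨?_, ?_⟩
    · rintro x _ ⟨y, hy, rfl⟩
      exact ⟨f.symm x * y, hR.1.mul_mem _ y hy, by simp [hf]⟩
    · rintro _ ⟨y, hy, rfl⟩
      obtain ⟨n, hn⟩ := hR.1.nil y hy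
      exact ⟨n, by simp [← hpow, hn]⟩
  exact (f.submoduleMap R).finrank_eq.trans_le (Submodule.finrank_mono hle)

/-- Elements of `J5 k` with vanishing cube, for `k ≤ 4`. -/
theorem isCubeZero_iff_of_le_four {k : Fin 16} (hk : k ≤ 4) (x : Fin 5 → ℂ) :
    IsCubeZero k x ↔ x 0 = 0 := by
  rw [isCubeZero_iff k (by revert hk; fin_cases k <;> simp [codimRad, charNum])]
  have : codimRad k = 1 := by revert hk; fin_cases k <;> simp [codimRad]
  rw [this]
  exact ⟨fun h => h 0 (by simp), fun h i hi => by rwa [show i = 0 by ext; simpa using hi]⟩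

/-- Elements of `J5 k` with vanishing cube, for `5 ≤ k ≤ 11`. -/
theorem isCubeZero_iff_of_mem_Icc {k : Fin 16} (hk : k ∈ Finset.Icc (5 : Fin 16) 11)
    (x : Fin 5 → ℂ) : IsCubeZero k x ↔ x 0 = 0 ∧ x 1 = 0 := by
  rw [isCubeZero_iff k (by revert hk; fin_cases k <;> simp [codimRad, charNum])]
  have : codimRad k = 2 := by revert hk; fin_cases k <;> simp [codimRad]
  rw [this]
  refine ⟨fun h => ⟨h 0 (by simp), h 1 (by simp)⟩, fun h i hi => ?_⟩
  have : i = 0 ∨ i = 1 := by revert hi; revert i; decide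
  rcases this with rfl | rfl
  exacts [h.1, h.2]

/-- With squares x₁² + x₂² and 2x₁x₂ (index 1) or one rank-one square (indices 2 and 6), square-zero
elements lie in the kernel of the product. A quadratic form of rank at least two has isotropic
vectors outside its kernel, such as (1, i); indices 0 and 8 have a square-zero basis vector with a
nonzero product. -/
theorem hasSqZeroNotAnn_iff (k : Fin 16) (hk : k ∈ ({0, 1, 2, 3, 4, 6, 7, 8} : Finset (Fin 16))) :
    HasSqZeroNotAnn k ↔ k ∈ ({0, 3, 4, 7, 8} : Finset (Fin 16)) := by
  constructor
  · rintro ⟨x, y, hx, hy, h, h'⟩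
    by_contra hc
    have : k = 1 ∨ k = 2 ∨ k = 6 := by
      clear hx hy h h'
      revert k
      decide
    rcases this with rfl | rfl | rfl
    · rw [isCubeZero_iff_of_le_four (by decide)] at hx hy
      have h3 := congrFun (show mul2 _ _ = 0 from h) 3
      have h4 := congrFun (show mul2 _ _ = 0 from h) 4
      simp [mul2, hx] at h3 h4
      have h12 : x 1 * x 2 = 0 := by linear_combination h4 / 2
      have h1 : x 1 = 0 := by
        refine eq_zero_of_pow_eq_zero (n := 3) ?_
        linear_combination x 1 * h3 - x 2 * h12
      have h2 : x 2 = 0 := by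
        refine eq_zero_of_pow_eq_zero (n := 2) ?_
        linear_combination h3 - x 1 * h1
      apply h'
      change mul2 _ _ = 0
      simp [mul2, hx, hy, h1, h2]
    · rw [isCubeZero_iff_of_le_four (by decide)] at hx hy
      have h4 := congrFun (show mul3 _ _ = 0 from h) 4
      simp [mul3, hx] at h4
      apply h'
      change mul3 _ _ = 0
      simp [mul3, hx, hy, h4]
    · rw [isCubeZero_iff_of_mem_Icc (by decide)] at hx hy
      have h2 := congrFun (show mul7 _ _ = 0 from h) 2
      simp [mul7, hx] at h2
      apply h'
      change mul7 _ _ = 0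
      simp [mul7, hx, hy, h2]
  · intro h
    simp only [Finset.mem_insert, Finset.mem_singleton] at h
    rcases h with rfl | rfl | rfl | rfl | rfl
    · refine ⟨![0, 0, 1, 0, 0], ![0, 1, 0, 0, 0], (isCubeZero_iff_of_le_four (by decide) _).2 rfl,
        (isCubeZero_iff_of_le_four (by decide) _).2 rfl, ?_, fun h => ?_⟩
      · change mul1 _ _ = 0
        simp [mul1]
      · simpa [mul1] using congrFun (show mul1 _ _ = 0 from h) 4
    · refine ⟨![0, 1, Complex.I, 0, 0], ![0, 1, 0, 0, 0],
        (isCubeZero_iff_of_le_four (by decide) _).2 rfl,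
        (isCubeZero_iff_of_le_four (by decide) _).2 rfl, ?_, fun h => ?_⟩
      · change mul4 _ _ = 0
        simp [mul4]
      · simpa [mul4] using congrFun (show mul4 _ _ = 0 from h) 4
    · refine ⟨![0, 1, Complex.I, 0, 0], ![0, 1, 0, 0, 0],
        (isCubeZero_iff_of_le_four (by decide) _).2 rfl,
        (isCubeZero_iff_of_le_four (by decide) _).2 rfl, ?_, fun h => ?_⟩
      · change mul5 _ _ = 0
        simp [mul5]
      · simpa [mul5] using congrFun (show mul5 _ _ = 0 from h) 4
    · refine ⟨![0, 0, 0, 1, Complex.I], ![0, 0, 0, 1, 0],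
        (isCubeZero_iff_of_mem_Icc (by decide) _).2 ⟨rfl, rfl⟩,
        (isCubeZero_iff_of_mem_Icc (by decide) _).2 ⟨rfl, rfl⟩, ?_, fun h => ?_⟩
      · change mul8 _ _ = 0
        simp [mul8]
      · simpa [mul8] using congrFun (show mul8 _ _ = 0 from h) 2
    · refine ⟨![0, 0, 1, 0, 0], ![0, 0, 0, 1, 0],
        (isCubeZero_iff_of_mem_Icc (by decide) _).2 ⟨rfl, rfl⟩,
        (isCubeZero_iff_of_mem_Icc (by decide) _).2 ⟨rfl, rfl⟩, ?_, fun h => ?_⟩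
      · change mul9 _ _ = 0
        simp [mul9]
      · simpa [mul9] using congrFun (show mul9 _ _ = 0 from h) 4

/-- At index 8 every square in the radical is a multiple of d, on which the relevant idempotent acts
by 1/2; at index 7 one has b² = a and e₁a = a. -/
theorem hasFixedSq_iff (k : Fin 16) (hk : k ∈ ({7, 8} : Finset (Fin 16))) :
    HasFixedSq k ↔ k = 7 := by
  constructor
  · rintro ⟨e, x, he, ht, hx, h, h'⟩
    by_contra hc
    have : k = 8 := by
      clear hx he ht h h'
      revert k
      decide
    subst this
    rw [isCubeZero_iff_of_mem_Icc (by decide)] at hx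
    have h0 := idem_apply 8 he 0 (by simp [charNum])
    have h1 := idem_apply 8 he 1 (by simp [charNum])
    rw [(traceC_eq 8 e).1 (by decide)] at ht
    have h4 := congrFun (show mul9 e (mul9 x x) = mul9 x x from h') 4
    simp [mul9, hx] at h4
    apply h
    change mul9 _ _ = 0
    simp only [mul9, hx]
    rcases h0 with h0 | h0 <;> rcases h1 with h1 | h1 <;> norm_num [h0, h1] at ht
    have : x 2 * x 3 + x 3 * x 2 = 0 := by
      simp [h0, h1] at h4
      linear_combination -2 * h4
    simpa using this
  · rintro rfl
    refine ⟨![1, 0, 0, 0, 0], ![0, 0, 0, 1, 0], ?_, ?_,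
        (isCubeZero_iff_of_mem_Icc (by decide) _).2 ⟨rfl, rfl⟩, fun h => ?_, ?_⟩
    · change mul8 _ _ = _
      simp [mul8]
    · rw [(traceC_eq 7 _).1 (by decide)]
      simp
    · simpa [mul8] using congrFun (show mul8 _ _ = 0 from h) 2
    · change mul8 _ (mul8 _ _) = mul8 _ _
      simp [mul8]

theorem hasIndepSq_iff (k : Fin 16) (hk : k ≤ 4) : HasIndepSq k ↔ k = 0 ∨ k = 1 := by
  constructor
  · rintro ⟨x, y, hx, hy, h⟩
    by_contra hc
    rw [isCubeZero_iff_of_le_four hk] at hx hy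
    have key : ∀ z : Fin 5 → ℂ, z 0 = 0 →
        mulC k z z = mulC k z z 4 • (Pi.single 4 1 : Fin 5 → ℂ) := by
      clear h
      revert hc hk
      apply mulC_cases (P := fun k m => k ≤ 4 → ¬ (k = 0 ∨ k = 1) → ∀ z : Fin 5 → ℂ, z 0 = 0 →
        m z z = m z z 4 • (Pi.single 4 1 : Fin 5 → ℂ)) <;>
      · intro hk hc z hz
        first
        | exact absurd hk (by decide)
        | exact absurd (by decide) hc
        | ext i
          fin_cases i <;> simp [mul3, mul4, mul5, hz]
    obtain ⟨a, ha⟩ : ∃ a, a = mulC k x x 4 := ⟨_, rfl⟩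
    obtain ⟨b, hb⟩ : ∃ b, b = mulC k y y 4 := ⟨_, rfl⟩
    rw [key x hx, key y hy, ← ha, ← hb, LinearIndependent.pair_iff] at h
    have h1 := h b (-a) (by module)
    have h2 := h 1 0 (by simp [neg_eq_zero.1 h1.2])
    exact one_ne_zero h2.1
  · intro h
    refine ⟨![0, 1, 0, 0, 0], ![0, 1, 1, 0, 0], (isCubeZero_iff_of_le_four hk _).2 rfl,
      (isCubeZero_iff_of_le_four hk _).2 rfl, ?_⟩
    rw [LinearIndependent.pair_iff]
    intro a b hab
    rcases h with rfl | rfl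
    · change a • mul1 _ _ + b • mul1 _ _ = 0 at hab
      have h3 := congrFun hab 3
      have h4 := congrFun hab 4
      simp [mul1] at h3 h4
      exact ⟨by linear_combination h3 - h4, h4⟩
    · change a • mul2 _ _ + b • mul2 _ _ = 0 at hab
      have h3 := congrFun hab 3
      have h4 := congrFun hab 4
      simp [mul2] at h3 h4
      exact ⟨by linear_combination h3 - 2 * h4, h4⟩

/-- The annihilator of the radical in itself is spanned by v₃ and v₄ at index 3, and only by v₄ at
index 4, where the form on v₁, v₂, v₃ is nondegenerate. -/
theorem hasIndepAnn_iff (k : Fin 16) (hk : k ∈ ({3, 4} : Finset (Fin 16))) :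
    HasIndepAnn k ↔ k = 3 := by
  constructor
  · rintro ⟨x, y, hx, hy, h, h'⟩
    by_contra hc
    have : k = 4 := by
      clear hx hy h h'
      revert k
      decide
    subst this
    have key : ∀ x : Fin 5 → ℂ, x 0 = 0 → (∀ z, IsCubeZero 4 z → mulC 4 x z = 0) →
        x = x 4 • (Pi.single 4 1 : Fin 5 → ℂ) := by
      intro x hx h
      have h1 := congrFun (show mul5 _ _ = 0 from
        h ![0, 1, 0, 0, 0] ((isCubeZero_iff_of_le_four (by decide) _).2 rfl)) 4
      have h2 := congrFun (show mul5 _ _ = 0 from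
        h ![0, 0, 1, 0, 0] ((isCubeZero_iff_of_le_four (by decide) _).2 rfl)) 4
      have h3 := congrFun (show mul5 _ _ = 0 from
        h ![0, 0, 0, 1, 0] ((isCubeZero_iff_of_le_four (by decide) _).2 rfl)) 4
      simp [mul5] at h1 h2 h3
      ext i
      fin_cases i <;> simp [hx, h1, h2, h3]
    have kx := key x ((isCubeZero_iff_of_le_four (by decide) _).1 hx) fun z hz => (h' z hz).1
    have ky := key y ((isCubeZero_iff_of_le_four (by decide) _).1 hy) fun z hz => (h' z hz).2
    rw [kx, ky, LinearIndependent.pair_iff] at h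
    have h1 := h (y 4) (-x 4) (by module)
    have h2 := h 1 0 (by simp [neg_eq_zero.1 h1.2])
    exact one_ne_zero h2.1
  · rintro rfl
    refine ⟨![0, 0, 0, 1, 0], ![0, 0, 0, 0, 1], (isCubeZero_iff_of_le_four (by decide) _).2 rfl,
      (isCubeZero_iff_of_le_four (by decide) _).2 rfl, ?_, fun z hz => ?_⟩
    · rw [LinearIndependent.pair_iff]
      intro a b hab
      have h3 := congrFun hab 3
      have h4 := congrFun hab 4
      simp at h3 h4
      exact ⟨h3, h4⟩
    · rw [isCubeZero_iff_of_le_four (by decide)] at hz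
      change mul4 _ _ = 0 ∧ mul4 _ _ = 0
      simp [mul4, hz]

-- The combinatorial end of the separation: each invariant is compared only on the range of indices
-- where it was computed, and the finite check confirms that together they determine the index.
set_option synthInstance.maxHeartbeats 400000 in
set_option synthInstance.maxSize 4000 in
set_option maxRecDepth 10000 in
theorem eq_of_invariants : ∀ k l : Fin 16, codimRad k = codimRad l →
    (k ∈ Finset.Icc (5 : Fin 16) 13 → l ∈ Finset.Icc (5 : Fin 16) 13 →
      ((k = 11 ∨ k = 13) ↔ (l = 11 ∨ l = 13))) →
    (k ∈ Finset.Icc (5 : Fin 16) 11 → l ∈ Finset.Icc (5 : Fin 16) 11 →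
      (k ∈ ({5, 6, 7, 8} : Finset (Fin 16)) ↔ l ∈ ({5, 6, 7, 8} : Finset (Fin 16)))) →
    (k ∈ Finset.Icc (5 : Fin 16) 11 → l ∈ Finset.Icc (5 : Fin 16) 11 →
      (k ∈ ({6, 7, 8, 10} : Finset (Fin 16)) ↔ l ∈ ({6, 7, 8, 10} : Finset (Fin 16)))) →
    (k ∈ ({0, 1, 2, 3, 4, 6, 7, 8} : Finset (Fin 16)) →
      l ∈ ({0, 1, 2, 3, 4, 6, 7, 8} : Finset (Fin 16)) →
      (k ∈ ({0, 3, 4, 7, 8} : Finset (Fin 16)) ↔ l ∈ ({0, 3, 4, 7, 8} : Finset (Fin 16)))) →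
    (k ∈ ({7, 8} : Finset (Fin 16)) → l ∈ ({7, 8} : Finset (Fin 16)) → (k = 7 ↔ l = 7)) →
    (k ≤ 4 → l ≤ 4 → ((k = 0 ∨ k = 1) ↔ (l = 0 ∨ l = 1))) →
    (k ∈ ({3, 4} : Finset (Fin 16)) → l ∈ ({3, 4} : Finset (Fin 16)) → (k = 3 ↔ l = 3)) →
    k = l := by
  decide

/-- The sixteen algebras are pairwise non-isomorphic. -/
theorem eq_of_isomorphic (k l : Fin 16) (h : Isomorphic (J5 k) (J5 l)) : k = l := by
  obtain ⟨f, hf⟩ := h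
  obtain ⟨φ, hφ⟩ := exists_isCoord k
  obtain ⟨ψ, hψ⟩ := exists_isCoord l
  have hg : IsIsoC k l (φ.symm ≪≫ₗ f ≪≫ₗ ψ) := by
    intro x y
    simp only [LinearEquiv.trans_apply, ← hψ.map_mul, ← hf]
    congr 2
    exact φ.injective (by simp [hφ.map_mul])
  refine eq_of_invariants k l ?_ (fun h h' => ?_) (fun h h' => ?_) (fun h h' => ?_)
    (fun h h' => ?_) (fun h h' => ?_) (fun h h' => ?_) (fun h h' => ?_)
  · obtain ⟨-, h1, -, R, hR, hR'⟩ := J5_spec k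
    obtain ⟨-, h2, -, S, hS, hS'⟩ := J5_spec l
    have := FiniteDimensional.of_finrank_pos (show 0 < finrank ℂ (J5 k) by omega)
    have := FiniteDimensional.of_finrank_pos (show 0 < finrank ℂ (J5 l) by omega)
    have h3 := hR.finrank_le hS f hf
    have h4 := hS.finrank_le hR f.symm fun x y => f.injective (by simp [hf])
    have h5 : ∀ k, codimRad k ≤ 5 := by decide
    have := h5 k
    have := h5 l
    omega
  · rw [← hasIdemTrace_one_iff k h, ← hasIdemTrace_one_iff l h']
    exact ⟨hg.hasIdemTrace, hg.symm.hasIdemTrace⟩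
  · rw [← hasIdemTrace_three_iff k h, ← hasIdemTrace_three_iff l h']
    exact ⟨hg.hasIdemTrace, hg.symm.hasIdemTrace⟩
  · rw [← hasNonzeroSq_iff k h, ← hasNonzeroSq_iff l h']
    exact ⟨hg.hasNonzeroSq, hg.symm.hasNonzeroSq⟩
  · rw [← hasSqZeroNotAnn_iff k h, ← hasSqZeroNotAnn_iff l h']
    exact ⟨hg.hasSqZeroNotAnn, hg.symm.hasSqZeroNotAnn⟩
  · rw [← hasFixedSq_iff k h, ← hasFixedSq_iff l h']
    exact ⟨hg.hasFixedSq, hg.symm.hasFixedSq⟩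
  · rw [← hasIndepSq_iff k h, ← hasIndepSq_iff l h']
    exact ⟨hg.hasIndepSq, hg.symm.hasIndepSq⟩
  · rw [← hasIndepAnn_iff k h, ← hasIndepAnn_iff l h']
    exact ⟨hg.hasIndepAnn, hg.symm.hasIndepAnn⟩

/-! ### Recognition by structure constants and normal form of quadratic forms -/

section Criteria

/-- Structure constants determine an algebra up to isomorphism. -/
theorem isomorphic_of_mul_eq {J : Type*} [NonAssocCommRing J] [Module ℂ J] [IsScalarTower ℂ J J]
    [SMulCommClass ℂ J J] (hJ : finrank ℂ J = 5) (k : Fin 16) (v : Fin 5 → J)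
    (hspan : ⊤ ≤ Submodule.span ℂ (Set.range v))
    (hv : ∀ i j, i ≤ j → v i * v j = ∑ l, mulC k (Pi.single i 1) (Pi.single j 1) l • v l) :
    Isomorphic J (J5 k) := by
  obtain ⟨φ, hφ⟩ := exists_isCoord k
  let b := basisOfTopLeSpanOfCardEqFinrank v hspan (by rw [hJ, Fintype.card_fin])
  have hb : ∀ i, b i = v i := fun i => by simp [b]
  have hcomm : ∀ x y, mulC k x y = mulC k y x := fun x y => by
    have := hφ.map_mul (φ.symm x) (φ.symm y)
    rw [mul_comm, hφ.map_mul] at this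
    simpa using this.symm
  have hv' : ∀ i j, v i * v j = ∑ l, mulC k (Pi.single i 1) (Pi.single j 1) l • v l := by
    intro i j
    rcases le_total i j with h | h
    · exact hv i j h
    · rw [mul_comm, hv j i h, hcomm]
  let f : J ≃ₗ[ℂ] J5 k := b.equivFun ≪≫ₗ φ.symm
  have hf : ∀ w : Fin 5 → ℂ, f (∑ l, w l • v l) = φ.symm w := fun w => by
    simp only [f, ← hb, LinearEquiv.trans_apply, ← b.equivFun_symm_apply,
      LinearEquiv.apply_symm_apply]
  have hfv : ∀ i, f (v i) = φ.symm (Pi.single i 1) := fun i => by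
    rw [← hf]
    simp [Pi.single_apply]
  have key : (LinearMap.mul ℂ J).compr₂ (f : J →ₗ[ℂ] J5 k) =
      (LinearMap.mul ℂ (J5 k)).compl₁₂ (f : J →ₗ[ℂ] J5 k) (f : J →ₗ[ℂ] J5 k) := by
    refine b.ext fun i => b.ext fun j => ?_
    simp only [LinearMap.compr₂_apply, LinearMap.compl₁₂_apply, LinearMap.mul_apply',
      LinearEquiv.coe_coe, hb, hfv]
    rw [hv', hf]
    exact φ.injective (by simp [hφ.map_mul])
  exact ⟨f, fun x y => LinearMap.congr_fun₂ key x y⟩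

/-- A symmetric bilinear form over `ℂ` is a sum of squares in a suitable basis. -/
theorem exists_basis_sum_squares {V : Type*} [AddCommGroup V] [Module ℂ V] [FiniteDimensional ℂ V]
    (B : LinearMap.BilinForm ℂ V) (hB : ∀ x y, B x y = B y x) {n : ℕ} (hn : finrank ℂ V = n) :
    ∃ r ≤ n, ∃ b : Basis (Fin n) ℂ V, ∀ i j, B (b i) (b j) = if i = j ∧ i.val < r then 1 else 0 := by
  subst hn
  obtain ⟨v, hv⟩ := LinearMap.BilinForm.exists_orthogonal_basis (B := B) ⟨hB⟩
  classical
  let p : Fin (finrank ℂ V) → Prop := fun i => B (v i) (v i) ≠ 0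
  have hr : Fintype.card {i // p i} ≤ finrank ℂ V := by
    simpa using Fintype.card_subtype_le p
  set r := Fintype.card {i // p i}
  let e₀ : {i : Fin (finrank ℂ V) // i.val < r} ≃ {i // p i} :=
    Fintype.equivOfCardEq (by
      rw [Fintype.card_of_subtype (Finset.univ.map (Fin.castLEEmb hr))]
      · simp [r]
      · intro i
        simp only [Finset.mem_map, Finset.mem_univ, true_and]
        exact ⟨fun ⟨j, hj⟩ => hj ▸ j.2, fun h => ⟨⟨i, h⟩, rfl⟩⟩)
  -- The permutation moves the non-isotropic vectors of the orthogonal basis to the front; the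
  -- scaling `c` below divides them by a square root of their value and leaves the isotropic ones
  -- alone.
  let σ : Equiv.Perm (Fin (finrank ℂ V)) := e₀.extendSubtype
  have hσ : ∀ i, B (v (σ i)) (v (σ i)) ≠ 0 ↔ i.val < r := fun i =>
    ⟨fun h => by_contra fun hi => e₀.extendSubtype_not_mem i hi h,
      fun h => e₀.extendSubtype_mem i h⟩
  choose s hs using fun z : ℂ => IsAlgClosed.exists_pow_nat_eq z (n := 2) (by norm_num)
  let c : Fin (finrank ℂ V) → ℂ := fun i =>
    if B (v (σ i)) (v (σ i)) = 0 then 1 else (s (B (v (σ i)) (v (σ i))))⁻¹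
  have hs0 : ∀ z : ℂ, z ≠ 0 → s z ≠ 0 := fun z hz h => hz (by rw [← hs z, h]; simp)
  have hc : ∀ i, IsUnit (c i) := fun i => by
    simp only [c]
    split_ifs with h
    · simp
    · exact (inv_ne_zero (hs0 _ h)).isUnit
  refine ⟨r, hr, (v.reindex σ.symm).isUnitSMul hc, fun i j => ?_⟩
  simp only [Basis.isUnitSMul_apply, Basis.reindex_apply, Equiv.symm_symm, map_smul,
    LinearMap.smul_apply, smul_eq_mul]
  by_cases hij : i = j
  · subst hij
    by_cases h : B (v (σ i)) (v (σ i)) = 0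
    · have : ¬ i.val < r := fun hi => (hσ i).2 hi h
      simp [h, this]
    · have h' := (hσ i).1 h
      have h0 := hs0 _ h
      simp only [c, h, h', if_false, and_self, if_true]
      conv_lhs => rw [← hs (B (v (σ i)) (v (σ i)))]
      rw [hs]
      have := hs (B (v (σ i)) (v (σ i)))
      field_simp
      exact this.symm
  · have : B (v (σ i)) (v (σ j)) = 0 := hv (fun h => hij (σ.injective h))
    simp [hij, this]

end Criteria

/-! ### Linearized Jordan identity and Peirce decomposition -/

section Peirce

variable {J : Type*} [NonAssocCommRing J] [Module ℂ J] [IsScalarTower ℂ J J]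
  [SMulCommClass ℂ J J] [IsCommJordan J]

/-- The full linearization of the Jordan identity. -/
theorem jordan_lin (a b c y : J) :
    (a * b) * (c * y) + (b * c) * (a * y) + (c * a) * (b * y) =
      c * ((a * b) * y) + a * ((b * c) * y) + b * ((c * a) * y) := by
  have h := congrArg (fun T => T y) (two_nsmul_lie_lmul_lmul_add_add_eq_zero a b c)
  simp only [Ring.lie_def, AddMonoid.End.mulLeft] at h
  replace h : 2 • ((a * ((b * c) * y) - (b * c) * (a * y)) + (b * ((c * a) * y) - (c * a) * (b * y))
      + (c * ((a * b) * y) - (a * b) * (c * y))) = 0 := h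
  have h2 : (2 : ℂ) • ((a * ((b * c) * y) - (b * c) * (a * y)) +
      (b * ((c * a) * y) - (c * a) * (b * y)) + (c * ((a * b) * y) - (a * b) * (c * y))) = 0 := by
    rw [← h]
    module
  have h3 := (smul_eq_zero.1 h2).resolve_left two_ne_zero
  linear_combination (norm := module) (-1 : ℂ) • h3

theorem jordan_sq (x y : J) : x * ((x * x) * y) = (x * x) * (x * y) := by
  have := jordan_lin x x x y
  have h3 : (3 : ℂ) • (x * ((x * x) * y) - (x * x) * (x * y)) = 0 := by
    linear_combination (norm := module) (-1 : ℂ) • this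
  exact sub_eq_zero.1 ((smul_eq_zero.1 h3).resolve_left three_ne_zero)

/-- Multiplication by e is a root of 2t³ - 3t² + t = t(2t - 1)(t - 1), so only the eigenvalues 0,
1/2 and 1 occur. -/
theorem peirce_cubic {e : J} (he : e * e = e) (z : J) :
    (2 : ℂ) • (e * (e * (e * z))) = (3 : ℂ) • (e * (e * z)) - e * z := by
  have := jordan_lin e e z e
  rw [he, he, mul_comm z e, mul_comm (e * z) e] at this
  linear_combination (norm := module) (-1 : ℂ) • this

/-- The Peirce decomposition with respect to an idempotent. -/
theorem peirce_decomp {e : J} (he : e * e = e) (z : J) : ∃ a m c : J, z = a + m + c ∧ e * a = a ∧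
    e * m = (1 / 2 : ℂ) • m ∧ e * c = 0 := by
  have h := peirce_cubic he z
  -- The three components are the Lagrange interpolation polynomials at 1, 1/2 and 0, namely 2t² -
  -- t, 4t - 4t² and 1 - 3t + 2t², evaluated at multiplication by e.
  refine ⟨(2 : ℂ) • (e * (e * z)) - e * z, (4 : ℂ) • (e * z) - (4 : ℂ) • (e * (e * z)),
    z - (3 : ℂ) • (e * z) + (2 : ℂ) • (e * (e * z)), by module, ?_, ?_, ?_⟩ <;>
    simp only [mul_sub, mul_add, mul_smul_comm]
  · linear_combination (norm := module) h
  · linear_combination (norm := module) (-2 : ℂ) • h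
  · linear_combination (norm := module) h

/-- Products with an element of the Peirce spaces for `1` and `0` preserve Peirce spaces. -/
theorem peirce_mul {e : J} (he : e * e = e) {s t : ℂ} (hs : s ≠ 1 / 2) {z y : J}
    (hz : e * z = s • z) (hy : e * y = t • y) : e * (z * y) = t • (z * y) := by
  have h := jordan_lin e e z y
  rw [he, mul_comm z e, hz, hy] at h
  simp only [mul_smul_comm, smul_mul_assoc] at h
  have h1 : (1 - 2 * s) • (e * (z * y) - t • (z * y)) = 0 := by
    linear_combination (norm := module) h
  refine sub_eq_zero.1 ((smul_eq_zero.1 h1).resolve_left fun h => hs ?_)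
  linear_combination (-1 / 2 : ℂ) * h

/-- The product of two elements of the Peirce space for `1 / 2`. -/
theorem peirce_half_mul_half {e : J} (he : e * e = e) {z w : J} (hz : e * z = (1 / 2 : ℂ) • z)
    (hw : e * w = (1 / 2 : ℂ) • w) : e * (e * (z * w)) = e * (z * w) := by
  have h := jordan_lin e z w e
  rw [mul_comm w e, mul_comm z e, he, hz, hw] at h
  simp only [mul_smul_comm, smul_mul_assoc, mul_comm w z, mul_comm z e, mul_comm w e, hz, hw,
    mul_comm (z * w) e] at h
  linear_combination (norm := module) (-1 : ℂ) • h

/-- The Peirce space for `1` acts on the one for `1 / 2` by a homomorphism, up to a factor. -/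
theorem peirce_one_act {e : J} (he : e * e = e) {y w m : J} (hy : e * y = y) (hw : e * w = w)
    (hm : e * m = (1 / 2 : ℂ) • m) : y * (w * m) + w * (y * m) = (y * w) * m := by
  have h1 : e * (y * m) = (1 / 2 : ℂ) • (y * m) :=
    peirce_mul he (s := 1) (by norm_num) (by rw [hy, one_smul]) hm
  have h2 : e * (w * m) = (1 / 2 : ℂ) • (w * m) :=
    peirce_mul he (s := 1) (by norm_num) (by rw [hw, one_smul]) hm
  have h3 : e * (y * w) = y * w := by
    have := peirce_mul he (s := 1) (t := 1) (by norm_num) (by rw [hy, one_smul])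
      (by rw [hw, one_smul] : e * w = (1 : ℂ) • w)
    rwa [one_smul] at this
  have h := jordan_lin y w m e
  rw [mul_comm m y, mul_comm m e, mul_comm y e, mul_comm w e, hy, hw, hm, mul_comm (y * w) e, h3,
    mul_comm (w * m) e, h2, mul_comm (y * m) e, h1, mul_comm (w * m) y, mul_comm m (y * w)] at h
  simp only [mul_smul_comm, mul_comm (y * m) w] at h
  linear_combination (norm := module) (2 : ℂ) • h

end Peirce

/-! ### Algebras with only trivial idempotents: scalar plus nilpotent -/

section LocalCase

/-- The signs are those of X³ - AX² - BX - C = (X - α)(X - β)(X - γ); one root comes from algebraic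
closedness, the others from the quadratic formula. -/
theorem exists_cubic_roots (A B C : ℂ) : ∃ α β γ : ℂ,
    A = α + β + γ ∧ B = -(α * β + α * γ + β * γ) ∧ C = α * β * γ := by
  obtain ⟨α, hα⟩ : ∃ α : ℂ, α ^ 3 - A * α ^ 2 - B * α - C = 0 := by
    obtain ⟨z, hz⟩ := IsAlgClosed.exists_root
      (Polynomial.X ^ 3 - Polynomial.C A * Polynomial.X ^ 2 - Polynomial.C B * Polynomial.X -
        Polynomial.C C : Polynomial ℂ) (by
        have : (Polynomial.X ^ 3 - Polynomial.C A * Polynomial.X ^ 2 -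
          Polynomial.C B * Polynomial.X - Polynomial.C C : Polynomial ℂ).degree = 3 := by
          compute_degree!
        rw [this]
        norm_num)
    exact ⟨z, by simpa using hz⟩
  obtain ⟨d, hd⟩ := IsAlgClosed.exists_pow_nat_eq ((A - α) ^ 2 + 4 * (B + α * (A - α)))
    (n := 2) (by norm_num)
  refine ⟨α, (A - α + d) / 2, (A - α - d) / 2, by ring, by linear_combination (-1 / 4) * hd, ?_⟩
  linear_combination (α / 4) * hd - hα

variable {J : Type*} [NonAssocCommRing J] [Module ℂ J] [IsScalarTower ℂ J J]
  [SMulCommClass ℂ J J] [IsCommJordan J]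

/-- For a root γ distinct from the other two, w = (x - α)(x - β) satisfies xw = γw and w² = (γ -
α)(γ - β)w, so a multiple of it is idempotent. If w is 0 or a scalar, x satisfies the quadratic with
roots α, β or is itself scalar, and the alternatives are settled directly. -/
theorem exists_idempotent_of_root {x : J} {α β γ : ℂ}
    (h : x * (x * x) = (α + β + γ) • (x * x) + (-(α * β + α * γ + β * γ)) • x +
      (α * β * γ) • (1 : J)) (h1 : γ ≠ α) (h2 : γ ≠ β) :
    (∃ c : ℂ, (x - c • 1) * ((x - c • 1) * (x - c • (1 : J))) = 0) ∨
      ∃ e : J, e * e = e ∧ e ≠ 0 ∧ e ≠ 1 := by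
  set w := x * x - (α + β) • x + (α * β) • (1 : J) with hw
  have hxw : x * w = γ • w := by
    rw [hw]
    simp only [mul_add, mul_sub, mul_smul_comm, mul_one, h]
    module
  by_cases hw0 : w = 0
  · have hxx : x * x = (α + β) • x - (α * β) • (1 : J) := by
      linear_combination (norm := module) hw.symm.trans hw0
    by_cases hαβ : α = β
    · left
      refine ⟨α, ?_⟩
      have : (x - α • 1) * (x - α • (1 : J)) = 0 := by
        simp only [mul_sub, sub_mul, mul_smul_comm, smul_mul_assoc, mul_one, one_mul, hxx, hαβ]
        module
      rw [this, mul_zero]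
    · have hne : β - α ≠ 0 := sub_ne_zero.2 (Ne.symm hαβ)
      by_cases hx1 : x = α • (1 : J)
      · exact Or.inl ⟨α, by rw [hx1]; simp⟩
      by_cases hx2 : x = β • (1 : J)
      · exact Or.inl ⟨β, by rw [hx2]; simp⟩
      refine Or.inr ⟨(β - α)⁻¹ • (x - α • 1), ?_, ?_, ?_⟩
      · have : (x - α • 1) * (x - α • (1 : J)) = (β - α) • (x - α • 1) := by
          simp only [mul_sub, sub_mul, mul_smul_comm, smul_mul_assoc, mul_one, one_mul, hxx]
          module
        rw [smul_mul_smul_comm, this, smul_smul, mul_assoc, inv_mul_cancel₀ hne, mul_one]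
      · exact smul_ne_zero (inv_ne_zero hne) (sub_ne_zero.2 hx1)
      · intro h
        have := congrArg (fun z => (β - α) • z) h
        simp only [smul_inv_smul₀ hne] at this
        exact hx2 (by linear_combination (norm := module) this)
  · have hc : (γ - α) * (γ - β) ≠ 0 := mul_ne_zero (sub_ne_zero.2 h1) (sub_ne_zero.2 h2)
    have hxxw : (x * x) * w = (γ * γ) • w := by
      have : (x * x) * w = x * (x * w) := by
        rw [hw]
        simp only [mul_add, mul_sub, mul_smul_comm, mul_one, mul_comm (x * x) x,
          IsCommJordan.lmul_comm_rmul_rmul x x]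
      rw [this, hxw, mul_smul_comm, hxw, smul_smul]
    have hww : w * w = ((γ - α) * (γ - β)) • w := by
      conv_lhs => rw [hw]
      simp only [add_mul, sub_mul, smul_mul_assoc, one_mul]
      rw [hxxw, hxw]
      module
    by_cases hw1 : w = ((γ - α) * (γ - β)) • (1 : J)
    · left
      refine ⟨γ, ?_⟩
      have : ((γ - α) * (γ - β)) • (x - γ • (1 : J)) = 0 := by
        rw [hw1] at hxw
        simp only [mul_smul_comm, mul_one] at hxw
        linear_combination (norm := module) hxw
      rw [(smul_eq_zero.1 this).resolve_left hc, mul_zero, mul_zero]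
    · refine Or.inr ⟨((γ - α) * (γ - β))⁻¹ • w, ?_, smul_ne_zero (inv_ne_zero hc) hw0, fun h => ?_⟩
      · rw [smul_mul_smul_comm, hww, smul_smul, mul_assoc, inv_mul_cancel₀ hc, mul_one]
      · have := congrArg (fun z => ((γ - α) * (γ - β)) • z) h
        simp only [smul_inv_smul₀ hc] at this
        exact hw1 this

/-- If all idempotents of a Jordan algebra of rank three are trivial, then each element is the sum
of a scalar and a nilpotent element. -/
theorem exists_sub_smul_one_cube (hr : HasRank J 3)
    (hidem : ∀ e : J, e * e = e → e = 0 ∨ e = 1) (x : J) :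
    ∃ c : ℂ, (x - c • 1) * ((x - c • 1) * (x - c • (1 : J))) = 0 := by
  have key : ∀ {α β γ : ℂ}, x * (x * x) = (α + β + γ) • (x * x) +
      (-(α * β + α * γ + β * γ)) • x + (α * β * γ) • (1 : J) → γ ≠ α → γ ≠ β →
      ∃ c : ℂ, (x - c • 1) * ((x - c • 1) * (x - c • (1 : J))) = 0 := by
    intro α β γ h h1 h2
    refine (exists_idempotent_of_root h h1 h2).resolve_right ?_
    rintro ⟨e, he, h0, h1⟩
    exact (hidem e he).elim h0 h1
  obtain ⟨A, B, C, h⟩ := hr.exists_cubic x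
  obtain ⟨α, β, γ, rfl, rfl, rfl⟩ := exists_cubic_roots A B C
  -- Unless all three roots coincide, one of them differs from both others; it is moved to the place
  -- of γ.
  by_cases hαβ : α = β
  · by_cases hαγ : γ = α
    · subst hαβ hαγ
      refine ⟨γ, ?_⟩
      simp only [mul_sub, sub_mul, mul_smul_comm, smul_mul_assoc, mul_one, one_mul, h]
      module
    · exact key h hαγ (hαβ ▸ hαγ)
  · by_cases hαγ : γ = α
    · refine key (α := α) (β := γ) (γ := β) ?_ (Ne.symm hαβ) (hαγ ▸ Ne.symm hαβ)
      rw [h]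
      module
    · refine key (α := β) (β := γ) (γ := α) ?_ hαβ (Ne.symm hαγ)
      rw [h]
      module

/-- The multiplication by an element with vanishing cube has trace zero. -/
theorem trace_mulLeft_eq_zero [FiniteDimensional ℂ J] {x : J} (hx : x * (x * x) = 0) :
    LinearMap.trace ℂ J (LinearMap.mulLeft ℂ x) = 0 := by
  have hcube : ∀ x z : J, (x * (x * x)) * z =
      (3 : ℂ) • ((x * x) * (x * z)) - (2 : ℂ) • (x * (x * (x * z))) := by
    intro x z
    have h := jordan_lin x x z x
    rw [mul_comm z x, mul_comm (x * z) (x * x), mul_comm z, mul_comm (x * x) x,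
      mul_comm (x * z) x] at h
    linear_combination (norm := module) (-1 : ℂ) • h
  have hy : (x * x) * (x * x) = 0 := by
    rw [IsCommJordan.lmul_comm_rmul_rmul x x, hx, mul_zero]
  set X := LinearMap.mulLeft ℂ x
  set Y := LinearMap.mulLeft ℂ (x * x)
  have hXY : Commute X Y := LinearMap.ext fun z => jordan_sq x z
  -- The identity `hcube` reads L(x³) = 3L(x²)L(x) - 2L(x)³. As x³ = 0 it gives X³ = (3/2)YX, and
  -- for x², whose square is zero, it gives Y³ = 0; hence X⁹ = 0.
  have h1 : X ^ 3 = (3 / 2 : ℂ) • (Y * X) := by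
    refine LinearMap.ext fun z => ?_
    have := hcube x z
    rw [hx, zero_mul] at this
    change x * (x * (x * z)) = (3 / 2 : ℂ) • ((x * x) * (x * z))
    linear_combination (norm := module) (1 / 2 : ℂ) • this
  have h2 : Y ^ 3 = 0 := by
    refine LinearMap.ext fun z => ?_
    have := hcube (x * x) z
    rw [hy, mul_zero, zero_mul, zero_mul, smul_zero, zero_sub] at this
    have := (smul_eq_zero.1 (neg_eq_zero.1 this.symm)).resolve_left two_ne_zero
    exact this
  have h3 : X ^ 9 = 0 := by
    rw [show (9 : ℕ) = 3 * 3 from rfl, pow_mul, h1, smul_pow, hXY.symm.mul_pow, h2, zero_mul,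
      smul_zero]
  exact (LinearMap.isNilpotent_trace_of_isNilpotent ⟨9, h3⟩).eq_zero

end LocalCase

/-! ### The nil hyperplane and the vanishing of its triple products -/

section NilCase

variable {J : Type*} [NonAssocCommRing J] [Module ℂ J] [IsScalarTower ℂ J J]
  [SMulCommClass ℂ J J] [IsCommJordan J]

/-- A subspace of dimension `n` is spanned by any `n` independent vectors in it. -/
theorem exists_coeff_of_linearIndependent {V : Type*} [AddCommGroup V] [Module ℂ V]
    {N : Submodule ℂ V} [FiniteDimensional ℂ N] {n : ℕ} (hN : finrank ℂ N = n) {v : Fin n → V}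
    (hv : LinearIndependent ℂ v) (hm : ∀ i, v i ∈ N) {x : V} (hx : x ∈ N) :
    ∃ c : Fin n → ℂ, x = ∑ i, c i • v i := by
  have hle : Submodule.span ℂ (Set.range v) ≤ N :=
    Submodule.span_le.2 (Set.range_subset_iff.2 hm)
  have heq := Submodule.eq_of_le_of_finrank_eq hle
    (by rw [finrank_span_eq_card hv, hN, Fintype.card_fin])
  rw [← heq, Submodule.mem_span_range_iff_exists_fun] at hx
  obtain ⟨c, hc⟩ := hx
  exact ⟨c, hc.symm⟩

/-- `N` is a hyperplane of elements with vanishing cube, closed under products. -/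
structure IsNilHyperplane (N : Submodule ℂ J) : Prop where
  finrank_eq : finrank ℂ N = 4
  mul_mem : ∀ x ∈ N, ∀ y ∈ N, x * y ∈ N
  cube : ∀ x ∈ N, x * (x * x) = 0
  decomp : ∀ x : J, ∃ c : ℂ, ∃ n ∈ N, x = c • (1 : J) + n

/-- The hyperplane is the kernel of τ(x) = tr L(x). Elements with vanishing cube have τ = 0 and τ(1)
= 5, so τ reads off the scalar part. Squares of trace-zero elements are nilpotent, and polarization
gives closure under products. -/
theorem exists_isNilHyperplane (hJ : finrank ℂ J = 5) (hr : HasRank J 3)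
    (hidem : ∀ e : J, e * e = e → e = 0 ∨ e = 1) : ∃ N : Submodule ℂ J, IsNilHyperplane N := by
  have : FiniteDimensional ℂ J := .of_finrank_pos (by omega)
  let τ : J →ₗ[ℂ] ℂ := LinearMap.trace ℂ J ∘ₗ LinearMap.mul ℂ J
  have hτ1 : τ 1 = 5 := by
    have : LinearMap.mulLeft ℂ (1 : J) = LinearMap.id := LinearMap.ext fun z => by simp
    change LinearMap.trace ℂ J (LinearMap.mulLeft ℂ 1) = 5
    rw [this, LinearMap.trace_id, hJ]
    norm_num
  have hτ0 : ∀ x : J, x * (x * x) = 0 → τ x = 0 := fun x hx => trace_mulLeft_eq_zero hx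
  have hcube : ∀ x : J, τ x = 0 → x * (x * x) = 0 := by
    intro x hx
    obtain ⟨c, hc⟩ := exists_sub_smul_one_cube hr hidem x
    have := hτ0 _ hc
    rw [map_sub, map_smul, hx, hτ1] at this
    have hc0 : c = 0 := by simpa using this
    simpa [hc0] using hc
  have hsq : ∀ x : J, τ x = 0 → τ (x * x) = 0 := by
    intro x hx
    apply hτ0
    have : (x * x) * (x * x) = 0 := by
      rw [IsCommJordan.lmul_comm_rmul_rmul x x, hcube x hx, mul_zero]
    rw [this, mul_zero]
  refine ⟨LinearMap.ker τ, ?_, fun x hx y hy => ?_, hcube, fun x => ?_⟩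
  · have h := τ.finrank_range_add_finrank_ker
    have hsurj : LinearMap.range τ = ⊤ :=
      LinearMap.range_eq_top.2 (LinearMap.surjective fun h => by simp [h] at hτ1)
    rw [hsurj, finrank_top, finrank_self, hJ] at h
    omega
  · rw [LinearMap.mem_ker] at hx hy ⊢
    have h := hsq (x + y) (by rw [map_add, hx, hy, add_zero])
    simp only [mul_add, add_mul, map_add, hsq x hx, hsq y hy, mul_comm y x] at h
    linear_combination h / 2
  · refine ⟨τ x / 5, x - (τ x / 5) • 1, ?_, by module⟩
    rw [LinearMap.mem_ker, map_sub, map_smul, hτ1, smul_eq_mul]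
    ring

variable {N : Submodule ℂ J}

/-- Polarization of x³ = 0: the part linear in y, isolated by comparing x + y with x - y. -/
theorem IsNilHyperplane.sq_mul (hN : IsNilHyperplane N) {x y : J} (hx : x ∈ N) (hy : y ∈ N) :
    (x * x) * y = (-2 : ℂ) • (x * (x * y)) := by
  have h1 := hN.cube _ (N.add_mem hx hy)
  have h2 := hN.cube _ (N.sub_mem hx hy)
  simp only [mul_add, add_mul, mul_sub, sub_mul, hN.cube x hx, hN.cube y hy, mul_comm y x] at h1 h2
  rw [mul_comm]
  linear_combination (norm := module) (1 / 2 : ℂ) • h1 - (1 / 2 : ℂ) • h2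

/-- Multiplication by an element of `N` has no nonzero eigenvalue on `N`. -/
theorem IsNilHyperplane.eq_zero_of_mul_eq_smul (hN : IsNilHyperplane N) {x y : J} (hx : x ∈ N)
    (hy : y ∈ N) {c : ℂ} (h : x * y = c • y) (hc : c ≠ 0) : y = 0 := by
  have h1 : (x * x) * y = (-2 * c * c) • y := by
    rw [hN.sq_mul hx hy, h, mul_smul_comm, h]
    module
  -- The element x² acts on y by -2c², yet its own square is zero, so the same identity for x²
  -- forces (-2c²)²y = 0.
  have h2 := hN.sq_mul (hN.mul_mem x hx x hx) hy
  rw [IsCommJordan.lmul_comm_rmul_rmul x x, hN.cube x hx, mul_zero, zero_mul, h1, mul_smul_comm,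
    h1, smul_smul, smul_smul] at h2
  refine (smul_eq_zero.1 h2.symm).resolve_left ?_
  simp [hc]

/-- The cube of the four-dimensional nilalgebra `N` vanishes. -/
theorem IsNilHyperplane.sq_mul_eq_zero (hN : IsNilHyperplane N) {x y : J} (hx : x ∈ N) (hy : y ∈ N) :
    (x * x) * y = 0 := by
  by_contra ht
  have : FiniteDimensional ℂ N := .of_finrank_pos (by rw [hN.finrank_eq]; norm_num)
  set t := (x * x) * y with htdef
  have hxy := hN.mul_mem x hx y hy
  have htN : t ∈ N := hN.mul_mem _ (hN.mul_mem x hx x hx) y hy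
  have hx2 : x * x ≠ 0 := fun h => ht (by rw [htdef, h, zero_mul])
  have h1 : x * (x * y) = (-1 / 2 : ℂ) • t := by
    linear_combination (norm := module) (1 / 2 : ℂ) • (hN.sq_mul hx hy)
  -- Commutation of L(x) with L(x²) gives xt = x²(xy), and the linearized Jordan identity gives
  -- 3x²(xy) = -xt.
  have h2 : x * t = 0 := by
    have e1 : x * t = (x * x) * (x * y) := jordan_sq x y
    have e2 := jordan_lin x x y x
    rw [mul_comm y x, mul_comm (x * y) (x * x), mul_comm y ((x * x) * x), mul_comm (x * x) x,
      hN.cube x hx, zero_mul, mul_comm (x * y) x, h1, mul_smul_comm, ← e1] at e2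
    have : (4 : ℂ) • (x * t) = 0 := by linear_combination (norm := module) e2
    exact (smul_eq_zero.1 this).resolve_left (by norm_num)
  -- If x² were a multiple of t, then t would be an eigenvector of multiplication by y with nonzero
  -- eigenvalue.
  have hev : ∀ c : ℂ, x * x ≠ c • t := by
    intro c hc
    have hc0 : c ≠ 0 := fun h => hx2 (by rw [hc, h, zero_smul])
    have : y * t = c⁻¹ • t := by
      conv_rhs => rw [htdef, hc, smul_mul_assoc, smul_smul, inv_mul_cancel₀ hc0, one_smul, mul_comm]
    exact ht (hN.eq_zero_of_mul_eq_smul hy htN this (inv_ne_zero hc0))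
  have hli : ∀ a b c d : ℂ, a • x + b • y + c • (x * y) + d • t = 0 →
      a = 0 ∧ b = 0 ∧ c = 0 ∧ d = 0 := by
    intro a b c d h
    have e1 : a • (x * x) + b • (x * y) + (-1 / 2 * c) • t = 0 := by
      have := congrArg (fun z => x * z) h
      simp only [mul_add, mul_smul_comm, h1, h2, mul_zero] at this
      linear_combination (norm := module) this
    have hb : b = 0 := by
      have := congrArg (fun z => x * z) e1
      simp only [mul_add, mul_smul_comm, h1, h2, mul_zero, hN.cube x hx] at this
      have : (-1 / 2 * b) • t = 0 := by linear_combination (norm := module) this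
      simpa [ht] using this
    have ha : a = 0 := by
      by_contra ha
      apply hev (a⁻¹ * (1 / 2 * c))
      rw [← smul_smul, ← inv_smul_smul₀ ha (x * x)]
      congr 1
      rw [hb] at e1
      linear_combination (norm := module) e1
    have hc : c = 0 := by simpa [ha, hb, ht] using e1
    exact ⟨ha, hb, hc, by simpa [ha, hb, hc, ht] using h⟩
  have hLI : LinearIndependent ℂ ![x, y, x * y, t] := by
    rw [Fintype.linearIndependent_iff]
    intro g hg
    have := hli (g 0) (g 1) (g 2) (g 3) (by simpa [Fin.sum_univ_four] using hg)
    intro i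
    fin_cases i
    exacts [this.1, this.2.1, this.2.2.1, this.2.2.2]
  -- The four independent vectors exhaust N, so x² can be expanded in them. Multiplying by x and
  -- using x·x² = 0 eliminates all but the t-coefficient, against `hev`.
  obtain ⟨c, hc⟩ := exists_coeff_of_linearIndependent hN.finrank_eq hLI
    (by intro i; fin_cases i; exacts [hx, hy, hxy, htN]) (hN.mul_mem x hx x hx)
  simp only [Fin.sum_univ_four, Matrix.cons_val] at hc
  have e1 := congrArg (fun z => x * z) hc
  simp only [mul_add, mul_smul_comm, h1, h2, hN.cube x hx] at e1
  have e2 := hli (c 0 * c 0) (c 0 * c 1) (c 0 * c 2 + c 1) (c 0 * c 3 - c 2 / 2)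
    (by rw [hc] at e1; linear_combination (norm := module) (-1 : ℂ) • e1)
  have c0 : c 0 = 0 := by simpa using e2.1
  have c1 : c 1 = 0 := by simpa [c0] using e2.2.2.1
  have c2 : c 2 = 0 := by simpa [c0] using e2.2.2.2
  exact hev (c 3) (by rw [hc, c0, c1, c2]; module)

/-- Polarization of `IsNilHyperplane.sq_mul_eq_zero` in the squared argument. -/
theorem IsNilHyperplane.mul_mul_eq_zero (hN : IsNilHyperplane N) {x y z : J} (hx : x ∈ N) (hy : y ∈ N) (hz : z ∈ N) :
    (x * y) * z = 0 := by
  have h := hN.sq_mul_eq_zero (N.add_mem hx hy) hz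
  simp only [mul_add, add_mul, hN.sq_mul_eq_zero hx hz, hN.sq_mul_eq_zero hy hz, mul_comm y x] at h
  have h2 : (2 : ℂ) • ((x * y) * z) = 0 := by linear_combination (norm := module) h
  exact (smul_eq_zero.1 h2).resolve_left two_ne_zero

end NilCase

/-! ### Classification of the local algebras -/

section NilClassification

variable {J : Type*} [NonAssocCommRing J] [Module ℂ J] [IsScalarTower ℂ J J]
  [SMulCommClass ℂ J J] [IsCommJordan J] {N : Submodule ℂ J}

/-- If the products of elements of `N` lie on a line, then `J` is one of three algebras. -/
theorem IsNilHyperplane.exists_of_line (hN : IsNilHyperplane N) (hJ : finrank ℂ J = 5) {t : J}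
    (ht0 : t ≠ 0) (ht : ∀ x ∈ N, ∀ y ∈ N, ∃ c : ℂ, x * y = c • t) {p q : J} (hp : p ∈ N)
    (hq : q ∈ N) (hpq : p * q ≠ 0) : ∃ k, Isomorphic J (J5 k) := by
  have : FiniteDimensional ℂ J := .of_finrank_pos (by omega)
  have htN : t ∈ N := by
    obtain ⟨c, hc⟩ := ht p hp q hq
    have hc0 : c ≠ 0 := fun h => hpq (by rw [hc, h, zero_smul])
    rw [← inv_smul_smul₀ hc0 t, ← hc]
    exact N.smul_mem _ (hN.mul_mem p hp q hq)
  have htz : ∀ z ∈ N, t * z = 0 := by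
    intro z hz
    obtain ⟨c, hc⟩ := ht p hp q hq
    have hc0 : c ≠ 0 := fun h => hpq (by rw [hc, h, zero_smul])
    rw [← inv_smul_smul₀ hc0 t, ← hc, smul_mul_assoc, hN.mul_mul_eq_zero hp hq hz, smul_zero]
  obtain ⟨f, hf⟩ : ∃ f : J →ₗ[ℂ] ℂ, f t = 1 := by
    obtain ⟨f, hf⟩ := Module.Projective.exists_dual_ne_zero ℂ ht0
    exact ⟨(f t)⁻¹ • f, by simp [hf]⟩
  have hmul : ∀ x ∈ N, ∀ y ∈ N, x * y = f (x * y) • t := by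
    intro x hx y hy
    obtain ⟨c, hc⟩ := ht x hx y hy
    rw [hc, map_smul, hf, smul_eq_mul, mul_one]
  -- W complements the line of t in N, and the product on W is a symmetric bilinear form times t.
  -- Its rank is the only invariant and selects among indices 2, 3 and 4.
  let W := N ⊓ LinearMap.ker f
  have hdec : ∀ x ∈ N, x - f x • t ∈ W := fun x hx =>
    ⟨N.sub_mem hx (N.smul_mem _ htN), by simp [hf]⟩
  have hW : finrank ℂ W = 3 := by
    let g : N →ₗ[ℂ] ℂ := f.domRestrict N
    have h := g.finrank_range_add_finrank_ker
    have hsurj : LinearMap.range g = ⊤ :=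
      LinearMap.range_eq_top.2 (LinearMap.surjective fun h => by
        have := LinearMap.congr_fun h ⟨t, htN⟩
        simp [g, hf] at this)
    rw [hsurj, finrank_top, finrank_self, hN.finrank_eq] at h
    have e : finrank ℂ (LinearMap.ker g) = finrank ℂ W := by
      have h1 : (LinearMap.ker g).map N.subtype = W := by
        ext x
        simp [g, W, LinearMap.mem_ker, and_comm]
      rw [← h1]
      exact ((LinearMap.ker g).equivMapOfInjective _ N.subtype_injective).finrank_eq
    omega
  obtain ⟨r, hr, b, hb⟩ := exists_basis_sum_squares
    (((LinearMap.mul ℂ J).compr₂ f).domRestrict₁₂ W W)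
    (fun x y => congrArg f (mul_comm (x : J) y)) hW
  have hbN : ∀ i, (b i : J) ∈ N := fun i => (b i).2.1
  have hbb : ∀ i j, (b i : J) * b j = if i = j ∧ i.val < r then t else 0 := by
    intro i j
    have := hb i j
    simp only [LinearMap.domRestrict₁₂_apply, LinearMap.compr₂_apply, LinearMap.mul_apply'] at this
    rw [hmul _ (hbN i) _ (hbN j), this]
    split_ifs <;> simp
  have htb : ∀ i, (b i : J) * t = 0 := fun i => by rw [mul_comm, htz _ (hbN i)]
  have htt : t * t = 0 := htz t htN
  have hdecW : ∀ x ∈ N, ∃ c : Fin 3 → ℂ,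
      x = c 0 • (b 0 : J) + c 1 • (b 1 : J) + c 2 • (b 2 : J) + f x • t := by
    intro x hx
    refine ⟨b.repr ⟨_, hdec x hx⟩, ?_⟩
    have := congrArg (fun z : W => (z : J)) (b.sum_repr ⟨_, hdec x hx⟩)
    simp only [Fin.sum_univ_three, Submodule.coe_add, Submodule.coe_smul] at this
    rw [this]
    module
  have hspan : ⊤ ≤ Submodule.span ℂ (Set.range ![1, (b 0 : J), b 1, b 2, t]) := by
    intro x _
    rw [Submodule.mem_span_range_iff_exists_fun]
    obtain ⟨c, n, hn, rfl⟩ := hN.decomp x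
    obtain ⟨d, hd⟩ := hdecW n hn
    refine ⟨![c, d 0, d 1, d 2, f n], ?_⟩
    simp only [Fin.sum_univ_five, Matrix.cons_val]
    conv_rhs => rw [hd]
    module
  have hr0 : r ≠ 0 := by
    rintro rfl
    apply hpq
    obtain ⟨c, hc⟩ := hdecW p hp
    obtain ⟨d, hd⟩ := hdecW q hq
    have h0 : ∀ i j, (b i : J) * b j = 0 := fun i j => by simp [hbb]
    have hz : ∀ i, t * (b i : J) = 0 := fun i => htz _ (hbN i)
    rw [hc, hd]
    simp [mul_add, add_mul, mul_smul_comm, smul_mul_assoc, h0, hz, htt, htb]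
  have hcases : r = 1 ∨ r = 2 ∨ r = 3 := by omega
  rcases hcases with rfl | rfl | rfl
  · refine ⟨2, isomorphic_of_mul_eq hJ 2 _ hspan fun i j hij => ?_⟩
    change _ = ∑ l, mul3 _ _ _ • _
    fin_cases i <;> fin_cases j <;> simp [Fin.sum_univ_five, mul3, hbb, htb, htt] at hij ⊢
  · refine ⟨3, isomorphic_of_mul_eq hJ 3 _ hspan fun i j hij => ?_⟩
    change _ = ∑ l, mul4 _ _ _ • _
    fin_cases i <;> fin_cases j <;> simp [Fin.sum_univ_five, mul4, hbb, htb, htt] at hij ⊢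
  · refine ⟨4, isomorphic_of_mul_eq hJ 4 _ hspan fun i j hij => ?_⟩
    change _ = ∑ l, mul5 _ _ _ • _
    fin_cases i <;> fin_cases j <;> simp [Fin.sum_univ_five, mul5, hbb, htb, htt] at hij ⊢

/-- The two tables differ only in the square of the second generator, so one list of relations
serves both. -/
theorem isomorphic_of_two_generators (hJ : finrank ℂ J = 5) {k : Fin 16} (hk : k = 0 ∨ k = 1)
    {v₁ v₂ v₃ v₄ : J} (hspan : ⊤ ≤ Submodule.span ℂ (Set.range ![1, v₁, v₂, v₃, v₄]))
    (h11 : v₁ * v₁ = v₃) (h12 : v₁ * v₂ = v₄) (h22 : v₂ * v₂ = if k = 0 then 0 else v₃)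
    (h13 : v₁ * v₃ = 0) (h14 : v₁ * v₄ = 0) (h23 : v₂ * v₃ = 0) (h24 : v₂ * v₄ = 0)
    (h33 : v₃ * v₃ = 0) (h34 : v₃ * v₄ = 0) (h44 : v₄ * v₄ = 0) : Isomorphic J (J5 k) := by
  rcases hk with rfl | rfl
  · refine isomorphic_of_mul_eq hJ 0 _ hspan fun i j hij => ?_
    change _ = ∑ l, mul1 _ _ _ • _
    fin_cases i <;> fin_cases j <;> simp [Fin.sum_univ_five, mul1, *] at hij ⊢
  · refine isomorphic_of_mul_eq hJ 1 _ hspan fun i j hij => ?_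
    change _ = ∑ l, mul2 _ _ _ • _
    fin_cases i <;> fin_cases j <;> simp [Fin.sum_univ_five, mul2, *] at hij ⊢

/-- If two squares of elements of `N` are independent, then `J` is one of two algebras. -/
theorem IsNilHyperplane.exists_of_indep (hN : IsNilHyperplane N) (hJ : finrank ℂ J = 5) {p q : J}
    (hp : p ∈ N) (hq : q ∈ N) (hpq : ∀ a b : ℂ, a • (p * p) + b • (q * q) = 0 → a = 0 ∧ b = 0) :
    ∃ k, Isomorphic J (J5 k) := by
  have : FiniteDimensional ℂ J := .of_finrank_pos (by omega)
  -- No nonzero combination ap + bq is annihilated by both p and q: eliminating pq leaves a²p² =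
  -- b²q².
  have h0 : ∀ a b : ℂ, a • (p * p) + b • (p * q) = 0 → a • (p * q) + b • (q * q) = 0 →
      a = 0 ∧ b = 0 := by
    intro a b h1 h2
    have h3 : (a * a) • (p * p) + (-(b * b)) • (q * q) = 0 := by
      linear_combination (norm := module) a • h1 - b • h2
    have h4 := hpq _ _ h3
    simpa using h4
  have hz : ∀ {x y z : J}, x ∈ N → y ∈ N → z ∈ N → z * (x * y) = 0 := fun hx hy hz => by
    rw [mul_comm, hN.mul_mul_eq_zero hx hy hz]
  have hLI : LinearIndependent ℂ ![p, q, p * p, q * q] := by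
    rw [Fintype.linearIndependent_iff]
    intro g hg
    replace hg : g 0 • p + g 1 • q + g 2 • (p * p) + g 3 • (q * q) = 0 := by
      simpa [Fin.sum_univ_four] using hg
    have h1 := congrArg (fun z => p * z) hg
    have h2 := congrArg (fun z => q * z) hg
    simp only [mul_add, mul_smul_comm, hz hp hp hp, hz hq hq hp, hz hp hp hq, hz hq hq hq,
      smul_zero, add_zero, mul_zero, mul_comm q p] at h1 h2
    have h3 := h0 _ _ h1 h2
    have h4 := hpq (g 2) (g 3) (by simpa [h3] using hg)
    intro i
    fin_cases i
    exacts [h3.1, h3.2, h4.1, h4.2]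
  have hcoef : ∀ x ∈ N, ∃ c : Fin 4 → ℂ,
      x = c 0 • p + c 1 • q + c 2 • (p * p) + c 3 • (q * q) := by
    intro x hx
    obtain ⟨c, hc⟩ := exists_coeff_of_linearIndependent hN.finrank_eq hLI
      (by
        intro i
        fin_cases i
        exacts [hp, hq, hN.mul_mem p hp p hp, hN.mul_mem q hq q hq]) hx
    exact ⟨c, by simpa [Fin.sum_univ_four] using hc⟩
  obtain ⟨γ, δ, hγδ⟩ : ∃ γ δ : ℂ, p * q = γ • (p * p) + δ • (q * q) := by
    obtain ⟨c, hc⟩ := hcoef _ (hN.mul_mem p hp q hq)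
    have h1 := congrArg (fun z => p * z) hc
    have h2 := congrArg (fun z => q * z) hc
    simp only [mul_add, mul_smul_comm, hz hp hp hp, hz hq hq hp, hz hp hp hq, hz hq hq hq,
      hz hp hq hp, hz hp hq hq, smul_zero, add_zero, mul_comm q p] at h1 h2
    have h3 := h0 _ _ h1.symm h2.symm
    exact ⟨c 2, c 3, by simpa [h3] using hc⟩
  -- The relation γp² - pq + δq² = 0 is a binary quadratic form in p and q. A root s of γs² - s + δ
  -- splits it into the factors ℓ = p - sq and m = γp - (1 - γs)q, so ℓm = 0.
  obtain ⟨s, hs⟩ : ∃ s : ℂ, γ * s ^ 2 - s + δ = 0 := by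
    by_cases hγ : γ = 0
    · exact ⟨δ, by rw [hγ]; ring⟩
    · obtain ⟨d, hd⟩ := IsAlgClosed.exists_pow_nat_eq (1 - 4 * γ * δ) (n := 2) (by norm_num)
      refine ⟨(1 + d) / (2 * γ), ?_⟩
      field_simp
      linear_combination hd
  set ℓ := p - s • q with hℓ
  have hℓN : ℓ ∈ N := N.sub_mem hp (N.smul_mem _ hq)
  -- This is the case of a double root: the factors are proportional and ℓ² = 0.
  by_cases hdisc : 2 * γ * s = 1
  · have hγ : γ ≠ 0 := by rintro rfl; simp at hdisc
    have hℓℓ : ℓ * ℓ = 0 := by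
      have : γ • (ℓ * ℓ) = 0 := by
        rw [hℓ]
        simp only [mul_sub, sub_mul, mul_smul_comm, smul_mul_assoc, mul_comm q p]
        have e1 : γ • (p * p - s • (p * q) - s • (p * q - s • (q * q))) =
            (1 - 2 * γ * s) • (p * q) + (γ * s ^ 2 - δ) • (q * q) := by
          linear_combination (norm := module) (-1 : ℂ) • hγδ
        have e2 : γ * s ^ 2 - δ = 0 := by linear_combination s * hdisc - hs
        rw [e1, hdisc, e2]
        module
      exact (smul_eq_zero.1 this).resolve_left hγ
    refine ⟨0, isomorphic_of_two_generators hJ (.inl rfl) (v₁ := q) (v₂ := ℓ) ?_ rfl rfl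
      (by simpa using hℓℓ) (hz hq hq hq) (hz hq hℓN hq) (hz hq hq hℓN) (hz hq hℓN hℓN)
      (hz hq hq (hN.mul_mem q hq q hq)) (hz hq hℓN (hN.mul_mem q hq q hq))
      (hz hq hℓN (hN.mul_mem q hq ℓ hℓN))⟩
    intro x _
    rw [Submodule.mem_span_range_iff_exists_fun]
    obtain ⟨c, n, hn, rfl⟩ := hN.decomp x
    obtain ⟨d, hd⟩ := hcoef n hn
    have hpe : p = ℓ + s • q := by rw [hℓ]; module
    have hpp : p * p = (2 * s) • (q * ℓ) + (s * s) • (q * q) := by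
      rw [hpe]
      simp only [mul_add, add_mul, mul_smul_comm, smul_mul_assoc, hℓℓ, mul_comm ℓ q]
      module
    refine ⟨![c, d 0 * s + d 1, d 0, d 2 * (s * s) + d 3, d 2 * (2 * s)], ?_⟩
    simp only [Fin.sum_univ_five, Matrix.cons_val]
    conv_rhs => rw [hd, hpp, hpe]
    module
  · set m := γ • p - (1 - γ * s) • q with hm
    have hmN : m ∈ N := N.sub_mem (N.smul_mem _ hp) (N.smul_mem _ hq)
    have hℓm : ℓ * m = 0 := by
      rw [hℓ, hm]
      simp only [mul_sub, sub_mul, mul_smul_comm, smul_mul_assoc, mul_comm q p, hγδ]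
      have : δ = s - γ * s ^ 2 := by linear_combination hs
      rw [this]
      module
    have hD : 2 * γ * s - 1 ≠ 0 := sub_ne_zero.2 hdisc
    obtain ⟨d, hd⟩ : ∃ d : ℂ, d * (2 * γ * s - 1) = 1 := ⟨_, inv_mul_cancel₀ hD⟩
    have hqe : q = d • (m - γ • ℓ) := by
      have : m - γ • ℓ = (2 * γ * s - 1) • q := by
        rw [hm, hℓ]
        module
      rw [this, smul_smul, hd, one_smul]
    have hpe : p = ℓ + s • q := by rw [hℓ]; module
    have hqq : q * q = (d * d) • (m * m) + (d * d * γ * γ) • (ℓ * ℓ) := by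
      rw [hqe]
      simp only [mul_sub, sub_mul, mul_smul_comm, smul_mul_assoc, mul_comm m ℓ, hℓm]
      module
    have hpp : p * p = ((1 - s * d * γ) ^ 2) • (ℓ * ℓ) + ((s * d) ^ 2) • (m * m) := by
      rw [hpe, hqe]
      simp only [mul_sub, sub_mul, mul_add, add_mul, mul_smul_comm, smul_mul_assoc, mul_comm m ℓ,
        hℓm]
      module
    have hs1 : ∀ {z : J}, z ∈ N → z * (ℓ * ℓ + m * m) = 0 := fun h => by
      rw [mul_add, hz hℓN hℓN h, hz hmN hmN h, add_zero]
    have hs2 : ∀ {z : J}, z ∈ N → z * (ℓ * ℓ - m * m) = 0 := fun h => by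
      rw [mul_sub, hz hℓN hℓN h, hz hmN hmN h, sub_zero]
    have hadd := N.add_mem hℓN hmN
    have hsub := N.sub_mem hℓN hmN
    have hadd' := N.add_mem (hN.mul_mem ℓ hℓN ℓ hℓN) (hN.mul_mem m hmN m hmN)
    have hsub' := N.sub_mem (hN.mul_mem ℓ hℓN ℓ hℓN) (hN.mul_mem m hmN m hmN)
    -- For independent factors with ℓm = 0, the vectors ℓ ± m have equal squares ℓ² + m² and product
    -- ℓ² - m².
    refine ⟨1, isomorphic_of_two_generators hJ (.inr rfl) (v₁ := ℓ + m) (v₂ := ℓ - m)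
      (v₃ := ℓ * ℓ + m * m) (v₄ := ℓ * ℓ - m * m) ?_ ?_ ?_ ?_ (hs1 hadd) (hs2 hadd) (hs1 hsub)
      (hs2 hsub) (hs1 hadd') (hs2 hadd') (hs2 hsub')⟩
    · intro x _
      rw [Submodule.mem_span_range_iff_exists_fun]
      obtain ⟨c, n, hn, rfl⟩ := hN.decomp x
      obtain ⟨g, hg⟩ := hcoef n hn
      refine ⟨![c,
        (g 0 * (1 - s * d * γ) - g 1 * d * γ + g 0 * s * d + g 1 * d) / 2,
        (g 0 * (1 - s * d * γ) - g 1 * d * γ - g 0 * s * d - g 1 * d) / 2,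
        (g 2 * (1 - s * d * γ) ^ 2 + g 3 * d * d * γ * γ + g 2 * (s * d) ^ 2 + g 3 * d * d) / 2,
        (g 2 * (1 - s * d * γ) ^ 2 + g 3 * d * d * γ * γ - g 2 * (s * d) ^ 2 - g 3 * d * d) / 2],
        ?_⟩
      simp only [Fin.sum_univ_five, Matrix.cons_val]
      conv_rhs => rw [hg, hpp, hqq, hpe, hqe]
      module
    all_goals simp [mul_add, add_mul, mul_sub, sub_mul, mul_comm m ℓ, hℓm]

/-- A Jordan algebra of dimension five and rank three whose idempotents are all trivial. -/
theorem exists_isomorphic_of_trivial_idempotents (hJ : finrank ℂ J = 5) (hr : HasRank J 3)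
    (hidem : ∀ e : J, e * e = e → e = 0 ∨ e = 1) : ∃ k, Isomorphic J (J5 k) := by
  obtain ⟨N, hN⟩ := exists_isNilHyperplane hJ hr hidem
  obtain ⟨p, hp, hpp⟩ : ∃ p ∈ N, p * p ≠ 0 := by
    by_contra! h
    -- If every square in N vanished, c + n would be a root of (t - c)² for all c and n.
    obtain ⟨x, hx⟩ := hr.exists_not_quadratic
    obtain ⟨c, n, hn, rfl⟩ := hN.decomp x
    refine hx (2 * c) (-(c * c)) ?_
    simp only [mul_add, add_mul, mul_smul_comm, smul_mul_assoc, mul_one, one_mul, h n hn]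
    module
  by_cases hq : ∀ q ∈ N, ∃ c : ℂ, q * q = c • (p * p)
  · refine hN.exists_of_line hJ hpp (fun x hx y hy => ?_) hp hp hpp
    obtain ⟨a, ha⟩ := hq x hx
    obtain ⟨b, hb⟩ := hq y hy
    obtain ⟨c, hc⟩ := hq _ (N.add_mem hx hy)
    simp only [mul_add, add_mul, ha, hb, mul_comm y x] at hc
    exact ⟨(c - a - b) / 2, by linear_combination (norm := module) (1 / 2 : ℂ) • hc⟩
  · push Not at hq
    obtain ⟨q, hqN, hq⟩ := hq
    refine hN.exists_of_indep hJ hp hqN fun a b hab => ?_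
    by_cases hb : b = 0
    · subst hb
      exact ⟨by simpa [hpp] using hab, rfl⟩
    · refine absurd ?_ (hq (-(a / b)))
      rw [← inv_smul_smul₀ hb (q * q), show b • (q * q) = (-a) • (p * p) by
        linear_combination (norm := module) hab, smul_smul]
      congr 1
      ring

end NilClassification

/-! ### Three orthogonal idempotents: the joint Peirce decomposition -/

section Triple

variable {J : Type*} [NonAssocCommRing J] [Module ℂ J] [IsScalarTower ℂ J J]
  [SMulCommClass ℂ J J] [IsCommJordan J]

theorem peirce_one_mul_one {e : J} (he : e * e = e) {y w : J} (hy : e * y = y) (hw : e * w = w) :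
    e * (y * w) = y * w := by
  have := peirce_mul he (s := 1) (t := 1) (by norm_num) (by rw [hy, one_smul])
    (by rw [hw, one_smul] : e * w = (1 : ℂ) • w)
  rwa [one_smul] at this

theorem peirce_zero_mul_zero {e : J} (he : e * e = e) {y w : J} (hy : e * y = 0) (hw : e * w = 0) :
    e * (y * w) = 0 := by
  have := peirce_mul he (s := 0) (t := 0) (by norm_num) (by rw [hy, zero_smul])
    (by rw [hw, zero_smul] : e * w = (0 : ℂ) • w)
  rwa [zero_smul] at this

/-- The product would be an eigenvector of multiplication by e for both 0 and 1. -/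
theorem peirce_one_mul_zero {e : J} (he : e * e = e) {y w : J} (hy : e * y = y) (hw : e * w = 0) :
    y * w = 0 := by
  have h1 := peirce_mul he (s := 1) (t := 0) (by norm_num) (by rw [hy, one_smul])
    (by rw [hw, zero_smul] : e * w = (0 : ℂ) • w)
  have h2 := peirce_mul he (s := 0) (t := 1) (by norm_num) (by rw [hw, zero_smul])
    (by rw [hy, one_smul] : e * y = (1 : ℂ) • y)
  rw [mul_comm w y, h1, zero_smul, one_smul] at h2
  exact h2.symm

/-- In rank three, the elements of the Peirce space of a proper idempotent satisfy quadratic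
equations. -/
theorem HasRank.exists_quadratic (hr : HasRank J 3) {e : J} (he : e * e = e) (he1 : e ≠ 1) {y : J}
    (hy : e * y = y) : ∃ a b : ℂ, y * y = a • y + b • e := by
  by_contra! hc
  have hli : ∀ α β γ : ℂ, α • (y * y) + β • y + γ • e = 0 → α = 0 ∧ β = 0 ∧ γ = 0 := by
    intro α β γ h
    have hα : α = 0 := by
      by_contra hα
      apply hc (-(β / α)) (-(γ / α))
      rw [← inv_smul_smul₀ hα (y * y), show α • (y * y) = (-β) • y + (-γ) • e by
        linear_combination (norm := module) h, smul_add, smul_smul, smul_smul]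
      congr 2 <;> ring
    have hβ : β = 0 := by
      by_contra hβ
      have hye : y = (-(γ / β)) • e := by
        rw [hα] at h
        rw [← inv_smul_smul₀ hβ y, show β • y = (-γ) • e by
          linear_combination (norm := module) h, smul_smul]
        congr 1
        ring
      apply hc (-(γ / β)) 0
      have : y * y = (-(γ / β)) • y := by
        nth_rewrite 1 [hye]
        rw [smul_mul_assoc, hy]
      rw [this]
      module
    refine ⟨hα, hβ, ?_⟩
    by_contra hγ
    have : e = 0 := by simpa [hα, hβ, hγ] using h
    apply hc 0 0
    rw [← hy, this]
    simp
  set f := 1 - e with hf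
  have hf0 : f ≠ 0 := sub_ne_zero.2 (Ne.symm he1)
  have hff : f * f = f := by simp [hf, mul_sub, sub_mul, he]
  have hfe : f * e = 0 := by simp [hf, sub_mul, he]
  have hef : e * f = 0 := by rw [mul_comm, hfe]
  have hyf : ∀ w, e * w = w → w * f = 0 := fun w hw => peirce_one_mul_zero he hw hef
  have hyy := peirce_one_mul_one he hy hy
  have hyyy := peirce_one_mul_one he hy hyy
  -- The cubic of y + μ(1 - e) annihilates y in the Peirce space and has μ as a root. Since y², y
  -- and e are independent by `hli`, its coefficients do not depend on μ, so one monic cubic would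
  -- have every number as a root.
  have key : ∀ μ : ℂ, ∃ A B C : ℂ, y * (y * y) = A • (y * y) + B • y + C • e ∧
      μ ^ 3 = A * μ ^ 2 + B * μ + C := by
    intro μ
    obtain ⟨A, B, C, h⟩ := hr.exists_cubic (y + μ • f)
    have hsq : (y + μ • f) * (y + μ • f) = y * y + (μ ^ 2) • f := by
      simp only [mul_add, add_mul, mul_smul_comm, smul_mul_assoc, hff, hyf y hy, mul_comm f y]
      module
    have hcu : (y + μ • f) * (y * y + (μ ^ 2) • f) = y * (y * y) + (μ ^ 3) • f := by
      simp only [mul_add, add_mul, mul_smul_comm, smul_mul_assoc, hff, hyf y hy, hyf _ hyy,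
        mul_comm f (y * y)]
      module
    rw [hsq, hcu, show (1 : J) = e + f by rw [hf]; abel] at h
    refine ⟨A, B, C, ?_, ?_⟩
    · have h1 := congrArg (fun z => e * z) h
      simp only [mul_add, mul_smul_comm, hy, hyy, hyyy, hef, he] at h1
      linear_combination (norm := module) h1
    · have h1 := congrArg (fun z => z * f) h
      simp only [add_mul, smul_mul_assoc, hyf _ hy, hyf _ hyy, hyf _ hyyy, hff, hef] at h1
      have h2 : (μ ^ 3 - (A * μ ^ 2 + B * μ + C)) • f = 0 := by
        linear_combination (norm := module) h1
      exact sub_eq_zero.1 ((smul_eq_zero.1 h2).resolve_right hf0)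
  obtain ⟨A, B, C, h, h0⟩ := key 0
  have key' : ∀ μ : ℂ, μ ^ 3 = A * μ ^ 2 + B * μ + C := by
    intro μ
    obtain ⟨A', B', C', h', h0'⟩ := key μ
    obtain ⟨e1, e2, e3⟩ := hli (A - A') (B - B') (C - C')
      (by linear_combination (norm := module) h' - h)
    linear_combination h0' - e1 * μ ^ 2 - e2 * μ - e3
  -- The third difference of a monic cubic is 6, whereas here all values are zero.
  have h1 := key' 1
  have h2 := key' (-1)
  have h3 := key' 2
  exact absurd (show (6 : ℂ) = 0 by linear_combination h3 - 3 * h1 - h2 + 3 * h0) (by norm_num)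

/-- Three orthogonal nonzero idempotents with sum one. -/
structure IsTriple (e₁ e₂ e₃ : J) : Prop where
  idem₁ : e₁ * e₁ = e₁
  idem₂ : e₂ * e₂ = e₂
  idem₃ : e₃ * e₃ = e₃
  orth₁₂ : e₁ * e₂ = 0
  orth₁₃ : e₁ * e₃ = 0
  orth₂₃ : e₂ * e₃ = 0
  ne₁ : e₁ ≠ 0
  ne₂ : e₂ ≠ 0
  ne₃ : e₃ ≠ 0
  sum : e₁ + e₂ + e₃ = 1

variable {e₁ e₂ e₃ : J}

theorem IsTriple.swap (h : IsTriple e₁ e₂ e₃) : IsTriple e₂ e₁ e₃ :=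
  ⟨h.idem₂, h.idem₁, h.idem₃, by rw [mul_comm, h.orth₁₂], h.orth₂₃, h.orth₁₃, h.ne₂, h.ne₁, h.ne₃,
    by rw [← h.sum]; abel⟩

theorem IsTriple.rotate (h : IsTriple e₁ e₂ e₃) : IsTriple e₂ e₃ e₁ :=
  ⟨h.idem₂, h.idem₃, h.idem₁, h.orth₂₃, by rw [mul_comm, h.orth₁₂], by rw [mul_comm, h.orth₁₃],
    h.ne₂, h.ne₃, h.ne₁, by rw [← h.sum]; abel⟩

theorem exists_roots_quadratic (a b : ℂ) : ∃ r s : ℂ, a = r + s ∧ b = -(r * s) := by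
  obtain ⟨d, hd⟩ := IsAlgClosed.exists_pow_nat_eq (a ^ 2 + 4 * b) (n := 2) (by norm_num)
  exact ⟨(a + d) / 2, (a - d) / 2, by ring, by linear_combination (-1 / 4) * hd⟩

/-- In rank three the diagonal Peirce spaces of a triple are one-dimensional. -/
theorem IsTriple.exists_smul (h : IsTriple e₁ e₂ e₃) (hr : HasRank J 3) {y : J} (hy : e₁ * y = y) :
    ∃ c : ℂ, y = c • e₁ := by
  by_contra! hc
  have hli : ∀ α β : ℂ, α • y + β • e₁ = 0 → α = 0 ∧ β = 0 := by
    intro α β hαβ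
    have hα : α = 0 := by
      by_contra hα
      apply hc (-(β / α))
      rw [← inv_smul_smul₀ hα y, show α • y = (-β) • e₁ by
          linear_combination (norm := module) hαβ, smul_smul]
      congr 1
      ring
    exact ⟨hα, by simpa [hα, h.ne₁] using hαβ⟩
  have he1 : e₁ ≠ 1 := fun h1 => h.ne₂ (by rw [← one_mul e₂, ← h1, h.orth₁₂])
  obtain ⟨a, b, hab⟩ := hr.exists_quadratic h.idem₁ he1 hy
  obtain ⟨r, s, rfl, rfl⟩ := exists_roots_quadratic a b
  have h2 : y * e₂ = 0 := peirce_one_mul_zero h.idem₁ hy h.orth₁₂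
  have h3 : y * e₃ = 0 := peirce_one_mul_zero h.idem₁ hy h.orth₁₃
  -- If y is not a multiple of e₁, its quadratic with roots r, s divides the cubic of y + μe₂ + νe₃.
  -- With μ and ν distinct and different from r and s, that cubic would need two further roots.
  obtain ⟨μ, hμ⟩ := Infinite.exists_notMem_finset ({r, s} : Finset ℂ)
  obtain ⟨ν, hν⟩ := Infinite.exists_notMem_finset ({r, s, μ} : Finset ℂ)
  simp only [Finset.mem_insert, Finset.mem_singleton, not_or] at hμ hν
  obtain ⟨A, B, C, hcu⟩ := hr.exists_cubic (y + μ • e₂ + ν • e₃)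
  have h2' := h2
  have h3' := h3
  rw [mul_comm] at h2' h3'
  have h12 := h.orth₁₂
  have h13 := h.orth₁₃
  have h23 := h.orth₂₃
  have h21 := h.swap.orth₁₂
  have h32 : e₃ * e₂ = 0 := by rw [mul_comm, h23]
  have h31 : e₃ * e₁ = 0 := by rw [mul_comm, h13]
  have hy' : y * e₁ = y := by rw [mul_comm, hy]
  rw [← h.sum] at hcu
  simp only [mul_add, add_mul, mul_smul_comm, smul_mul_assoc, h.idem₂, h.idem₃, h2, h3, h2', h3',
    h23, h32, h21, h31, hab, hy', smul_zero, add_zero, zero_add] at hcu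
  have e1 := congrArg (fun z => e₁ * z) hcu
  have e2 := congrArg (fun z => e₂ * z) hcu
  have e3 := congrArg (fun z => e₃ * z) hcu
  simp only [mul_add, mul_smul_comm, h.idem₁, h.idem₂, h.idem₃, h2', h3',
    h23, h32, h12, h13, h21, h31, hy, smul_zero, add_zero, zero_add] at e1 e2 e3
  obtain ⟨f1, f2⟩ := hli ((r + s) ^ 2 - r * s - A * (r + s) - B)
    (-(r * s) * (r + s) + A * (r * s) - C)
    (by linear_combination (norm := module) e1)
  have f3 : (μ ^ 3 - A * μ ^ 2 - B * μ - C) • e₂ = 0 := by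
    linear_combination (norm := module) e2
  have f4 : (ν ^ 3 - A * ν ^ 2 - B * ν - C) • e₃ = 0 := by
    linear_combination (norm := module) e3
  have f3 := (smul_eq_zero.1 f3).resolve_right h.ne₂
  have f4 := (smul_eq_zero.1 f4).resolve_right h.ne₃
  have g3 : (μ - r) * (μ - s) * (μ - (A - r - s)) = 0 := by
    linear_combination f3 - f1 * μ - f2
  have g4 : (ν - r) * (ν - s) * (ν - (A - r - s)) = 0 := by
    linear_combination f4 - f1 * ν - f2
  have k3 := (mul_eq_zero.1 g3).resolve_left
    (mul_ne_zero (sub_ne_zero.2 hμ.1) (sub_ne_zero.2 hμ.2))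
  have k4 := (mul_eq_zero.1 g4).resolve_left
    (mul_ne_zero (sub_ne_zero.2 hν.1) (sub_ne_zero.2 hν.2.1))
  exact hν.2.2 (by linear_combination k4 - k3)

/-- The off-diagonal Peirce space of two orthogonal idempotents. -/
def peirceSpace (e f : J) : Submodule ℂ J where
  carrier := {z | e * z = (1 / 2 : ℂ) • z ∧ f * z = (1 / 2 : ℂ) • z}
  add_mem' := fun ⟨h1, h2⟩ ⟨h3, h4⟩ => ⟨by rw [mul_add, h1, h3, smul_add],
    by rw [mul_add, h2, h4, smul_add]⟩
  zero_mem' := by simp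
  smul_mem' c _ := fun ⟨h1, h2⟩ => ⟨by rw [mul_smul_comm, h1, smul_comm],
    by rw [mul_smul_comm, h2, smul_comm]⟩

theorem peirceSpace_comm (e f : J) : peirceSpace e f = peirceSpace f e :=
  Submodule.ext fun _ => and_comm

theorem IsTriple.mul_eq_zero (h : IsTriple e₁ e₂ e₃) {z : J} (hz : z ∈ peirceSpace e₁ e₂) :
    e₃ * z = 0 := by
  have := one_mul z
  rw [← h.sum, add_mul, add_mul, hz.1, hz.2] at this
  linear_combination (norm := module) this

/-- Orthogonal idempotents act by commuting operators, which allows a Peirce decomposition for both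
at once. -/
theorem IsTriple.mul_left_comm (h : IsTriple e₁ e₂ e₃) (z : J) :
    e₁ * (e₂ * z) = e₂ * (e₁ * z) := by
  have := jordan_lin e₁ e₁ e₂ z
  rw [h.idem₁, h.orth₁₂, mul_comm e₂ e₁, h.orth₁₂] at this
  simpa using this

/-- Each Peirce component of e₁ is split again by e₂, and e₃ = 1 - e₁ - e₂ then acts by the
complementary eigenvalue. The diagonal pieces are scalar multiples of the idempotents by
`IsTriple.exists_smul`, which also kills the piece with eigenvalues 1/2 and 1. -/
theorem IsTriple.decomp (h : IsTriple e₁ e₂ e₃) (hr : HasRank J 3) (x : J) : ∃ α β γ : ℂ,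
    ∃ a ∈ peirceSpace e₁ e₂, ∃ b ∈ peirceSpace e₁ e₃, ∃ c ∈ peirceSpace e₂ e₃,
      x = α • e₁ + β • e₂ + γ • e₃ + a + b + c := by
  have hthird : ∀ {s t : ℂ} {z : J}, e₁ * z = s • z → e₂ * z = t • z →
      e₃ * z = (1 - s - t) • z := by
    intro s t z h1 h2
    have := one_mul z
    rw [← h.sum, add_mul, add_mul, h1, h2] at this
    linear_combination (norm := module) this
  have hsplit : ∀ {s : ℂ} {z : J}, e₁ * z = s • z → ∃ a m c : J, z = a + m + c ∧
      (e₂ * a = a ∧ e₁ * a = s • a) ∧ (e₂ * m = (1 / 2 : ℂ) • m ∧ e₁ * m = s • m) ∧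
      (e₂ * c = 0 ∧ e₁ * c = s • c) := by
    intro s z hz
    have h3 := peirce_cubic h.idem₂ z
    have k1 : e₁ * (e₂ * z) = s • (e₂ * z) := by rw [h.mul_left_comm, hz, mul_smul_comm]
    have k2 : e₁ * (e₂ * (e₂ * z)) = s • (e₂ * (e₂ * z)) := by
      rw [h.mul_left_comm, k1, mul_smul_comm]
    refine ⟨(2 : ℂ) • (e₂ * (e₂ * z)) - e₂ * z, (4 : ℂ) • (e₂ * z) - (4 : ℂ) • (e₂ * (e₂ * z)),
      z - (3 : ℂ) • (e₂ * z) + (2 : ℂ) • (e₂ * (e₂ * z)), by module, ⟨?_, ?_⟩, ⟨?_, ?_⟩, ?_, ?_⟩ <;>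
      simp only [mul_sub, mul_add, mul_smul_comm, hz, k1, k2]
    · linear_combination (norm := module) h3
    · module
    · linear_combination (norm := module) (-2 : ℂ) • h3
    · module
    · linear_combination (norm := module) h3
    · module
  obtain ⟨x1, m, x0, rfl, h1, hm, h0⟩ := peirce_decomp h.idem₁ x
  obtain ⟨α, rfl⟩ := h.exists_smul hr h1
  obtain ⟨m1, a, b, rfl, ⟨i1, i2⟩, ⟨i3, i4⟩, i5, i6⟩ := hsplit hm
  obtain ⟨x01, c, x00, rfl, ⟨j1, j2⟩, ⟨j3, j4⟩, j5, j6⟩ := hsplit (s := 0) (by rw [h0, zero_smul])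
  obtain ⟨β, rfl⟩ := h.swap.exists_smul hr j1
  obtain ⟨γ, rfl⟩ := h.rotate.rotate.exists_smul hr
    (by simpa using hthird (t := 0) j6 (by rw [j5, zero_smul]))
  have hm1 : m1 = 0 := by
    obtain ⟨c, rfl⟩ := h.swap.exists_smul hr i1
    rw [mul_smul_comm, h.orth₁₂, smul_zero] at i2
    simpa using i2.symm
  have hb := hthird (t := 0) i6 (by rw [i5, zero_smul])
  have hc := hthird j4 j3
  refine ⟨α, β, γ, a, ⟨i4, i3⟩, b, ⟨i6, ?_⟩, c, ⟨j3, ?_⟩, ?_⟩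
  · rw [hb]
    norm_num
  · rw [hc]
    norm_num
  · rw [hm1]
    abel

/-- Multiplying by e₁, and then by e₂ or e₃, isolates the components. Only half of the conclusions
are stated; the others follow by rotating the triple. -/
theorem IsTriple.eq_zero (h : IsTriple e₁ e₂ e₃) {α β γ : ℂ} {a b c : J}
    (ha : a ∈ peirceSpace e₁ e₂) (hb : b ∈ peirceSpace e₁ e₃) (hc : c ∈ peirceSpace e₂ e₃)
    (hx : α • e₁ + β • e₂ + γ • e₃ + a + b + c = 0) : α = 0 ∧ a = 0 ∧ b = 0 := by
  have hc1 : e₁ * c = 0 := h.rotate.mul_eq_zero hc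
  have hb2 : e₂ * b = 0 := by
    rw [peirceSpace_comm] at hb
    exact h.rotate.rotate.mul_eq_zero hb
  have ha3 : e₃ * a = 0 := h.mul_eq_zero ha
  have h1 := congrArg (fun z => e₁ * z) hx
  simp only [mul_add, mul_smul_comm, h.idem₁, h.orth₁₂, h.orth₁₃, ha.1, hb.1, hc1, mul_zero] at h1
  have h2 := congrArg (fun z => e₂ * z) h1
  have h3 := congrArg (fun z => e₃ * z) h1
  simp only [mul_add, mul_smul_comm, h.swap.orth₁₂, h.rotate.rotate.orth₁₂, ha.2, hb.2, ha3, hb2,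
    mul_zero] at h2 h3
  have ha0 : a = 0 := by simpa using h2
  have hb0 : b = 0 := by simpa using h3
  refine ⟨?_, ha0, hb0⟩
  simpa [ha0, hb0, h.ne₁] using h1

theorem IsTriple.finrank_add_finrank (h : IsTriple e₁ e₂ e₃) (hr : HasRank J 3) (hJ : finrank ℂ J = 5) :
    finrank ℂ (peirceSpace e₁ e₂) + finrank ℂ (peirceSpace e₁ e₃) +
      finrank ℂ (peirceSpace e₂ e₃) = 2 := by
  have : FiniteDimensional ℂ J := .of_finrank_pos (by omega)
  let F : (ℂ × ℂ × ℂ) × (peirceSpace e₁ e₂ × peirceSpace e₁ e₃ × peirceSpace e₂ e₃) →ₗ[ℂ] J :=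
    { toFun := fun p => p.1.1 • e₁ + p.1.2.1 • e₂ + p.1.2.2 • e₃ + p.2.1 + p.2.2.1 + p.2.2.2
      map_add' := fun p q => by
        simp only [Prod.fst_add, Prod.snd_add, Submodule.coe_add]
        module
      map_smul' := fun t p => by
        simp only [Prod.smul_fst, Prod.smul_snd, Submodule.coe_smul, smul_eq_mul, RingHom.id_apply]
        module }
  have hF : Function.Bijective F := by
    constructor
    · rw [← LinearMap.ker_eq_bot, LinearMap.ker_eq_bot']
      rintro ⟨⟨α, β, γ⟩, a, b, c⟩ hx
      replace hx : α • e₁ + β • e₂ + γ • e₃ + (a : J) + b + c = 0 := hx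
      obtain ⟨h1, h2, h3⟩ := h.eq_zero a.2 b.2 c.2 hx
      obtain ⟨h4, h5, -⟩ := h.rotate.eq_zero c.2 (by rw [peirceSpace_comm]; exact a.2)
        (by rw [peirceSpace_comm]; exact b.2) (show β • e₂ + γ • e₃ + α • e₁ + (c : J) + a + b = 0 by
          rw [← hx]; abel)
      obtain ⟨h6, -, -⟩ := h.rotate.rotate.eq_zero (by rw [peirceSpace_comm]; exact b.2)
        (by rw [peirceSpace_comm]; exact c.2) a.2
        (show γ • e₃ + α • e₁ + β • e₂ + (b : J) + c + a = 0 by rw [← hx]; abel)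
      simp_all
    · intro x
      obtain ⟨α, β, γ, a, ha, b, hb, c, hc, rfl⟩ := h.decomp hr x
      exact ⟨⟨⟨α, β, γ⟩, ⟨a, ha⟩, ⟨b, hb⟩, ⟨c, hc⟩⟩, rfl⟩
  have := (LinearEquiv.ofBijective F hF).finrank_eq
  simp only [Module.finrank_prod, finrank_self, hJ] at this
  omega

end Triple

/-! ### Classification with three orthogonal idempotents -/

section Triple

variable {J : Type*} [NonAssocCommRing J] [Module ℂ J] [IsScalarTower ℂ J J]
  [SMulCommClass ℂ J J] [IsCommJordan J] {e₁ e₂ e₃ : J}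

/-- The Peirce rules leave only αe₁ + βe₂, and the commutation of L(z) with L(z²), applied to e₁,
gives (α - β)z = 0. -/
theorem IsTriple.exists_mul_self (h : IsTriple e₁ e₂ e₃) (hr : HasRank J 3) {z : J}
    (hz : z ∈ peirceSpace e₁ e₂) : ∃ c : ℂ, z * z = c • (e₁ + e₂) := by
  obtain ⟨α, β, γ, a, ha, b, hb, c, hc, hx⟩ := h.decomp hr (z * z)
  have h3 := peirce_zero_mul_zero h.idem₃ (h.mul_eq_zero hz) (h.mul_eq_zero hz)
  have h1 := peirce_half_mul_half h.idem₁ hz.1 hz.1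
  have hc1 : e₁ * c = 0 := h.rotate.mul_eq_zero hc
  have ha3 : e₃ * a = 0 := h.mul_eq_zero ha
  have h31 : e₃ * e₁ = 0 := h.rotate.rotate.orth₁₂
  have h32 : e₃ * e₂ = 0 := h.rotate.swap.orth₁₂
  rw [hx] at h1 h3
  simp only [mul_add, mul_smul_comm, h.idem₁, h.idem₃, h.orth₁₂, h.orth₁₃, ha.1, hb.1, hb.2, hc.2,
    hc1, ha3, h31, h32, smul_zero, add_zero, zero_add] at h1 h3
  have hab : a + b = 0 := by linear_combination (norm := module) (-4 : ℂ) • h1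
  have hb0 : b = 0 := by
    have := congrArg (fun z => e₃ * z) hab
    simpa [mul_add, ha3, hb.2] using this
  have ha0 : a = 0 := by simpa [hb0] using hab
  have hc0 : c = 0 := by
    have := congrArg (fun z => e₂ * z) h3
    simpa [mul_add, mul_smul_comm, h.orth₂₃, hc.1, hb0] using this
  have hγ : γ • e₃ = 0 := by simpa [hb0, hc0] using h3
  rw [ha0, hb0, hc0, hγ] at hx
  have hJ := jordan_sq z e₁
  rw [hx, mul_comm z e₁, hz.1] at hJ
  simp only [add_mul, mul_smul_comm, smul_mul_assoc, h.idem₁, mul_comm e₂ e₁, h.orth₁₂,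
    mul_comm z e₁, hz.1, hz.2, smul_zero, add_zero] at hJ
  have hαβ : (α - β) • z = 0 := by linear_combination (norm := module) (4 : ℂ) • hJ
  rcases smul_eq_zero.1 hαβ with h0 | rfl
  · rw [sub_eq_zero.1 h0] at hx
    exact ⟨β, by rw [hx]; module⟩
  · exact ⟨0, by simp⟩

theorem IsTriple.exists_mul (h : IsTriple e₁ e₂ e₃) (hr : HasRank J 3) {z w : J}
    (hz : z ∈ peirceSpace e₁ e₂) (hw : w ∈ peirceSpace e₁ e₂) : ∃ c : ℂ, z * w = c • (e₁ + e₂) := by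
  obtain ⟨a, ha⟩ := h.exists_mul_self hr hz
  obtain ⟨b, hb⟩ := h.exists_mul_self hr hw
  obtain ⟨c, hc⟩ := h.exists_mul_self hr (add_mem hz hw)
  simp only [mul_add, add_mul, ha, hb, mul_comm w z] at hc
  exact ⟨(c - a - b) / 2, by linear_combination (norm := module) (1 / 2 : ℂ) • hc⟩

/-- The algebra is ℂe₃ times a quadratic-form algebra with unity e₁ + e₂. The vector i(e₁ - e₂) has
square -(e₁ + e₂) and always contributes one to the rank of the form, so rank r on the Peirce space
gives rank r + 1. -/
theorem IsTriple.exists_isomorphic_of_finrank_two (h : IsTriple e₁ e₂ e₃) (hr : HasRank J 3)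
    (hJ : finrank ℂ J = 5) (h12 : finrank ℂ (peirceSpace e₁ e₂) = 2)
    (h13 : finrank ℂ (peirceSpace e₁ e₃) = 0) (h23 : finrank ℂ (peirceSpace e₂ e₃) = 0) :
    ∃ k, Isomorphic J (J5 k) := by
  have : FiniteDimensional ℂ J := .of_finrank_pos (by omega)
  rw [Submodule.finrank_eq_zero] at h13 h23
  have hs0 : e₁ + e₂ ≠ 0 := fun h0 => h.ne₁ (by
    have := congrArg (fun z => e₁ * z) h0
    simpa [mul_add, h.idem₁, h.orth₁₂] using this)
  obtain ⟨f, hf⟩ : ∃ f : J →ₗ[ℂ] ℂ, f (e₁ + e₂) = -1 := by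
    obtain ⟨f, hf⟩ := Module.Projective.exists_dual_ne_zero ℂ hs0
    exact ⟨-(f (e₁ + e₂))⁻¹ • f, by rw [LinearMap.smul_apply, smul_eq_mul, neg_mul,
      inv_mul_cancel₀ hf]⟩
  have hmul : ∀ x ∈ peirceSpace e₁ e₂, ∀ y ∈ peirceSpace e₁ e₂,
      x * y = (-f (x * y)) • (e₁ + e₂) := by
    intro x hx y hy
    obtain ⟨c, hc⟩ := h.exists_mul hr hx hy
    rw [hc, map_smul, hf, smul_eq_mul, mul_neg, mul_one, neg_neg]
  obtain ⟨r, hr2, b, hb⟩ := exists_basis_sum_squares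
    (((LinearMap.mul ℂ J).compr₂ f).domRestrict₁₂ (peirceSpace e₁ e₂) (peirceSpace e₁ e₂))
    (fun x y => congrArg f (mul_comm (x : J) y)) h12
  have hbb : ∀ i j, (b i : J) * b j = if i = j ∧ i.val < r then -(e₁ + e₂) else 0 := by
    intro i j
    have := hb i j
    simp only [LinearMap.domRestrict₁₂_apply, LinearMap.compr₂_apply, LinearMap.mul_apply'] at this
    rw [hmul _ (b i).2 _ (b j).2, this]
    split_ifs <;> module
  have hspan : ⊤ ≤ Submodule.span ℂ
      (Set.range ![e₃, e₁ + e₂, Complex.I • (e₁ - e₂), (b 0 : J), b 1]) := by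
    intro x _
    rw [Submodule.mem_span_range_iff_exists_fun]
    obtain ⟨α, β, γ, a, ha, c, hc, d, hd, rfl⟩ := h.decomp hr x
    rw [h13, Submodule.mem_bot] at hc
    rw [h23, Submodule.mem_bot] at hd
    have := congrArg (fun z : peirceSpace e₁ e₂ => (z : J)) (b.sum_repr ⟨a, ha⟩)
    simp only [Fin.sum_univ_two, Submodule.coe_add, Submodule.coe_smul] at this
    refine ⟨![γ, (α + β) / 2, -Complex.I * (α - β) / 2, b.repr ⟨a, ha⟩ 0, b.repr ⟨a, ha⟩ 1], ?_⟩
    simp only [Fin.sum_univ_five, Matrix.cons_val]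
    rw [smul_smul, show -Complex.I * (α - β) / 2 * Complex.I = (α - β) / 2 by
      linear_combination (-(α - β) / 2) * Complex.I_mul_I, hc, hd]
    conv_rhs => rw [← this]
    module
  have hb1 : ∀ i, e₁ * (b i : J) = (1 / 2 : ℂ) • (b i : J) := fun i => (b i).2.1
  have hb2 : ∀ i, e₂ * (b i : J) = (1 / 2 : ℂ) • (b i : J) := fun i => (b i).2.2
  have hb3 : ∀ i, e₃ * (b i : J) = 0 := fun i => h.mul_eq_zero (b i).2
  have h31 : e₃ * e₁ = 0 := h.rotate.rotate.orth₁₂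
  have h32 : e₃ * e₂ = 0 := h.rotate.swap.orth₁₂
  have h21 : e₂ * e₁ = 0 := h.swap.orth₁₂
  have t1 : e₃ * (e₁ + e₂) = 0 := by rw [mul_add, h31, h32, add_zero]
  have t2 : e₃ * (e₁ - e₂) = 0 := by rw [mul_sub, h31, h32, sub_zero]
  have t3 : (e₁ + e₂) * (e₁ + e₂) = e₁ + e₂ := by
    simp [mul_add, add_mul, h.idem₁, h.idem₂, h21, h.orth₁₂]
  have t4 : (e₁ + e₂) * (e₁ - e₂) = e₁ - e₂ := by
    simp [mul_sub, add_mul, h.idem₁, h.idem₂, h21, h.orth₁₂]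
  have t5 : (e₁ - e₂) * (e₁ - e₂) = e₁ + e₂ := by
    simp [mul_sub, sub_mul, h.idem₁, h.idem₂, h21, h.orth₁₂]
  have t6 : ∀ i, (e₁ + e₂) * (b i : J) = b i := fun i => by
    rw [add_mul, hb1, hb2]
    module
  have t7 : ∀ i, (e₁ - e₂) * (b i : J) = 0 := fun i => by
    rw [sub_mul, hb1, hb2, sub_self]
  have hcases : r = 0 ∨ r = 1 ∨ r = 2 := by omega
  rcases hcases with rfl | rfl | rfl
  · refine ⟨13, isomorphic_of_mul_eq hJ 13 _ hspan fun i j hij => ?_⟩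
    change _ = ∑ l, mul14 _ _ _ • _
    fin_cases i <;> fin_cases j <;> simp [-smul_add, Fin.sum_univ_five, mul14, hbb, h.idem₃,
      hb3, t1, t2, t3, t4, t5, t6, t7, smul_smul, mul_smul_comm, smul_mul_assoc] at hij ⊢
  · refine ⟨14, isomorphic_of_mul_eq hJ 14 _ hspan fun i j hij => ?_⟩
    change _ = ∑ l, mul15 _ _ _ • _
    fin_cases i <;> fin_cases j <;> simp [-smul_add, Fin.sum_univ_five, mul15, hbb, h.idem₃,
      hb3, t1, t2, t3, t4, t5, t6, t7, smul_smul, mul_smul_comm, smul_mul_assoc] at hij ⊢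
  · refine ⟨15, isomorphic_of_mul_eq hJ 15 _ hspan fun i j hij => ?_⟩
    change _ = ∑ l, mul16 _ _ _ • _
    fin_cases i <;> fin_cases j <;> simp [-smul_add, Fin.sum_univ_five, mul16, hbb, h.idem₃,
      hb3, t1, t2, t3, t4, t5, t6, t7, smul_smul, mul_smul_comm, smul_mul_assoc] at hij ⊢

/-- The product ab lies in the zero Peirce space of e₂ and e₃. The linearized Jordan identity at a,
a, b then gives αb = 0 for a² = α(e₁ + e₂), so a² = 0, and likewise b² = 0. -/
theorem IsTriple.isomorphic_of_finrank_one (h : IsTriple e₁ e₂ e₃) (hr : HasRank J 3)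
    (hJ : finrank ℂ J = 5) (h12 : finrank ℂ (peirceSpace e₁ e₂) = 1)
    (h13 : finrank ℂ (peirceSpace e₁ e₃) = 1) (h23 : finrank ℂ (peirceSpace e₂ e₃) = 0) :
    Isomorphic J (J5 12) := by
  have : FiniteDimensional ℂ J := .of_finrank_pos (by omega)
  rw [Submodule.finrank_eq_zero] at h23
  obtain ⟨⟨a, ha⟩, ha0, ha'⟩ := finrank_eq_one_iff'.1 h12
  obtain ⟨⟨b, hb⟩, hb0, hb'⟩ := finrank_eq_one_iff'.1 h13
  have ha0' : a ≠ 0 := fun h0 => ha0 (Subtype.ext h0)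
  have hb0' : b ≠ 0 := fun h0 => hb0 (Subtype.ext h0)
  have h31 : e₃ * e₁ = 0 := h.rotate.rotate.orth₁₂
  have h32 : e₃ * e₂ = 0 := h.rotate.swap.orth₁₂
  have h21 : e₂ * e₁ = 0 := h.swap.orth₁₂
  have ha3 : e₃ * a = 0 := h.mul_eq_zero ha
  have hb2 : e₂ * b = 0 := by
    rw [peirceSpace_comm] at hb
    exact h.rotate.rotate.mul_eq_zero hb
  have hab : a * b = 0 := by
    have h1 : a * b ∈ peirceSpace e₂ e₃ := by
      constructor
      · rw [mul_comm a b]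
        exact peirce_mul h.idem₂ (s := 0) (by norm_num) (by rw [hb2, zero_smul]) ha.2
      · exact peirce_mul h.idem₃ (s := 0) (by norm_num) (by rw [ha3, zero_smul]) hb.2
    rwa [h23, Submodule.mem_bot] at h1
  obtain ⟨α, hα⟩ := h.exists_mul_self hr ha
  obtain ⟨β, hβ⟩ := h.swap.rotate.exists_mul_self hr hb
  have haa : a * a = 0 := by
    have := jordan_lin a a b e₃
    rw [hab, mul_comm b a, hab, hα, mul_comm b e₃, hb.2] at this
    simp only [smul_mul_assoc, mul_smul_comm, add_mul, h.orth₁₃, h.orth₂₃, hb.1, hb2, zero_mul,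
      mul_zero, smul_zero, add_zero] at this
    have h0 : α • b = 0 := by linear_combination (norm := module) (4 : ℂ) • this
    rw [hα, (smul_eq_zero.1 h0).resolve_right hb0', zero_smul]
  have hbb : b * b = 0 := by
    have := jordan_lin b b a e₂
    rw [mul_comm b a, hab, hβ, mul_comm a e₂, ha.2] at this
    simp only [smul_mul_assoc, mul_smul_comm, add_mul, h.orth₁₂, h32, ha.1, ha3, zero_mul,
      mul_zero, smul_zero, add_zero] at this
    have h0 : β • a = 0 := by linear_combination (norm := module) (4 : ℂ) • this
    rw [hβ, (smul_eq_zero.1 h0).resolve_right ha0', zero_smul]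
  have hspan : ⊤ ≤ Submodule.span ℂ (Set.range ![e₁, e₂, e₃, a, b]) := by
    intro x _
    rw [Submodule.mem_span_range_iff_exists_fun]
    obtain ⟨α, β, γ, a', ha', b', hb', d, hd, rfl⟩ := h.decomp hr x
    rw [h23, Submodule.mem_bot] at hd
    obtain ⟨s, hs⟩ := ‹∀ w : peirceSpace e₁ e₂, _› ⟨a', ha'⟩
    obtain ⟨t, ht⟩ := ‹∀ w : peirceSpace e₁ e₃, _› ⟨b', hb'⟩
    replace hs : s • a = a' := congrArg Subtype.val hs
    replace ht : t • b = b' := congrArg Subtype.val ht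
    refine ⟨![α, β, γ, s, t], ?_⟩
    simp only [Fin.sum_univ_five, Matrix.cons_val]
    rw [hd, ← hs, ← ht, add_zero]
  refine isomorphic_of_mul_eq hJ 12 _ hspan fun i j hij => ?_
  change _ = ∑ l, mul13 _ _ _ • _
  fin_cases i <;> fin_cases j <;> simp [Fin.sum_univ_five, mul13, h.idem₁, h.idem₂, h.idem₃,
    h.orth₁₂, h.orth₁₃, h.orth₂₃, ha.1, ha.2, hb.1, hb.2, hb2, ha3, haa, hbb, hab] at hij ⊢

theorem IsTriple.exists_isomorphic (h : IsTriple e₁ e₂ e₃) (hr : HasRank J 3)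
    (hJ : finrank ℂ J = 5) : ∃ k, Isomorphic J (J5 k) := by
  have hsum := h.finrank_add_finrank hr hJ
  have h21 := peirceSpace_comm e₂ e₁
  have h31 := peirceSpace_comm e₃ e₁
  have h32 := peirceSpace_comm e₃ e₂
  by_cases h12 : finrank ℂ (peirceSpace e₁ e₂) = 2
  · exact h.exists_isomorphic_of_finrank_two hr hJ h12 (by omega) (by omega)
  by_cases h13 : finrank ℂ (peirceSpace e₁ e₃) = 2
  · exact h.rotate.rotate.exists_isomorphic_of_finrank_two hr hJ (by rw [h31]; omega)
      (by rw [h32]; omega) (by omega)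
  by_cases h23 : finrank ℂ (peirceSpace e₂ e₃) = 2
  · exact h.rotate.exists_isomorphic_of_finrank_two hr hJ h23 (by rw [h21]; omega)
      (by rw [h31]; omega)
  by_cases k12 : finrank ℂ (peirceSpace e₁ e₂) = 0
  · exact ⟨12, h.rotate.rotate.isomorphic_of_finrank_one hr hJ (by rw [h31]; omega)
      (by rw [h32]; omega) (by omega)⟩
  by_cases k13 : finrank ℂ (peirceSpace e₁ e₃) = 0
  · exact ⟨12, h.rotate.isomorphic_of_finrank_one hr hJ (by omega) (by rw [h21]; omega)
      (by rw [h31]; omega)⟩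
  · exact ⟨12, h.isomorphic_of_finrank_one hr hJ (by omega) (by omega) (by omega)⟩

end Triple

/-! ### Two complementary idempotents: nil part and half-space -/

section Pair

variable {J : Type*} [NonAssocCommRing J] [Module ℂ J] [IsScalarTower ℂ J J]
  [SMulCommClass ℂ J J] [IsCommJordan J]

/-- Two complementary nonzero idempotents, in an algebra which does not have three of them. -/
structure IsPair (e f : J) : Prop where
  idem₁ : e * e = e
  idem₂ : f * f = f
  orth : e * f = 0
  ne₁ : e ≠ 0
  ne₂ : f ≠ 0
  sum : e + f = 1
  not_isTriple : ∀ e₁ e₂ e₃ : J, ¬ IsTriple e₁ e₂ e₃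

variable {e f : J}

theorem IsPair.symm (h : IsPair e f) : IsPair f e :=
  ⟨h.idem₂, h.idem₁, by rw [mul_comm, h.orth], h.ne₂, h.ne₁, by rw [add_comm, h.sum],
    h.not_isTriple⟩

theorem IsPair.ne_one (h : IsPair e f) : e ≠ 1 := fun h1 => h.ne₂ (by
  rw [← one_mul f, ← h1, h.orth])

theorem IsPair.right_mul_eq_zero (h : IsPair e f) {y : J} (hy : e * y = y) : f * y = 0 := by
  have := one_mul y
  rw [← h.sum, add_mul, hy] at this
  simpa using this

theorem IsPair.right_mul_eq_self (h : IsPair e f) {y : J} (hy : e * y = 0) : f * y = y := by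
  have := one_mul y
  rw [← h.sum, add_mul, hy] at this
  simpa using this

/-- A further idempotent g below e would produce the triple g, e - g, f. -/
theorem IsPair.eq_zero_or_eq (h : IsPair e f) {g : J} (hg : g * g = g) (heg : e * g = g) :
    g = 0 ∨ g = e := by
  by_contra! hc
  have hge : g * e = g := by rw [mul_comm, heg]
  have hgf : g * f = 0 := by rw [mul_comm, h.right_mul_eq_zero heg]
  exact h.not_isTriple g (e - g) f ⟨hg, by simp [mul_sub, sub_mul, h.idem₁, hg, heg, hge], h.idem₂,
    by rw [mul_sub, hge, hg, sub_self], hgf, by rw [sub_mul, h.orth, hgf, sub_zero], hc.1,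
    sub_ne_zero.2 hc.2.symm, h.ne₂, by rw [← h.sum]; abel⟩

/-- The element satisfies a quadratic over e. Distinct roots would give an idempotent below e, hence
0 or e, and y is then a scalar; a double root r makes y - re square to zero. -/
theorem IsPair.exists_smul_add (h : IsPair e f) (hr : HasRank J 3) {y : J} (hy : e * y = y) :
    ∃ (c : ℂ) (n : J), y = c • e + n ∧ e * n = n ∧ n * n = 0 := by
  obtain ⟨a, b, hab⟩ := hr.exists_quadratic h.idem₁ h.ne_one hy
  obtain ⟨r, s, rfl, rfl⟩ := exists_roots_quadratic a b
  have hye : y * e = y := by rw [mul_comm, hy]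
  by_cases hrs : r = s
  · subst hrs
    refine ⟨r, y - r • e, by module, by rw [mul_sub, mul_smul_comm, hy, h.idem₁], ?_⟩
    simp only [mul_sub, sub_mul, mul_smul_comm, smul_mul_assoc, hab, hy, hye, h.idem₁]
    module
  · have hrs' : r - s ≠ 0 := sub_ne_zero.2 hrs
    obtain ⟨t, ht⟩ : ∃ t : ℂ, t * (r - s) = 1 := ⟨_, inv_mul_cancel₀ hrs'⟩
    have hg : y = (r - s) • (t • (y - s • e)) + s • e := by
      rw [smul_smul, mul_comm, ht]
      module
    have hgg : (t • (y - s • e)) * (t • (y - s • e)) = t • (y - s • e) := by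
      have h1 : (y - s • e) * (y - s • e) = (r - s) • (y - s • e) := by
        simp only [mul_sub, sub_mul, mul_smul_comm, smul_mul_assoc, hab, hy, hye, h.idem₁]
        module
      rw [smul_mul_assoc, mul_smul_comm, h1, smul_smul t (r - s), ht, one_smul]
    rcases h.eq_zero_or_eq hgg (by rw [mul_smul_comm, mul_sub, mul_smul_comm, hy, h.idem₁]) with
      h0 | h0 <;> rw [h0] at hg
    · exact ⟨s, 0, by rw [hg]; module, by simp, by simp⟩
    · exact ⟨r, 0, by rw [hg]; module, by simp, by simp⟩

/-- Write y + z and y - z as le and me plus square-zero terms. Adding the two squared relations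
gives (l + m)y + (l - m)z = ((l² + m²)/2)e; multiplying by y and z settles all cases of l and m. -/
theorem IsPair.nil_mul_nil (h : IsPair e f) (hr : HasRank J 3) {y z : J} (hy : e * y = y)
    (hyy : y * y = 0) (hz : e * z = z) (hzz : z * z = 0) : y * z = 0 := by
  obtain ⟨l, n, hn, -, hnn⟩ := h.exists_smul_add hr (y := y + z) (by rw [mul_add, hy, hz])
  obtain ⟨m, n', hn', -, hnn'⟩ := h.exists_smul_add hr (y := y - z) (by rw [mul_sub, hy, hz])
  have hye : y * e = y := by rw [mul_comm, hy]
  have hze : z * e = z := by rw [mul_comm, hz]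
  rw [show n = y + z - l • e by rw [hn]; module] at hnn
  rw [show n' = y - z - m • e by rw [hn']; module] at hnn'
  simp only [mul_add, add_mul, mul_sub, sub_mul, mul_smul_comm, smul_mul_assoc, hyy, hzz, hy, hz,
    hye, hze, h.idem₁, mul_comm z y] at hnn hnn'
  have hsum : (l + m) • y + (l - m) • z = ((l ^ 2 + m ^ 2) / 2) • e := by
    linear_combination (norm := module) (-1 / 2 : ℂ) • hnn + (-1 / 2 : ℂ) • hnn'
  have h1 := congrArg (fun x => y * x) hsum
  have h2 := congrArg (fun x => z * x) hsum
  simp only [mul_add, mul_smul_comm, hyy, hzz, hye, hze, mul_comm z y] at h1 h2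
  by_cases hlm : l = m
  · subst hlm
    by_cases hl : l = 0
    · subst hl
      have : (2 : ℂ) • (y * z) = 0 := by linear_combination (norm := module) hnn
      exact (smul_eq_zero.1 this).resolve_left two_ne_zero
    · have : (l ^ 2) • y = 0 := by linear_combination (norm := module) (-1 : ℂ) • h1
      rw [(smul_eq_zero.1 this).resolve_left (pow_ne_zero 2 hl), zero_mul]
  · have hlm' : l - m ≠ 0 := sub_ne_zero.2 hlm
    by_cases hc : (l ^ 2 + m ^ 2) / 2 = 0
    · rw [hc] at h1
      have : (l - m) • (y * z) = 0 := by linear_combination (norm := module) h1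
      exact (smul_eq_zero.1 this).resolve_left hlm'
    · have h3 := congrArg (fun x => y * x) h1
      have h4 := congrArg (fun x => y * x) h2
      simp only [mul_smul_comm, hyy, smul_zero, zero_add, add_zero] at h3 h4
      have h5 : y * (y * z) = 0 := (smul_eq_zero.1 h3).resolve_left hlm'
      rw [h5, smul_zero] at h4
      exact (smul_eq_zero.1 h4.symm).resolve_left hc

/-- The nilpotent elements of the Peirce space of `e`. -/
def IsPair.nil (h : IsPair e f) (hr : HasRank J 3) : Submodule ℂ J where
  carrier := {y | e * y = y ∧ y * y = 0}
  add_mem' := fun {y z} ⟨h1, h2⟩ ⟨h3, h4⟩ => ⟨by rw [mul_add, h1, h3], by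
    rw [mul_add, add_mul, add_mul, h2, h4, mul_comm z y, h.nil_mul_nil hr h1 h2 h3 h4]
    simp⟩
  zero_mem' := by simp
  smul_mem' c _ := fun ⟨h1, h2⟩ => ⟨by rw [mul_smul_comm, h1], by
    rw [mul_smul_comm, smul_mul_assoc, h2, smul_zero, smul_zero]⟩

theorem IsPair.decomp (h : IsPair e f) (hr : HasRank J 3) (x : J) : ∃ (a b : ℂ),
    ∃ n ∈ h.nil hr, ∃ m ∈ h.symm.nil hr, ∃ z ∈ peirceSpace e f, x = a • e + b • f + n + m + z := by
  obtain ⟨x₁, z, x₀, rfl, h1, hz, h0⟩ := peirce_decomp h.idem₁ x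
  obtain ⟨a, n, rfl, hn, hnn⟩ := h.exists_smul_add hr h1
  obtain ⟨b, m, rfl, hm, hmm⟩ := h.symm.exists_smul_add hr (h.right_mul_eq_self h0)
  refine ⟨a, b, n, ⟨hn, hnn⟩, m, ⟨hm, hmm⟩, z, ⟨hz, ?_⟩, by abel⟩
  have := one_mul z
  rw [← h.sum, add_mul, hz] at this
  linear_combination (norm := module) this

/-- With nonzero n and m in the two nil parts, n + f + m would have minimal polynomial t²(t - 1)²,
of degree four. -/
theorem IsPair.nil_eq_bot (h : IsPair e f) (hr : HasRank J 3) :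
    h.nil hr = ⊥ ∨ h.symm.nil hr = ⊥ := by
  by_contra! hc
  obtain ⟨n, hn, hn0⟩ := Submodule.exists_mem_ne_zero_of_ne_bot hc.1
  obtain ⟨m, hm, hm0⟩ := Submodule.exists_mem_ne_zero_of_ne_bot hc.2
  obtain ⟨A, B, C, hcu⟩ := hr.exists_cubic (n + f + m)
  have hem : e * m = 0 := h.symm.right_mul_eq_zero hm.1
  have hfn : f * n = 0 := h.right_mul_eq_zero hn.1
  have hnm : n * m = 0 := peirce_one_mul_zero h.idem₁ hn.1 hem
  have hmf : m * f = m := by rw [mul_comm]; exact hm.1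
  have hnf : n * f = 0 := by rw [mul_comm, hfn]
  have hne : n * e = n := by rw [mul_comm]; exact hn.1
  have hme : m * e = 0 := by rw [mul_comm, hem]
  rw [← h.sum] at hcu
  simp only [mul_add, add_mul, hn.2, hm.2, hm.1, hnm, mul_comm m n, hnf, hfn, h.idem₂, hmf,
    zero_add, add_zero] at hcu
  have h1 := congrArg (fun x => n * x) hcu
  have h2 := congrArg (fun x => m * x) hcu
  simp only [mul_add, mul_smul_comm, hn.2, hm.2, hnm, mul_comm m n, hnf, hmf, hne, hme,
    smul_zero, zero_add, add_zero] at h1 h2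
  have hC : C = 0 := by simpa [hn0] using h1.symm
  subst hC
  have h3 := congrArg (fun x => e * x) hcu
  simp only [mul_add, mul_smul_comm, hn.1, hem, h.orth, zero_smul, smul_zero, zero_add,
    add_zero] at h3
  have hB : B = 0 := by simpa [hn0] using h3.symm
  subst hB
  have hA : (1 - A) • m = 0 := by linear_combination (norm := module) h2
  have hA1 : A = 1 := (sub_eq_zero.1 ((smul_eq_zero.1 hA).resolve_right hm0)).symm
  subst hA1
  exact hm0 (by linear_combination (norm := module) hcu)

/-- The Peirce rules give z² = ae + bf + n. The Jordan identity at e makes z an eigenvector of n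
with eigenvalue (b - a)/2, while n acts with square zero; hence a = b unless z = 0. -/
theorem IsPair.exists_mul_self (h : IsPair e f) (hr : HasRank J 3) (hf : h.symm.nil hr = ⊥)
    {z : J} (hz : z ∈ peirceSpace e f) : ∃ a : ℂ, ∃ n ∈ h.nil hr, z * z = a • 1 + n := by
  obtain ⟨a, b, n, hn, m, hm, w, hw, hx⟩ := h.decomp hr (z * z)
  rw [hf, Submodule.mem_bot] at hm
  have h1 := peirce_half_mul_half h.idem₁ hz.1 hz.1
  rw [hx, hm] at h1
  simp only [mul_add, mul_smul_comm, h.idem₁, h.orth, hn.1, hw.1, smul_zero, add_zero] at h1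
  have hw0 : w = 0 := by linear_combination (norm := module) (-4 : ℂ) • h1
  rw [hm, hw0, add_zero, add_zero] at hx
  have h2 := jordan_sq z e
  have hen : e * n = n := hn.1
  rw [hx, mul_comm z e, hz.1] at h2
  simp only [mul_add, add_mul, mul_smul_comm, smul_mul_assoc, h.idem₁, mul_comm f e, h.orth,
    mul_comm n e, hen, mul_comm z e, mul_comm z n, hz.1, hz.2, smul_zero, add_zero] at h2
  have h3 : n * z = (-(a - b) / 2) • z := by linear_combination (norm := module) (2 : ℂ) • h2
  have h4 := peirce_one_act h.idem₁ hn.1 hn.1 hz.1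
  rw [hn.2, zero_mul, h3, mul_smul_comm, h3] at h4
  have h5 : ((a - b) ^ 2) • z = 0 := by linear_combination (norm := module) (2 : ℂ) • h4
  rcases smul_eq_zero.1 h5 with h6 | rfl
  · have := sub_eq_zero.1 (pow_eq_zero_iff two_ne_zero |>.1 h6)
    subst this
    exact ⟨a, n, hn, by rw [hx, ← h.sum, smul_add]⟩
  · exact ⟨0, 0, zero_mem _, by simp⟩

theorem IsPair.nil_mul_eq_zero (h : IsPair e f) (hr : HasRank J 3) {z n : J} {a : ℂ}
    (hz : z ∈ peirceSpace e f) (hn : n ∈ h.nil hr) (hx : z * z = a • 1 + n) : n * z = 0 := by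
  have h2 := jordan_sq z e
  have hen : e * n = n := hn.1
  rw [hx, mul_comm z e, hz.1] at h2
  simp only [mul_add, add_mul, mul_smul_comm, smul_mul_assoc, one_mul,
    mul_comm n e, hen, mul_comm z e, mul_comm z n, hz.1] at h2
  linear_combination (norm := module) (2 : ℂ) • h2

/-- If both nil parts vanished, half-space squares would be scalars and every element would satisfy
a quadratic equation, contrary to rank three. -/
theorem IsPair.nil_ne_bot (h : IsPair e f) (hr : HasRank J 3) (hf : h.symm.nil hr = ⊥) :
    h.nil hr ≠ ⊥ := by
  intro he
  obtain ⟨x, hx⟩ := hr.exists_not_quadratic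
  obtain ⟨a, b, n, hn, m, hm, z, hz, rfl⟩ := h.decomp hr x
  obtain ⟨c, k, hk, hzz⟩ := h.exists_mul_self hr hf hz
  rw [he, Submodule.mem_bot] at hn hk
  rw [hf, Submodule.mem_bot] at hm
  refine hx (a + b) (c - a * b) ?_
  rw [hn, hm]
  rw [hk, add_zero] at hzz
  simp only [mul_add, add_mul, mul_smul_comm, smul_mul_assoc, h.idem₁, h.idem₂, mul_comm f e,
    h.orth, mul_comm z e, mul_comm z f, hz.1, hz.2, hzz, add_zero, smul_zero, ← h.sum]
  module

theorem IsPair.mul_mem_peirceSpace (h : IsPair e f) {y z : J} (hy : e * y = y)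
    (hz : z ∈ peirceSpace e f) : y * z ∈ peirceSpace e f :=
  ⟨peirce_mul h.idem₁ (s := 1) (by norm_num) (by rw [hy, one_smul]) hz.1,
    peirce_mul h.idem₂ (s := 0) (by norm_num) (by rw [h.right_mul_eq_zero hy, zero_smul]) hz.2⟩

theorem IsPair.nil_mul_nil_mul (h : IsPair e f) (hr : HasRank J 3) {n z : J} (hn : n ∈ h.nil hr)
    (hz : z ∈ peirceSpace e f) : n * (n * z) = 0 := by
  have h4 := peirce_one_act h.idem₁ hn.1 hn.1 hz.1
  rw [hn.2, zero_mul] at h4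
  linear_combination (norm := module) (1 / 2 : ℂ) • h4

/-- It must be shown that z² = a·1 + n has a = 0. Fix y ≠ 0 in the nil part and w = yz. The
linearized Jordan identity gives zw = (a/2)y, and `IsPair.nil_mul_eq_zero` for z ± w gives nw = -aw.
As n acts with square zero, a²w = 0, and w = 0 would again give ay = 0. -/
theorem IsPair.mul_self_mem (h : IsPair e f) (hr : HasRank J 3) (hf : h.symm.nil hr = ⊥)
    {z : J} (hz : z ∈ peirceSpace e f) : z * z ∈ h.nil hr := by
  obtain ⟨y, hy, hy0⟩ := Submodule.exists_mem_ne_zero_of_ne_bot (h.nil_ne_bot hr hf)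
  obtain ⟨a, n, hn, hzz⟩ := h.exists_mul_self hr hf hz
  suffices ha : a = 0 by rwa [hzz, ha, zero_smul, zero_add]
  set w := y * z with hw
  have hwM : w ∈ peirceSpace e f := h.mul_mem_peirceSpace hy.1 hz
  obtain ⟨b, k, hk, hww⟩ := h.exists_mul_self hr hf hwM
  obtain ⟨c, l, hl, hzw⟩ := h.exists_mul_self hr hf (add_mem hz hwM)
  have hzw' : z * w = ((c - a - b) / 2) • 1 + (1 / 2 : ℂ) • (l - n - k) := by
    simp only [mul_add, add_mul, hzz, hww, mul_comm w z] at hzw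
    linear_combination (norm := module) (1 / 2 : ℂ) • hzw
  have hp : (1 / 2 : ℂ) • (l - n - k) ∈ h.nil hr :=
    Submodule.smul_mem _ _ (sub_mem (sub_mem hl hn) hk)
  generalize (1 / 2 : ℂ) • (l - n - k) = p at hzw' hp
  generalize (c - a - b) / 2 = d at hzw'
  have hey : e * y = y := hy.1
  have h1 := jordan_lin z y e z
  have h2 : y * n = 0 := h.nil_mul_nil hr hy.1 hy.2 hn.1 hn.2
  rw [mul_comm z y, mul_comm y e, hey, hz.1, hzz, ← hw, mul_comm w] at h1
  simp only [smul_mul_assoc, mul_smul_comm, mul_comm w z, hzz, mul_add, mul_one, h2] at h1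
  rw [hzw'] at h1
  have hep : e * p = p := hp.1
  simp only [mul_add, mul_smul_comm, mul_one, hep, add_zero] at h1
  have h3 : d • e = (a / 2) • y - p := by linear_combination (norm := module) (-1 : ℂ) • h1
  -- The right side of `h3` lies in the nil part, so its square vanishes, whereas de has square d²e.
  have h4 : (d ^ 2) • e = 0 := by
    have h5 : (d • e) * (d • e) = 0 := by
      rw [h3]
      exact (sub_mem ((h.nil hr).smul_mem _ hy) hp).2
    rw [← h5, smul_mul_assoc, mul_smul_comm, h.idem₁]
    module
  have hd : d = 0 := by simpa [h.ne₁] using h4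
  subst hd
  have hp' : p = (a / 2) • y := by linear_combination (norm := module) h3
  have t1 := h.nil_mul_eq_zero hr hz hn hzz
  have t2 := h.nil_mul_eq_zero hr hwM hk hww
  have t3 := h.nil_mul_eq_zero hr (a := a + b) (add_mem hz hwM)
    (add_mem (add_mem hn hk) ((h.nil hr).smul_mem 2 hp)) (by
      simp only [mul_add, add_mul, hzz, hww, mul_comm w z, hzw']
      module)
  have t4 := h.nil_mul_eq_zero hr (a := a + b) (sub_mem hz hwM)
    (add_mem (add_mem hn hk) ((h.nil hr).smul_mem (-2) hp)) (by
      simp only [mul_sub, sub_mul, hzz, hww, mul_comm w z, hzw']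
      module)
  simp only [mul_sub, add_mul, mul_add, smul_mul_assoc, t1, t2, hp', ← hw] at t3 t4
  have h6 : n * w = (-a) • w := by
    linear_combination (norm := module) (1 / 2 : ℂ) • t3 - (1 / 2 : ℂ) • t4
  have h7 := h.nil_mul_nil_mul hr hn hwM
  rw [h6, mul_smul_comm, h6, smul_smul] at h7
  rcases smul_eq_zero.1 h7 with h8 | h8
  · simpa using h8
  · rw [h8, mul_zero] at hzw'
    have : p = 0 := by simpa using hzw'.symm
    rw [this] at hp'
    simpa [hy0] using hp'.symm

theorem IsPair.mul_mem (h : IsPair e f) (hr : HasRank J 3) (hf : h.symm.nil hr = ⊥)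
    {z w : J} (hz : z ∈ peirceSpace e f) (hw : w ∈ peirceSpace e f) : z * w ∈ h.nil hr := by
  have h1 := sub_mem (sub_mem (h.mul_self_mem hr hf (add_mem hz hw)) (h.mul_self_mem hr hf hz))
    (h.mul_self_mem hr hf hw)
  convert (h.nil hr).smul_mem (1 / 2 : ℂ) h1 using 1
  simp only [mul_add, add_mul, mul_comm w z]
  module

theorem IsPair.mul_self_mul (h : IsPair e f) (hr : HasRank J 3) (hf : h.symm.nil hr = ⊥)
    {z : J} (hz : z ∈ peirceSpace e f) : (z * z) * z = 0 :=
  h.nil_mul_eq_zero hr (a := 0) hz (h.mul_self_mem hr hf hz) (by simp)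

/-- Polarization of z²z = 0; it supplies the relations among products when the nil part acts
nontrivially. -/
theorem IsPair.mul_self_mul_add (h : IsPair e f) (hr : HasRank J 3) (hf : h.symm.nil hr = ⊥)
    {z w : J} (hz : z ∈ peirceSpace e f) (hw : w ∈ peirceSpace e f) :
    (z * z) * w + (2 : ℂ) • ((z * w) * z) = 0 := by
  have t1 := h.mul_self_mul hr hf hz
  have t2 := h.mul_self_mul hr hf hw
  have t3 := h.mul_self_mul hr hf (add_mem hz hw)
  have t4 := h.mul_self_mul hr hf (sub_mem hz hw)
  simp only [mul_add, add_mul, mul_sub, sub_mul, t1, t2, mul_comm w z] at t3 t4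
  linear_combination (norm := module) (1 / 2 : ℂ) • t3 - (1 / 2 : ℂ) • t4

theorem IsPair.finrank_add_finrank (h : IsPair e f) (hr : HasRank J 3) (hf : h.symm.nil hr = ⊥)
    (hJ : finrank ℂ J = 5) :
    finrank ℂ (h.nil hr) + finrank ℂ (peirceSpace e f) = 3 := by
  have : FiniteDimensional ℂ J := .of_finrank_pos (by omega)
  let F : (ℂ × ℂ) × (h.nil hr × peirceSpace e f) →ₗ[ℂ] J :=
    { toFun := fun p => p.1.1 • e + p.1.2 • f + p.2.1 + p.2.2
      map_add' := fun p q => by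
        simp only [Prod.fst_add, Prod.snd_add, Submodule.coe_add]
        module
      map_smul' := fun t p => by
        simp only [Prod.smul_fst, Prod.smul_snd, Submodule.coe_smul, smul_eq_mul, RingHom.id_apply]
        module }
  have hF : Function.Bijective F := by
    constructor
    · rw [← LinearMap.ker_eq_bot, LinearMap.ker_eq_bot']
      rintro ⟨⟨α, β⟩, ⟨n, hn⟩, z, hz⟩ hx
      replace hx : α • e + β • f + n + z = 0 := hx
      have hfn : f * n = 0 := h.right_mul_eq_zero hn.1
      have hne : e * n = n := hn.1
      have h1 := congrArg (fun x => e * x) hx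
      simp only [mul_add, mul_smul_comm, h.idem₁, h.orth, hn.1, hz.1, mul_zero] at h1
      have h2 := congrArg (fun x => f * x) h1
      simp only [mul_add, mul_smul_comm, h.symm.orth, hfn, hz.2, mul_zero] at h2
      have hz0 : z = 0 := by simpa using h2
      subst hz0
      have h3 : α • e = -n := by linear_combination (norm := module) h1
      have h4 : (α ^ 2) • e = 0 := by
        have h5 : (α • e) * (α • e) = 0 := by
          rw [h3]
          exact (neg_mem hn : -n ∈ h.nil hr).2
        rw [← h5, smul_mul_assoc, mul_smul_comm, h.idem₁]
        module
      have hα : α = 0 := by simpa [h.ne₁] using h4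
      subst hα
      have hn0 : n = 0 := by simpa using h3.symm
      subst hn0
      have hβ : β = 0 := by simpa [h.ne₂] using hx
      subst hβ
      rfl
    · intro x
      obtain ⟨α, β, n, hn, m, hm, z, hz, rfl⟩ := h.decomp hr x
      rw [hf, Submodule.mem_bot] at hm
      exact ⟨⟨⟨α, β⟩, ⟨n, hn⟩, ⟨z, hz⟩⟩, by simp [F, hm]⟩
  have := (LinearEquiv.ofBijective F hF).finrank_eq
  simp only [Module.finrank_prod, finrank_self, hJ] at this
  omega

end Pair

/-! ### Classification with two complementary idempotents -/

section Pair

variable {J : Type*} [NonAssocCommRing J] [Module ℂ J] [IsScalarTower ℂ J J]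
  [SMulCommClass ℂ J J] [IsCommJordan J] {e f : J}

theorem IsPair.top_le_span (h : IsPair e f) (hr : HasRank J 3) (hf : h.symm.nil hr = ⊥)
    {a b c : J} (hn : ∀ n ∈ h.nil hr, n ∈ Submodule.span ℂ {a, b, c})
    (hz : ∀ z ∈ peirceSpace e f, z ∈ Submodule.span ℂ {a, b, c}) :
    ⊤ ≤ Submodule.span ℂ (Set.range ![e, f, a, b, c]) := by
  intro x _
  rw [Submodule.mem_span_range_iff_exists_fun]
  obtain ⟨s, t, n, hn', m, hm, z, hz', rfl⟩ := h.decomp hr x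
  rw [hf, Submodule.mem_bot] at hm
  obtain ⟨p, q, r, hpqr⟩ := Submodule.mem_span_triple.1 (add_mem (hn n hn') (hz z hz'))
  refine ⟨![s, t, p, q, r], ?_⟩
  simp only [Fin.sum_univ_five, Matrix.cons_val]
  linear_combination (norm := (simp only [hm]; module)) hpqr

/-- If the generator a kills the half-space, the product there is a symmetric form times a, and its
rank selects index 5, 6 or 7. Otherwise d = az ≠ 0 and ad = 0, and the polarized identities force z²
= zd = d² = 0, which is index 8. -/
theorem IsPair.exists_isomorphic_of_finrank_one (h : IsPair e f) (hr : HasRank J 3)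
    (hf : h.symm.nil hr = ⊥) (hJ : finrank ℂ J = 5) (hn : finrank ℂ (h.nil hr) = 1) :
    ∃ k, Isomorphic J (J5 k) := by
  have : FiniteDimensional ℂ J := .of_finrank_pos (by omega)
  have hM : finrank ℂ (peirceSpace e f) = 2 := by
    have := h.finrank_add_finrank hr hf hJ
    omega
  obtain ⟨⟨a, ha⟩, ha0, ha'⟩ := finrank_eq_one_iff'.1 hn
  replace ha0 : a ≠ 0 := fun h0 => ha0 (Subtype.ext h0)
  replace ha' : ∀ n ∈ h.nil hr, ∃ c : ℂ, n = c • a := fun n hn =>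
    (ha' ⟨n, hn⟩).imp fun c hc => (congrArg Subtype.val hc).symm
  have hea : e * a = a := ha.1
  have hfa : f * a = 0 := h.right_mul_eq_zero hea
  have haa : a * a = 0 := ha.2
  have hna : ∀ x y : J, ∀ n ∈ h.nil hr, n ∈ Submodule.span ℂ {a, x, y} := by
    intro x y n hn
    obtain ⟨c, rfl⟩ := ha' n hn
    exact Submodule.smul_mem _ _ (Submodule.subset_span (by simp))
  by_cases hact : ∀ z ∈ peirceSpace e f, a * z = 0
  · obtain ⟨φ, hφ⟩ : ∃ φ : J →ₗ[ℂ] ℂ, φ a = 1 := by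
      obtain ⟨φ, hφ⟩ := Module.Projective.exists_dual_ne_zero ℂ ha0
      exact ⟨(φ a)⁻¹ • φ, by simp [hφ]⟩
    obtain ⟨r, hr2, b, hb⟩ := exists_basis_sum_squares
      (((LinearMap.mul ℂ J).compr₂ φ).domRestrict₁₂ (peirceSpace e f) (peirceSpace e f))
      (fun x y => congrArg φ (mul_comm (x : J) y)) hM
    have hbb : ∀ i j, (b i : J) * b j = if i = j ∧ i.val < r then a else 0 := by
      intro i j
      have := hb i j
      simp only [LinearMap.domRestrict₁₂_apply, LinearMap.compr₂_apply,
        LinearMap.mul_apply'] at this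
      obtain ⟨c, hc⟩ := ha' _ (h.mul_mem hr hf (b i).2 (b j).2)
      rw [hc, map_smul, hφ, smul_eq_mul, mul_one] at this
      rw [hc, this]
      split_ifs <;> simp
    have heb : ∀ i, e * (b i : J) = (1 / 2 : ℂ) • (b i : J) := fun i => (b i).2.1
    have hfb : ∀ i, f * (b i : J) = (1 / 2 : ℂ) • (b i : J) := fun i => (b i).2.2
    have hab : ∀ i, a * (b i : J) = 0 := fun i => hact _ (b i).2
    have hspan : ⊤ ≤ Submodule.span ℂ (Set.range ![e, f, a, (b 0 : J), b 1]) := by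
      refine h.top_le_span hr hf (hna _ _) fun z hz => ?_
      have := congrArg (fun z : peirceSpace e f => (z : J)) (b.sum_repr ⟨z, hz⟩)
      simp only [Fin.sum_univ_two, Submodule.coe_add, Submodule.coe_smul] at this
      exact Submodule.mem_span_triple.2 ⟨0, _, _, by rw [zero_smul, zero_add]; exact this⟩
    have hcases : r = 0 ∨ r = 1 ∨ r = 2 := by omega
    rcases hcases with rfl | rfl | rfl
    · refine ⟨5, isomorphic_of_mul_eq hJ 5 _ hspan fun i j hij => ?_⟩
      change _ = ∑ l, mul6 _ _ _ • _
      fin_cases i <;> fin_cases j <;> simp [Fin.sum_univ_five, mul6, hbb, h.idem₁, h.idem₂,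
        h.orth, hea, hfa, haa, heb, hfb, hab] at hij ⊢
    · refine ⟨6, isomorphic_of_mul_eq hJ 6 _ hspan fun i j hij => ?_⟩
      change _ = ∑ l, mul7 _ _ _ • _
      fin_cases i <;> fin_cases j <;> simp [Fin.sum_univ_five, mul7, hbb, h.idem₁, h.idem₂,
        h.orth, hea, hfa, haa, heb, hfb, hab] at hij ⊢
    · refine ⟨7, isomorphic_of_mul_eq hJ 7 _ hspan fun i j hij => ?_⟩
      change _ = ∑ l, mul8 _ _ _ • _
      fin_cases i <;> fin_cases j <;> simp [Fin.sum_univ_five, mul8, hbb, h.idem₁, h.idem₂,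
        h.orth, hea, hfa, haa, heb, hfb, hab] at hij ⊢
  · push Not at hact
    obtain ⟨z, hz, hd0⟩ := hact
    set d := a * z with hd
    have hdM : d ∈ peirceSpace e f := h.mul_mem_peirceSpace hea hz
    have had : a * d = 0 := h.nil_mul_nil_mul hr ha hz
    obtain ⟨p, hp⟩ := ha' _ (h.mul_self_mem hr hf hz)
    obtain ⟨q, hq⟩ := ha' _ (h.mul_self_mem hr hf hdM)
    obtain ⟨r, hr'⟩ := ha' _ (h.mul_mem hr hf hz hdM)
    have t1 := h.mul_self_mul hr hf hz
    have t2 := h.mul_self_mul_add hr hf hz hdM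
    have t3 := h.mul_self_mul_add hr hf hdM hz
    simp only [mul_comm d z, hp, hq, hr', smul_mul_assoc, ← hd, had, smul_zero, zero_add,
      add_zero] at t1 t2 t3
    have hp0 : p = 0 := by simpa [hd0] using t1
    have hq0 : q = 0 := by simpa [hd0] using t3
    have hr0 : r = 0 := by simpa [hd0] using t2
    rw [hp0, zero_smul] at hp
    rw [hq0, zero_smul] at hq
    rw [hr0, zero_smul] at hr'
    have hLI : LinearIndependent ℂ ![d, z] := by
      rw [LinearIndependent.pair_iff' hd0]
      intro c hc
      have h1 : a * (c • d) = d := by rw [hc]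
      rw [mul_smul_comm, had, smul_zero] at h1
      exact hd0 h1.symm
    have hspan : ⊤ ≤ Submodule.span ℂ (Set.range ![e, f, a, z, d]) := by
      refine h.top_le_span hr hf (hna _ _) fun x hx => ?_
      obtain ⟨c, hc⟩ := exists_coeff_of_linearIndependent hM hLI
        (by
          intro i
          fin_cases i
          exacts [hdM, hz]) hx
      simp only [Fin.sum_univ_two, Matrix.cons_val] at hc
      exact Submodule.mem_span_triple.2 ⟨0, c 1, c 0, by rw [hc]; module⟩
    refine ⟨8, isomorphic_of_mul_eq hJ 8 _ hspan fun i j hij => ?_⟩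
    change _ = ∑ l, mul9 _ _ _ • _
    clear_value d
    fin_cases i <;> fin_cases j <;> simp [Fin.sum_univ_five, mul9, h.idem₁, h.idem₂,
      h.orth, hea, hfa, haa, hz.1, hz.2, hdM.1, hdM.2, ← hd, had, hp, hq, hr'] at hij ⊢

/-- On a half-space of dimension one the nil part acts by nilpotent scalars, hence by zero. What
remains is whether d² vanishes; if not, it is taken as the basis vector a. -/
theorem IsPair.exists_isomorphic_of_finrank_two (h : IsPair e f) (hr : HasRank J 3)
    (hf : h.symm.nil hr = ⊥) (hJ : finrank ℂ J = 5) (hn : finrank ℂ (h.nil hr) = 2) :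
    ∃ k, Isomorphic J (J5 k) := by
  have : FiniteDimensional ℂ J := .of_finrank_pos (by omega)
  have hM : finrank ℂ (peirceSpace e f) = 1 := by
    have := h.finrank_add_finrank hr hf hJ
    omega
  obtain ⟨⟨d, hd⟩, hd0, hd'⟩ := finrank_eq_one_iff'.1 hM
  replace hd0 : d ≠ 0 := fun h0 => hd0 (Subtype.ext h0)
  replace hd' : ∀ z ∈ peirceSpace e f, ∃ c : ℂ, z = c • d := fun n hn =>
    (hd' ⟨n, hn⟩).imp fun c hc => (congrArg Subtype.val hc).symm
  have hnd : ∀ n ∈ h.nil hr, n * d = 0 := by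
    intro n hn
    obtain ⟨c, hc⟩ := hd' _ (h.mul_mem_peirceSpace hn.1 hd)
    have h1 := h.nil_mul_nil_mul hr hn hd
    rw [hc, mul_smul_comm, hc, smul_smul] at h1
    have hc0 : c = 0 := by simpa [hd0] using h1
    rw [hc, hc0, zero_smul]
  have key : ∃ a ∈ h.nil hr, a ≠ 0 ∧ (d * d = 0 ∨ d * d = a) := by
    by_cases hdd : d * d = 0
    · obtain ⟨a, ha, ha0⟩ := Submodule.exists_mem_ne_zero_of_ne_bot (h.nil_ne_bot hr hf)
      exact ⟨a, ha, ha0, .inl hdd⟩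
    · exact ⟨d * d, h.mul_self_mem hr hf hd, hdd, .inr rfl⟩
  obtain ⟨a, ha, ha0, hdd⟩ := key
  obtain ⟨b, hb, hab⟩ : ∃ b ∈ h.nil hr, ∀ c : ℂ, c • a ≠ b := by
    by_contra! hc
    have : finrank ℂ (h.nil hr) ≤ 1 := finrank_le_one ⟨a, ha⟩ fun ⟨b, hb⟩ =>
      (hc b hb).imp fun c hc => Subtype.ext hc
    omega
  have hLI : LinearIndependent ℂ ![a, b] := (LinearIndependent.pair_iff' ha0).2 hab
  have hspan : ⊤ ≤ Submodule.span ℂ (Set.range ![e, f, a, b, d]) := by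
    refine h.top_le_span hr hf (fun x hx => ?_) fun z hz => ?_
    · obtain ⟨c, hc⟩ := exists_coeff_of_linearIndependent hn hLI
        (by
          intro i
          fin_cases i
          exacts [ha, hb]) hx
      simp only [Fin.sum_univ_two, Matrix.cons_val] at hc
      exact Submodule.mem_span_triple.2 ⟨c 0, c 1, 0, by rw [hc]; module⟩
    · obtain ⟨c, rfl⟩ := hd' z hz
      exact Submodule.smul_mem _ _ (Submodule.subset_span (by simp))
  have hea : e * a = a := ha.1
  have hfa : f * a = 0 := h.right_mul_eq_zero hea
  have haa : a * a = 0 := ha.2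
  have heb : e * b = b := hb.1
  have hfb : f * b = 0 := h.right_mul_eq_zero heb
  have hbb : b * b = 0 := hb.2
  have hab' : a * b = 0 := h.nil_mul_nil hr hea haa heb hbb
  rcases hdd with hdd | hdd
  · refine ⟨9, isomorphic_of_mul_eq hJ 9 _ hspan fun i j hij => ?_⟩
    change _ = ∑ l, mul10 _ _ _ • _
    fin_cases i <;> fin_cases j <;> simp [Fin.sum_univ_five, mul10, h.idem₁, h.idem₂,
      h.orth, hea, hfa, haa, heb, hfb, hbb, hab', hd.1, hd.2, hdd, hnd a ha, hnd b hb] at hij ⊢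
  · refine ⟨10, isomorphic_of_mul_eq hJ 10 _ hspan fun i j hij => ?_⟩
    change _ = ∑ l, mul11 _ _ _ • _
    fin_cases i <;> fin_cases j <;> simp [Fin.sum_univ_five, mul11, h.idem₁, h.idem₂,
      h.orth, hea, hfa, haa, heb, hfb, hbb, hab', hd.1, hd.2, hdd, hnd a ha, hnd b hb] at hij ⊢

theorem IsPair.isomorphic_of_finrank_three (h : IsPair e f) (hr : HasRank J 3)
    (hf : h.symm.nil hr = ⊥) (hJ : finrank ℂ J = 5) (hn : finrank ℂ (h.nil hr) = 3) :
    Isomorphic J (J5 11) := by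
  have : FiniteDimensional ℂ J := .of_finrank_pos (by omega)
  have hM : finrank ℂ (peirceSpace e f) = 0 := by
    have := h.finrank_add_finrank hr hf hJ
    omega
  rw [Submodule.finrank_eq_zero] at hM
  let b := finBasisOfFinrankEq ℂ (h.nil hr) hn
  have heb : ∀ i, e * (b i : J) = b i := fun i => (b i).2.1
  have hfb : ∀ i, f * (b i : J) = 0 := fun i => h.right_mul_eq_zero (heb i)
  have hbb : ∀ i j, (b i : J) * b j = 0 := fun i j =>
    h.nil_mul_nil hr (b i).2.1 (b i).2.2 (b j).2.1 (b j).2.2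
  have hspan : ⊤ ≤ Submodule.span ℂ (Set.range ![e, f, (b 0 : J), b 1, b 2]) := by
    refine h.top_le_span hr hf (fun x hx => ?_) fun z hz => ?_
    · have := congrArg (fun z : h.nil hr => (z : J)) (b.sum_repr ⟨x, hx⟩)
      simp only [Fin.sum_univ_three, Submodule.coe_add, Submodule.coe_smul] at this
      exact Submodule.mem_span_triple.2 ⟨_, _, _, this⟩
    · rw [hM, Submodule.mem_bot] at hz
      rw [hz]
      exact zero_mem _
  refine isomorphic_of_mul_eq hJ 11 _ hspan fun i j hij => ?_
  change _ = ∑ l, mul12 _ _ _ • _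
  fin_cases i <;> fin_cases j <;> simp [Fin.sum_univ_five, mul12, h.idem₁, h.idem₂,
    h.orth, heb, hfb, hbb] at hij ⊢

theorem IsPair.exists_isomorphic (h : IsPair e f) (hr : HasRank J 3) (hJ : finrank ℂ J = 5) :
    ∃ k, Isomorphic J (J5 k) := by
  have : FiniteDimensional ℂ J := .of_finrank_pos (by omega)
  -- At most one nil part is nonzero, so exchanging e and f puts it at e.
  wlog hf : h.symm.nil hr = ⊥ generalizing e f
  · exact this h.symm ((h.nil_eq_bot hr).resolve_right hf)
  have h1 := h.finrank_add_finrank hr hf hJ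
  have h2 : finrank ℂ (h.nil hr) ≠ 0 := fun h0 =>
    h.nil_ne_bot hr hf (Submodule.finrank_eq_zero.1 h0)
  have h3 : finrank ℂ (h.nil hr) = 1 ∨ finrank ℂ (h.nil hr) = 2 ∨ finrank ℂ (h.nil hr) = 3 := by
    omega
  rcases h3 with h3 | h3 | h3
  · exact h.exists_isomorphic_of_finrank_one hr hf hJ h3
  · exact h.exists_isomorphic_of_finrank_two hr hf hJ h3
  · exact ⟨11, h.isomorphic_of_finrank_three hr hf hJ h3⟩

/-- Every Jordan algebra of dimension five and rank three is one of the sixteen algebras. -/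
theorem exists_isomorphic (hJ : finrank ℂ J = 5) (hr : HasRank J 3) :
    ∃ k, Isomorphic J (J5 k) := by
  by_cases hidem : ∀ e : J, e * e = e → e = 0 ∨ e = 1
  · exact exists_isomorphic_of_trivial_idempotents hJ hr hidem
  by_cases htriple : ∃ e₁ e₂ e₃ : J, IsTriple e₁ e₂ e₃
  · obtain ⟨e₁, e₂, e₃, h⟩ := htriple
    exact h.exists_isomorphic hr hJ
  · push Not at hidem htriple
    obtain ⟨e, he, he0, he1⟩ := hidem
    have h : IsPair e (1 - e) := ⟨he, by simp [mul_sub, sub_mul, he], by simp [mul_sub, he], he0,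
      sub_ne_zero.2 he1.symm, by abel, htriple⟩
    exact h.exists_isomorphic hr hJ

theorem Isomorphic.symm_trans {J J' J'' : Type*} [NonAssocCommRing J] [Module ℂ J]
    [NonAssocCommRing J'] [Module ℂ J'] [NonAssocCommRing J''] [Module ℂ J'']
    (h : Isomorphic J J') (h' : Isomorphic J J'') : Isomorphic J' J'' := by
  obtain ⟨f, hf⟩ := h
  obtain ⟨g, hg⟩ := h'
  refine ⟨f.symm ≪≫ₗ g, fun x y => ?_⟩
  have : f.symm (x * y) = f.symm x * f.symm y := f.injective (by simp [hf])
  simp [this, hg]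

end Pair

end Jordan3

end

/-! ### The classification theorem -/

theorem mainTheorem2 :
    (∀ k : Fin 16,
      IsCommJordan (Jordan3.J5 k) ∧
      Module.finrank ℂ (Jordan3.J5 k) = 5 ∧
      Jordan3.HasRank (Jordan3.J5 k) 3 ∧
      ∃ R : Submodule ℂ (Jordan3.J5 k), Jordan3.IsRadical R ∧
        Module.finrank ℂ R = (![4, 4, 4, 4, 4, 3, 3, 3, 3, 3, 3, 3, 2, 2, 1, 0] : Fin 16 → ℕ) k) ∧
    (∀ k l : Fin 16, Jordan3.Isomorphic (Jordan3.J5 k) (Jordan3.J5 l) → k = l) ∧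
    (∀ (J : Type*) [NonAssocCommRing J] [Module ℂ J] [IsScalarTower ℂ J J] [SMulCommClass ℂ J J]
      [IsCommJordan J],
      Module.finrank ℂ J = 5 → Jordan3.HasRank J 3 →
        ∃! k : Fin 16, Jordan3.Isomorphic J (Jordan3.J5 k)) := by
  refine ⟨fun k => ?_, Jordan3.eq_of_isomorphic, fun J _ _ _ _ _ hJ hr => ?_⟩
  · obtain ⟨h1, h2, h3, R, hR, hd⟩ := Jordan3.J5_spec k
    refine ⟨h1, h2, h3, R, hR, hd.trans ?_⟩
    fin_cases k <;> rfl
  · obtain ⟨k, hk⟩ := Jordan3.exists_isomorphic hJ hr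
    exact ⟨k, hk, fun l hl => Jordan3.eq_of_isomorphic l k (hl.symm_trans hk)⟩
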